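/- Let $G$ be a connected semisimple real algebraic group, that is, the identity component of the group of real points of a semisimple linear algebraic group over $\mathbb R$. Let $\theta$ be a Cartan involution of its Lie algebra $\mathfrak g$, with $+1$ and $-1$ eigenspaces $\mathfrak k$ and $\mathfrak p$, let $K<G$ be the maximal compact subgroup with Lie algebra $\mathfrak k$, let $\mathfrak a\subset\mathfrak p$ be a maximal abelian subalgebra, and let $\mathfrak a^+\subset\mathfrak a$ be a closed positive Weyl chamber. Write $a_u=\exp u$ for $u\in\mathfrak a$, $A=\exp\mathfrak a$, let $M$ be the centralizer of $A$ in $K$, let $$N=\{g\in G:\ a^{-k}ga^{k}\to e \text{ as } k\to+\infty\}\qquad (a\in\exp(\operatorname{int}\mathfrak a^+)),$$ and put $P=MAN$, $\mathcal F=G/P$, $o=K\in G/K$. Let $\|\cdot\|$ be the norm on $\mathfrak a$ induced by the Killing form. For $g\in G$ and $\xi=kP\in\mathcal F$ with $k\in K$, let $\sigma(g,\xi)\in\mathfrak a$ be the element with $gk\in K\exp(\sigma(g,\xi))N$, and let $\beta_\xi(ho,go)=\sigma(h^{-1},\xi)-\sigma(g^{-1},\xi)$ for $g,h\in G$. The Jordan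 projection $\lambda(g)\in\mathfrak a^+$ of $g\in G$ is the element such that the hyperbolic part $g_h$ in the Jordan decomposition $g=g_hg_eg_u$ (commuting product of a hyperbolic, an elliptic and a unipotent element) is conjugate in $G$ to $\exp\lambda(g)$. Let $\Gamma<G$ be a Zariski dense discrete subgroup. For $u\in\mathfrak a^+$, a point $\xi\in\mathcal F$ is called $u$-horospherical if for some $p\in G/K$ there are $R>0$ and a sequence $\gamma_j\in\Gamma$ such that $\beta_\xi(p,\gamma_jp)\to\infty$ and $\|\beta_\xi(p,\gamma_jp)-\mathbb R_+u\|<R$ for all $j$ (the distance from $\beta_\xi(p,\gamma_jp)$ to the ray $\mathbb R_+u$). For $x=[g]\in\Gamma\backslash G$, we say that $x^+$ is $u$-horospherical if $gP$ is; this does not depend on the choice of $g$. A point $x_0\in\Gamma\backslash G$ is called $u$-periodic if $x_0a_u=x_0m_0$ for some $m_0\in M$. Let $x\in\Gamma\backslash G$ and let $u\in\lambda(\Gamma)\cap\operatorname{int}\mathfrak a^+$. If $x^+$ is $u$-horospherical, then the closure of $xN$ in $\Gamma\backslash G$ contains a $u$-periodic point. -/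

import Mathlib

open Filter Topology
open scoped MatrixGroups

attribute [local instance] LieRing.ofAssociativeRing

noncomputable section

/-! ### Powers converging to the exponential -/

theorem norm_pow_sub_pow_le_aux {E : Type*} [NormedRing E] [NormOneClass E] (a b : E) (M : ℝ)
    (hM : 1 ≤ M) (ha : ‖a‖ ≤ M) (hb : ‖b‖ ≤ M) (k : ℕ) :
    ‖a ^ k - b ^ k‖ ≤ k * M ^ k * ‖a - b‖ := by
  induction k with
  | zero => simp
  | succ k ih =>
    have h : a ^ (k + 1) - b ^ (k + 1) = a ^ k * (a - b) + (a ^ k - b ^ k) * b := by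
      rw [pow_succ, pow_succ]; noncomm_ring
    have h1 : ‖a ^ k * (a - b)‖ ≤ M ^ (k + 1) * ‖a - b‖ := by
      refine (norm_mul_le _ _).trans (mul_le_mul_of_nonneg_right ?_ (norm_nonneg _))
      refine (norm_pow_le a k).trans ((pow_le_pow_left₀ (norm_nonneg _) ha k).trans ?_)
      exact pow_le_pow_right₀ hM (Nat.le_succ k)
    have h2 : ‖(a ^ k - b ^ k) * b‖ ≤ (k * M ^ k * ‖a - b‖) * M :=
      (norm_mul_le _ _).trans (mul_le_mul ih hb (norm_nonneg _) (by positivity))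
    rw [h]
    refine (norm_add_le _ _).trans ((add_le_add h1 h2).trans (le_of_eq ?_))
    push_cast; ring

theorem tendsto_pow_exp_aux {E : Type*} [NormedRing E] [NormOneClass E] [NormedAlgebra ℝ E]
    [CompleteSpace E] (c : ℝ → E) (X : E) (hc : HasDerivAt c X 0) (h0 : c 0 = 1) :
    Tendsto (fun k : ℕ => c (1 / (k : ℝ)) ^ k) atTop (𝓝 (NormedSpace.exp X)) := by
  have he : HasDerivAt (fun t : ℝ => NormedSpace.exp (t • X)) X 0 := by
    simpa using hasDerivAt_exp_smul_const (𝕂 := ℝ) X (0 : ℝ)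
  have hinv : Tendsto (fun k : ℕ => 1 / (k : ℝ)) atTop (𝓝 0) := tendsto_one_div_atTop_nhds_zero_nat
  set C : ℝ := ‖X‖ + 1 with hC
  have hC0 : 0 < C := by positivity
  have bound : ∀ f : ℝ → E, HasDerivAt f X 0 → f 0 = 1 →
      ∀ᶠ k : ℕ in atTop, ‖f (1 / (k : ℝ))‖ ≤ 1 + C / k := by
    intro f hf hf0
    have := (hf.isLittleO.def one_pos)
    have := hinv.eventually this
    filter_upwards [this, eventually_gt_atTop 0] with k hk hk0
    have hk0' : (0 : ℝ) < k := by exact_mod_cast hk0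
    rw [hf0, sub_zero, one_mul, Real.norm_of_nonneg (by positivity)] at hk
    have e : f (1 / (k : ℝ)) = (f (1 / (k : ℝ)) - 1 - (1 / (k : ℝ)) • X) + 1 + (1 / (k : ℝ)) • X := by
      abel
    rw [e]
    refine (norm_add₃_le).trans ?_
    rw [norm_one, norm_smul, Real.norm_of_nonneg (by positivity)]
    calc _ ≤ 1 / (k : ℝ) + 1 + 1 / k * ‖X‖ := by gcongr
      _ = 1 + C / k := by rw [hC]; ring
  have hd : Tendsto (fun k : ℕ => (k : ℝ) * ‖c (1 / (k : ℝ)) - NormedSpace.exp ((1 / (k : ℝ)) • X)‖)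
      atTop (𝓝 0) := by
    have h := (hc.sub he).isLittleO
    simp only [sub_self, smul_zero, sub_zero, zero_smul, NormedSpace.exp_zero, h0, Pi.sub_apply] at h
    have h2 := (h.comp_tendsto hinv).norm_left.tendsto_div_nhds_zero
    refine h2.congr fun k => ?_
    simp only [Function.comp_apply, div_div_eq_mul_div, div_one]
    ring
  have key : Tendsto (fun k : ℕ => c (1 / (k : ℝ)) ^ k -
      NormedSpace.exp ((1 / (k : ℝ)) • X) ^ k) atTop (𝓝 0) := by
    have h3 := hd.const_mul (Real.exp C)
    rw [mul_zero] at h3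
    refine squeeze_zero_norm' ?_ h3
    filter_upwards [bound c hc h0, bound _ he (by simp), eventually_gt_atTop 0] with k h1 h2 hk0
    have hk0' : (0 : ℝ) < k := by exact_mod_cast hk0
    refine (norm_pow_sub_pow_le_aux _ _ (1 + C / k) (by simpa using by positivity) h1 h2 k).trans ?_
    have h4 : (1 + C / k) ^ k ≤ Real.exp C := by
      have := Real.add_one_le_exp (C / k)
      calc (1 + C / k) ^ k ≤ (Real.exp (C / k)) ^ k := by
            gcongr; linarith
        _ = Real.exp C := by rw [← Real.exp_nat_mul]; congr 1; field_simp
    calc _ = (1 + C / k) ^ k * (k * ‖c (1 / (k : ℝ)) - NormedSpace.exp ((1 / (k : ℝ)) • X)‖) := by ring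
      _ ≤ _ := by gcongr
  have h5 := key.add_const (NormedSpace.exp X)
  rw [zero_add] at h5
  refine h5.congr' ?_
  filter_upwards [eventually_gt_atTop 0] with k hk0
  let _ : NormedAlgebra ℚ E := NormedAlgebra.restrictScalars ℚ ℝ E
  rw [← NormedSpace.exp_nsmul, ← Nat.cast_smul_eq_nsmul ℝ, smul_smul,
    mul_one_div_cancel (by exact_mod_cast hk0.ne'), one_smul]
  abel

theorem tendsto_exp_mul_exp_pow {E : Type*} [NormedRing E] [NormOneClass E] [NormedAlgebra ℝ E]
    [CompleteSpace E] (X Y : E) :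
    Tendsto (fun k : ℕ => (NormedSpace.exp ((1 / (k : ℝ)) • X) *
      NormedSpace.exp ((1 / (k : ℝ)) • Y)) ^ k) atTop (𝓝 (NormedSpace.exp (X + Y))) := by
  refine tendsto_pow_exp_aux (fun t : ℝ => NormedSpace.exp (t • X) * NormedSpace.exp (t • Y))
    (X + Y) ?_ (by simp)
  have h1 := hasDerivAt_exp_smul_const (𝕂 := ℝ) X (0 : ℝ)
  have h2 := hasDerivAt_exp_smul_const (𝕂 := ℝ) Y (0 : ℝ)
  have h3 := h1.mul h2
  simp only [zero_smul, NormedSpace.exp_zero, one_mul, mul_one] at h3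
  exact h3

theorem tendsto_slope_exp_conj {E : Type*} [NormedRing E] [NormedAlgebra ℝ E]
    [CompleteSpace E] (X Y : E) :
    Tendsto (fun t : ℝ => t⁻¹ • (NormedSpace.exp (t • X) * Y * NormedSpace.exp (t • -X) - Y))
      (𝓝[≠] 0) (𝓝 (X * Y - Y * X)) := by
  have h1 := (hasDerivAt_exp_smul_const (𝕂 := ℝ) X (0 : ℝ)).mul_const Y
  have h2 := hasDerivAt_exp_smul_const (𝕂 := ℝ) (-X) (0 : ℝ)
  have h3 := (h1.mul h2).tendsto_slope_zero
  simpa [sub_eq_add_neg] using h3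

/-! ### Connected real algebraic groups and their Lie algebras -/

/-- `S ⊆ GL_n(ℝ)` is cut out by polynomial equations in the matrix entries. -/
def IsZariskiClosed {n : ℕ} (S : Set (GL (Fin n) ℝ)) : Prop :=
  ∃ I : Set (MvPolynomial (Fin n × Fin n) ℝ),
    S = {g : GL (Fin n) ℝ | ∀ p ∈ I, MvPolynomial.eval (fun ij => (g : Matrix (Fin n) (Fin n) ℝ) ij.1 ij.2) p = 0}

/-- A connected (linear) real algebraic group: the identity component, for the Hausdorff topology,
of a Zariski closed subgroup of `GL_n(ℝ)`. -/
structure ConnectedRealAlgebraicGroup (n : ℕ) where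
  toSubgroup : Subgroup (GL (Fin n) ℝ)
  isIdentityComponent : ∃ H : Subgroup (GL (Fin n) ℝ), IsZariskiClosed (H : Set (GL (Fin n) ℝ)) ∧
    toSubgroup = (Subgroup.connectedComponentOfOne H).map H.subtype

theorem IsZariskiClosed.isClosed {n : ℕ} {S : Set (GL (Fin n) ℝ)} (hS : IsZariskiClosed S) :
    IsClosed S := by
  obtain ⟨I, rfl⟩ := hS
  simp only [Set.ofPred_forall]
  refine isClosed_biInter fun p _ => isClosed_eq ?_ continuous_const
  refine (MvPolynomial.continuous_eval p).comp (continuous_pi fun ij => ?_)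
  exact Units.continuous_val.matrix_elem ij.1 ij.2

/-- The matrix exponential with values in `GL_n(ℝ)`. -/
def expGL {n : ℕ} (X : Matrix (Fin n) (Fin n) ℝ) : GL (Fin n) ℝ where
  val := NormedSpace.exp X
  inv := NormedSpace.exp (-X)
  val_inv := by
    rw [← Matrix.exp_add_of_commute _ _ (Commute.refl X).neg_right, add_neg_cancel,
      NormedSpace.exp_zero]
  inv_val := by
    rw [← Matrix.exp_add_of_commute _ _ (Commute.refl X).neg_left, neg_add_cancel,
      NormedSpace.exp_zero]

theorem expGL_zero {n : ℕ} : expGL (0 : Matrix (Fin n) (Fin n) ℝ) = 1 :=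
  Units.ext NormedSpace.exp_zero

theorem expGL_add {n : ℕ} {X Y : Matrix (Fin n) (Fin n) ℝ} (h : Commute X Y) :
    expGL (X + Y) = expGL X * expGL Y :=
  Units.ext (Matrix.exp_add_of_commute _ _ h)

theorem expGL_conj {n : ℕ} (g : GL (Fin n) ℝ) (X : Matrix (Fin n) (Fin n) ℝ) :
    expGL ((g : Matrix (Fin n) (Fin n) ℝ) * X * ((g⁻¹ : GL (Fin n) ℝ) : Matrix (Fin n) (Fin n) ℝ)) = g * expGL X * g⁻¹ :=
  Units.ext (Matrix.exp_units_conj g X)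

section LieAlgebra

attribute [local instance] Matrix.linftyOpNormedRing Matrix.linftyOpNormedAlgebra

/-- The Lie product formula, with values in a closed subgroup. -/
theorem expGL_add_mem {n : ℕ} {G : Subgroup (GL (Fin n) ℝ)} (hG : IsClosed (G : Set (GL (Fin n) ℝ)))
    {X Y : Matrix (Fin n) (Fin n) ℝ} (hX : ∀ t : ℝ, expGL (t • X) ∈ G)
    (hY : ∀ t : ℝ, expGL (t • Y) ∈ G) : expGL (X + Y) ∈ G := by
  rcases isEmpty_or_nonempty (Fin n) with h | h
  · have : expGL (X + Y) = 1 := Units.ext (Subsingleton.elim _ _)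
    exact this ▸ G.one_mem
  have ht := tendsto_exp_mul_exp_pow X Y
  have ht' : Tendsto (fun k : ℕ => (expGL ((1 / (k : ℝ)) • X) * expGL ((1 / (k : ℝ)) • Y)) ^ k)
      atTop (𝓝 (expGL (X + Y))) :=
    (Units.isOpenEmbedding_val.isEmbedding.tendsto_nhds_iff).2 ht
  exact hG.mem_of_tendsto ht' (Eventually.of_forall fun k =>
    G.pow_mem (G.mul_mem (hX _) (hY _)) k)

/-- The space of `X` with `exp (tX) ∈ G` for all `t`. -/
def lieSubspace {n : ℕ} (G : Subgroup (GL (Fin n) ℝ)) (hG : IsClosed (G : Set (GL (Fin n) ℝ))) :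
    Submodule ℝ (Matrix (Fin n) (Fin n) ℝ) where
  carrier := {X | ∀ t : ℝ, expGL (t • X) ∈ G}
  zero_mem' t := by rw [smul_zero, expGL_zero]; exact G.one_mem
  add_mem' {X Y} hX hY t := by
    rw [smul_add]
    exact expGL_add_mem hG (fun s => by rw [smul_smul]; exact hX _)
      (fun s => by rw [smul_smul]; exact hY _)
  smul_mem' c X hX t := by rw [smul_smul]; exact hX _

theorem lieSubspace_lie_mem {n : ℕ} (G : Subgroup (GL (Fin n) ℝ))
    (hG : IsClosed (G : Set (GL (Fin n) ℝ))) {X Y : Matrix (Fin n) (Fin n) ℝ}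
    (hX : X ∈ lieSubspace G hG) (hY : Y ∈ lieSubspace G hG) : ⁅X, Y⁆ ∈ lieSubspace G hG := by
  have hmem : ∀ t : ℝ, NormedSpace.exp (t • X) * Y * NormedSpace.exp (t • -X) ∈ lieSubspace G hG := by
    intro t s
    have h := expGL_conj (expGL (t • X)) (s • Y)
    have e : s • (NormedSpace.exp (t • X) * Y * NormedSpace.exp (t • -X)) =
        (expGL (t • X) : Matrix (Fin n) (Fin n) ℝ) * (s • Y) *
          (((expGL (t • X))⁻¹ : GL (Fin n) ℝ) : Matrix (Fin n) (Fin n) ℝ) := by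
      change _ = NormedSpace.exp (t • X) * (s • Y) * NormedSpace.exp (-(t • X))
      rw [smul_neg, mul_smul_comm, smul_mul_assoc]
    rw [e, h]
    exact G.mul_mem (G.mul_mem (hX t) (hY s)) (G.inv_mem (hX t))
  have ht := tendsto_slope_exp_conj X Y
  have hclosed : IsClosed (lieSubspace G hG : Set (Matrix (Fin n) (Fin n) ℝ)) :=
    (lieSubspace G hG).closed_of_finiteDimensional
  exact hclosed.mem_of_tendsto ht (Eventually.of_forall fun t =>
    (lieSubspace G hG).smul_mem _ ((lieSubspace G hG).sub_mem (hmem t) hY))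

end LieAlgebra

namespace ConnectedRealAlgebraicGroup

variable {n : ℕ} (G : ConnectedRealAlgebraicGroup n)

theorem isClosed : IsClosed (G.toSubgroup : Set (GL (Fin n) ℝ)) := by
  obtain ⟨H, hH, h⟩ := G.isIdentityComponent
  rw [h, Subgroup.coe_map]
  exact hH.isClosed.isClosedEmbedding_subtypeVal.isClosedMap _ isClosed_connectedComponent

/-- The group itself, as a topological group. -/
abbrev Pts : Type := G.toSubgroup

/-- The Lie algebra `𝔤` of `G`. -/
def lieAlgebra : LieSubalgebra ℝ (Matrix (Fin n) (Fin n) ℝ) where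
  __ := lieSubspace G.toSubgroup G.isClosed
  lie_mem' hX hY := lieSubspace_lie_mem G.toSubgroup G.isClosed hX hY

/-- The exponential map `𝔤 → G`. -/
def exp (X : G.lieAlgebra) : G.Pts :=
  ⟨expGL (X : Matrix (Fin n) (Fin n) ℝ), by simpa using X.2 1⟩

theorem exp_zero : G.exp 0 = 1 := Subtype.ext expGL_zero

theorem exp_add {X Y : G.lieAlgebra} (h : ⁅X, Y⁆ = 0) : G.exp (X + Y) = G.exp X * G.exp Y := by
  refine Subtype.ext (expGL_add ?_)
  have h' := congrArg (Subtype.val) h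
  exact sub_eq_zero.1 h'

/-- `Γ` is Zariski dense in `G`: a polynomial in the matrix entries that vanishes on `Γ` vanishes
on `G`. -/
def IsZariskiDense (Γ : Subgroup G.Pts) : Prop :=
  ∀ p : MvPolynomial (Fin n × Fin n) ℝ,
    (∀ γ ∈ Γ, MvPolynomial.eval
      (fun ij => ((γ : GL (Fin n) ℝ) : Matrix (Fin n) (Fin n) ℝ) ij.1 ij.2) p = 0) →
    ∀ g : G.Pts, MvPolynomial.eval
      (fun ij => ((g : GL (Fin n) ℝ) : Matrix (Fin n) (Fin n) ℝ) ij.1 ij.2) p = 0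

/-- `Γ \ G`, with the quotient topology. -/
abbrev LeftQuotient (Γ : Subgroup G.Pts) : Type := Quotient (QuotientGroup.rightRel Γ)

/-- The point `[g] = Γ g` of `Γ \ G`. -/
def toQuotient (Γ : Subgroup G.Pts) (g : G.Pts) : G.LeftQuotient Γ := Quotient.mk _ g

/-- The right translation `x ↦ x h` of `Γ \ G`. -/
def translate {Γ : Subgroup G.Pts} (x : G.LeftQuotient Γ) (h : G.Pts) : G.LeftQuotient Γ :=
  Quotient.map (· * h) (fun a b hab => by
    have hab' := QuotientGroup.rightRel_apply.1 hab
    exact QuotientGroup.rightRel_apply.2 (by simpa [mul_assoc] using hab')) x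

/-- A nonzero linear functional `α` on `𝔞` with nonzero root space
`{X ∈ 𝔤 : [H, X] = α(H) X for all H ∈ 𝔞}`. -/
def IsRestrictedRoot (𝔞 : Submodule ℝ G.lieAlgebra) (α : 𝔞 →ₗ[ℝ] ℝ) : Prop :=
  α ≠ 0 ∧ ∃ X : G.lieAlgebra, X ≠ 0 ∧ ∀ H : 𝔞, ⁅(H : G.lieAlgebra), X⁆ = α H • X

/-- A closed Weyl chamber of `𝔞`: the closed chamber that contains some regular element `H₀`. -/
def IsClosedWeylChamber (𝔞 : Submodule ℝ G.lieAlgebra) (C : Set 𝔞) : Prop :=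
  ∃ H₀ : 𝔞, (∀ α, G.IsRestrictedRoot 𝔞 α → α H₀ ≠ 0) ∧
    C = {H | ∀ α, G.IsRestrictedRoot 𝔞 α → 0 < α H₀ → 0 ≤ α H}

/-- The choices fixed once and for all: a Cartan involution `θ` of `𝔤` with eigenspaces `𝔨` (for
`+1`) and `𝔭` (for `-1`), the maximal compact subgroup `K` with Lie algebra `𝔨`, a maximal abelian
subalgebra `𝔞` of `𝔭` and a closed positive Weyl chamber `𝔞⁺` of `𝔞`. -/
structure CartanData where
  θ : G.lieAlgebra ≃ₗ⁅ℝ⁆ G.lieAlgebra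
  θ_θ : ∀ X, θ (θ X) = X
  killing_neg : ∀ X, X ≠ 0 → killingForm ℝ G.lieAlgebra X (θ X) < 0
  K : Subgroup G.Pts
  K_maximal : Maximal (fun L : Subgroup G.Pts => IsCompact (L : Set G.Pts)) K
  K_lie : ∀ X, (∀ t : ℝ, G.exp (t • X) ∈ K) ↔ θ X = X
  𝔞 : Submodule ℝ G.lieAlgebra
  𝔞_maximal : Maximal (fun V : Submodule ℝ G.lieAlgebra =>
    (∀ X ∈ V, θ X = -X) ∧ ∀ X ∈ V, ∀ Y ∈ V, ⁅X, Y⁆ = 0) 𝔞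
  chamber : Set 𝔞
  isChamber : G.IsClosedWeylChamber 𝔞 chamber

namespace CartanData

variable {G} (D : G.CartanData)

theorem lie_eq_zero (u v : D.𝔞) : ⁅(u : G.lieAlgebra), (v : G.lieAlgebra)⁆ = 0 :=
  D.𝔞_maximal.prop.2 _ u.2 _ v.2

/-- `a_u = exp u` for `u ∈ 𝔞`. -/
def a (u : D.𝔞) : G.Pts := G.exp u

theorem a_zero : D.a 0 = 1 := G.exp_zero

theorem a_add (u v : D.𝔞) : D.a (u + v) = D.a u * D.a v := G.exp_add (D.lie_eq_zero u v)

theorem a_neg (u : D.𝔞) : D.a (-u) = (D.a u)⁻¹ := by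
  rw [eq_inv_iff_mul_eq_one, ← D.a_add, neg_add_cancel, D.a_zero]

/-- `A = exp 𝔞`. -/
def A : Subgroup G.Pts where
  carrier := Set.range D.a
  one_mem' := ⟨0, D.a_zero⟩
  mul_mem' := by
    rintro _ _ ⟨u, rfl⟩ ⟨v, rfl⟩
    exact ⟨u + v, D.a_add u v⟩
  inv_mem' := by
    rintro _ ⟨u, rfl⟩
    exact ⟨-u, D.a_neg u⟩

/-- `M` is the centralizer of `A` in `K`. -/
def M : Subgroup G.Pts := D.K ⊓ Subgroup.centralizer (D.A : Set G.Pts)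

/-- `N` is the maximal contracting horospherical subgroup: all `g` such that `a⁻ⁿ g aⁿ → e` for `a`
in the interior of `A⁺ = exp 𝔞⁺`. -/
def N : Subgroup G.Pts where
  carrier := {g | ∀ u ∈ interior D.chamber,
    Tendsto (fun k : ℕ => (D.a u ^ k)⁻¹ * g * D.a u ^ k) atTop (𝓝 1)}
  one_mem' u _ := by simp
  mul_mem' {g h} hg hh u hu := by
    have := (hg u hu).mul (hh u hu)
    rw [one_mul] at this
    refine this.congr fun k => ?_
    group
  inv_mem' {g} hg u hu := by
    have := (hg u hu).inv
    rw [inv_one] at this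
    refine this.congr fun k => ?_
    group

theorem conj_mem_N {g x : G.Pts} (hg : g ∈ Subgroup.centralizer (D.A : Set G.Pts)) (hx : x ∈ D.N) :
    g⁻¹ * x * g ∈ D.N := by
  intro u hu
  have h := ((hx u hu).const_mul g⁻¹).mul_const g
  rw [mul_one, inv_mul_cancel] at h
  refine h.congr fun k => ?_
  have hc : Commute g (D.a u ^ k) :=
    ((Subgroup.mem_centralizer_iff.1 hg (D.a u) ⟨u, rfl⟩ : D.a u * g = g * D.a u)).symm |>
      fun h' => Commute.pow_right h' k
  have h1 : g * D.a u ^ k = D.a u ^ k * g := hc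
  have h2 : (D.a u ^ k)⁻¹ * g⁻¹ = g⁻¹ * (D.a u ^ k)⁻¹ := by
    rw [← mul_inv_rev, ← mul_inv_rev, h1]
  calc g⁻¹ * ((D.a u ^ k)⁻¹ * x * D.a u ^ k) * g
      = (g⁻¹ * (D.a u ^ k)⁻¹) * x * (D.a u ^ k * g) := by group
    _ = _ := by rw [← h1, ← h2]; group

theorem A_le_centralizer : D.A ≤ Subgroup.centralizer (D.A : Set G.Pts) := by
  rintro _ ⟨u, rfl⟩
  rw [Subgroup.mem_centralizer_iff]
  rintro _ ⟨v, rfl⟩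
  rw [← D.a_add, ← D.a_add, add_comm]

/-- The minimal parabolic subgroup `P = MAN`. -/
def P : Subgroup G.Pts where
  carrier := {g | ∃ m ∈ D.M, ∃ a ∈ D.A, ∃ n ∈ D.N, g = m * a * n}
  one_mem' := ⟨1, D.M.one_mem, 1, D.A.one_mem, 1, D.N.one_mem, by simp⟩
  mul_mem' := by
    rintro _ _ ⟨m, hm, a, ha, x, hx, rfl⟩ ⟨m', hm', a', ha', x', hx', rfl⟩
    have hc : m' * a' ∈ Subgroup.centralizer (D.A : Set G.Pts) :=
      mul_mem hm'.2 (D.A_le_centralizer ha')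
    refine ⟨m * m', mul_mem hm hm', a * a', mul_mem ha ha', ((m' * a')⁻¹ * x * (m' * a')) * x',
      mul_mem (D.conj_mem_N hc hx) hx', ?_⟩
    have h1 : a * m' = m' * a := Subgroup.mem_centralizer_iff.1 hm'.2 a ha
    calc m * a * x * (m' * a' * x') = m * (a * m') * a' * ((m' * a')⁻¹ * x * (m' * a')) * x' := by
          group
      _ = _ := by rw [h1]; group
  inv_mem' := by
    rintro _ ⟨m, hm, a, ha, x, hx, rfl⟩
    have hc : (m * a)⁻¹ ∈ Subgroup.centralizer (D.A : Set G.Pts) :=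
      inv_mem (mul_mem hm.2 (D.A_le_centralizer ha))
    have h1 : a * m = m * a := Subgroup.mem_centralizer_iff.1 hm.2 a ha
    refine ⟨m⁻¹, inv_mem hm, a⁻¹, inv_mem ha, _, D.conj_mem_N hc (inv_mem hx), ?_⟩
    calc (m * a * x)⁻¹ = (a * m)⁻¹ * ((m * a)⁻¹⁻¹ * x⁻¹ * (m * a)⁻¹) := by rw [h1]; group
      _ = _ := by group

/-- The norm on `𝔞` induced by the Killing form, `‖v‖² = -B(v, θ v)`. -/
def norm (v : D.𝔞) : ℝ :=
  Real.sqrt (-killingForm ℝ G.lieAlgebra (v : G.lieAlgebra) (D.θ v))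

/-- The Furstenberg boundary `𝓕 = G / P`. -/
abbrev Boundary : Type := G.Pts ⧸ D.P

/-- `σ(g, ξ) = v` for the Iwasawa cocycle `σ`: `g k ∈ K exp(v) N`, where `ξ = [k]` with `k ∈ K`. -/
def IwasawaCocycleEq (g : G.Pts) (ξ : D.Boundary) (v : D.𝔞) : Prop :=
  ∃ k ∈ D.K, (k : D.Boundary) = ξ ∧ ∃ k' ∈ D.K, ∃ x ∈ D.N, g * k = k' * D.a v * x

/-- `β_ξ(ho, go) = v` for the `𝔞`-valued Busemann map `β_ξ(ho, go) = σ(h⁻¹, ξ) - σ(g⁻¹, ξ)`. -/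
def BusemannEq (ξ : D.Boundary) (h g : G.Pts) (v : D.𝔞) : Prop :=
  ∃ v₁ v₂ : D.𝔞, D.IwasawaCocycleEq h⁻¹ ξ v₁ ∧ D.IwasawaCocycleEq g⁻¹ ξ v₂ ∧ v = v₁ - v₂

/-- `ξ ∈ 𝓕` is a `u`-horospherical limit point of `Γ`: for some base point `p = ho` there are
`R > 0` and `γ_j ∈ Γ` such that `β_ξ(p, γ_j p) → ∞` and `‖β_ξ(p, γ_j p) - ℝ₊ u‖ < R` for all `j`. -/
def IsHorospherical (Γ : Subgroup G.Pts) (u : D.𝔞) (ξ : D.Boundary) : Prop :=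
  ∃ (h : G.Pts) (R : ℝ) (γ : ℕ → G.Pts) (v : ℕ → D.𝔞), 0 < R ∧
    (∀ j, γ j ∈ Γ) ∧ (∀ j, D.BusemannEq ξ h (γ j * h) (v j)) ∧
    Tendsto (fun j => D.norm (v j)) atTop atTop ∧
    ∀ j, ∃ t : ℝ, 0 ≤ t ∧ D.norm (v j - t • u) < R

/-- `λ(g) = v` for the Jordan projection `λ`: `v ∈ 𝔞⁺`, and `g` is a commuting product of a
hyperbolic element `gh = φ exp(v) φ⁻¹`, an elliptic element `ge` (one that lies in a compact
subgroup) and a unipotent element `gu`. -/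
def JordanProjectionEq (g : G.Pts) (v : D.𝔞) : Prop :=
  v ∈ D.chamber ∧ ∃ gh ge gu φ : G.Pts,
    g = gh * ge * gu ∧ Commute gh ge ∧ Commute gh gu ∧ Commute ge gu ∧
    gh = φ * D.a v * φ⁻¹ ∧
    (∃ L : Subgroup G.Pts, IsCompact (L : Set G.Pts) ∧ ge ∈ L) ∧
    IsNilpotent (((gu : GL (Fin n) ℝ) : Matrix (Fin n) (Fin n) ℝ) - 1)

/-- `x⁺` is `u`-horospherical: for `x = [g]`, the point `g⁺ = gP` is. -/
def IsHorosphericalPlus {Γ : Subgroup G.Pts} (u : D.𝔞) (x : G.LeftQuotient Γ) : Prop :=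
  ∃ g : G.Pts, G.toQuotient Γ g = x ∧ D.IsHorospherical Γ u (g : D.Boundary)

/-- `x` is `u`-periodic: `x a_u = x m₀` for some `m₀ ∈ M`. -/
def IsPeriodic {Γ : Subgroup G.Pts} (u : D.𝔞) (x : G.LeftQuotient Γ) : Prop :=
  ∃ m₀ ∈ D.M, G.translate x (D.a u) = G.translate x m₀

/-- The orbit `xN`. -/
def orbitN {Γ : Subgroup G.Pts} (x : G.LeftQuotient Γ) : Set (G.LeftQuotient Γ) :=
  {y | ∃ h ∈ D.N, y = G.translate x h}

end CartanData

end ConnectedRealAlgebraicGroup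

end

/-! Let `γ₀ ∈ Γ` have Jordan projection `u`. Since `u` is regular, the centralizer of `a_u` is `MA`,
so after conjugation the elliptic and unipotent parts of `γ₀` lie in `MA`; comparing growth rates of
`Ad` kills the `A`-component. Hence `γ₀ = φ a_u m φ⁻¹` with `m ∈ M`, and `[φ c]` is `u`-periodic for
every `c` commuting with `a_u`. One such point has to be reached from `x = [g]` along `N`.

By the Iwasawa decomposition, horosphericity says that `z_j = γ_j g x_j a_{t_j u}` stays bounded for
suitable `γ_j ∈ Γ`, `x_j ∈ N` and `t_j → ∞`; let `y` be a limit along an ultrafilter. Zariski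
density gives `γ₁ ∈ Γ` with `φ⁻¹ γ₁ y` in the big cell `N⁻ M A N`, so `φ⁻¹ γ₁ z_j = n_j⁻ l_j n_j`
with `l_j` in the centralizer of `a_u`. Dropping `n_j` and flowing back by time `t_j` changes the
point only along `gN`, because `A` normalizes `N`. Acting on the left by `γ₀ ^ k_j`, where `k_j` is
the integer part of `t_j` and `r_j` the remainder, gives `φ m^{k_j} a_{-r_j u} (a_{t_j u} n_j⁻
a_{-t_j u}) l_j`. The bracket tends to `e`, the other factors have limits commuting with `a_u`, and
the limit is some `φ c`.

The dynamical steps are `exists_conj_of_jordanProjection`, `exists_tendsto_of_isHorospherical`,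
`exists_transversal` and `exists_periodic_mem_closure`. They rest on structure theory built from the
definitions. `Ad_eq_self_of_preservesParts` shows that an element preserving the triangular
decomposition of `ad u` centralizes `𝔞`: connectedness of `G` and analyticity bound the multiplicity
of the eigenvalue 1 of every `Ad g` from below, and a well-chosen `g` leaves room for this only if
`𝔞` is fixed. `fixedSubgroup_eq_K` identifies `K` with the elements commuting with `θ`, through a
continuous polar decomposition. Together they give `exists_mem_M_mul_a` and then `exists_bigCell`;
`iwasawa_unique` makes the Busemann values usable. -/

noncomputable section

/-! ### The exponential of an inner derivation -/

section BanachAlgebra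

variable {E : Type*} [NormedRing E] [NormedAlgebra ℝ E]

/-- `Y ↦ W Y - Y W` as a continuous linear map. -/
def adCLM (W : E) : E →L[ℝ] E :=
  ContinuousLinearMap.mul ℝ E W - (ContinuousLinearMap.mul ℝ E).flip W

@[simp] theorem adCLM_apply (W Y : E) : adCLM W Y = W * Y - Y * W := rfl

variable [CompleteSpace E]

theorem exp_mul_exp_neg_self (W : E) : NormedSpace.exp W * NormedSpace.exp (-W) = 1 := by
  let _ : NormedAlgebra ℚ E := NormedAlgebra.restrictScalars ℚ ℝ E
  rw [← NormedSpace.exp_add_of_commute (Commute.refl W).neg_right, add_neg_cancel,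
    NormedSpace.exp_zero]

/-- Undoing the conjugation along `t W` turns the claim into the constancy of a curve that starts at
`x`; its derivative cancels. -/
theorem exp_adCLM_apply (W x : E) :
    NormedSpace.exp (adCLM W) x = NormedSpace.exp W * x * NormedSpace.exp (-W) := by
  set F : ℝ → E := fun t => NormedSpace.exp (t • -W) * (NormedSpace.exp (t • adCLM W) x) *
    NormedSpace.exp (t • W) with hF
  have hd : ∀ t, HasDerivAt F 0 t := by
    intro t
    have h1 := hasDerivAt_exp_smul_const (𝕂 := ℝ) (-W) t
    have h2 := (hasDerivAt_exp_smul_const' (𝕂 := ℝ) (adCLM W) t).clm_apply (hasDerivAt_const t x)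
    have h3 := hasDerivAt_exp_smul_const' (𝕂 := ℝ) W t
    have h4 := (h1.mul h2).mul h3
    refine h4.congr_deriv ?_
    rw [map_zero, add_zero, mul_apply_eq_comp, adCLM_apply, Pi.mul_apply]
    noncomm_ring
  have hc : F 1 = F 0 :=
    is_const_of_deriv_eq_zero (fun t => (hd t).differentiableAt) (fun t => (hd t).deriv) 1 0
  have e0 : (0 : ℝ) • adCLM W = 0 := by ext y; simp
  simp only [hF, e0, one_smul, zero_smul, NormedSpace.exp_zero, one_mul, mul_one,
    one_apply_eq_self] at hc
  conv_rhs => rw [← hc]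
  rw [← mul_assoc, ← mul_assoc, exp_mul_exp_neg_self, one_mul, mul_assoc, exp_mul_exp_neg_self,
    mul_one]

theorem hasSum_exp_conj (W x : E) :
    HasSum (fun k : ℕ => ((k.factorial : ℝ)⁻¹) • ((adCLM W) ^ k) x)
      (NormedSpace.exp W * x * NormedSpace.exp (-W)) := by
  rw [← exp_adCLM_apply]
  have h := NormedSpace.exp_series_hasSum_exp' (𝕂 := ℝ) (adCLM W)
  exact h.mapL (ContinuousLinearMap.apply ℝ E x)

/-- Without its zeroth term, the series of `exp (ad W) x` has all its terms in `S`, which is closed.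
The point `x` itself may lie outside `S`. -/
theorem exp_conj_sub_mem (S : Submodule ℝ E) [FiniteDimensional ℝ S] {W x : E}
    (hS : ∀ Y ∈ S, W * Y - Y * W ∈ S) (hx : W * x - x * W ∈ S) :
    NormedSpace.exp W * x * NormedSpace.exp (-W) - x ∈ S := by
  have h := hasSum_exp_conj W x
  rw [← hasSum_nat_add_iff' 1] at h
  simp only [Finset.range_one, Finset.sum_singleton, Nat.factorial_zero, Nat.cast_one, inv_one,
    pow_zero, one_smul, one_apply_eq_self] at h
  refine S.closed_of_finiteDimensional.mem_of_tendsto h (Eventually.of_forall fun s => ?_)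
  refine S.sum_mem fun k _ => S.smul_mem _ ?_
  clear * - hS hx
  induction k with
  | zero => simpa using hx
  | succ k ih => rw [pow_succ']; exact hS _ ih

theorem exp_conj_eigen {W x : E} {c : ℝ} (h : W * x - x * W = c • x) :
    NormedSpace.exp W * x * NormedSpace.exp (-W) = Real.exp c • x := by
  have h1 := hasSum_exp_conj W x
  have h2 : ∀ k : ℕ, ((adCLM W) ^ k) x = c ^ k • x := by
    intro k
    induction k with
    | zero => simp
    | succ k ih =>
      rw [pow_succ', mul_apply_eq_comp, ih, map_smul, adCLM_apply, h, smul_smul,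
        pow_succ]
  simp only [h2, smul_smul] at h1
  have h3 := NormedSpace.exp_series_hasSum_exp' (𝕂 := ℝ) c
  rw [← Real.exp_eq_exp_ℝ] at h3
  simp only [smul_eq_mul] at h3
  exact h1.unique (h3.smul_const x)

/-- An inverse function theorem for the map `(Y, Z) ↦ exp Y (u + Z) exp (-Y)`. -/
theorem eventually_exists_exp_conj (S C V : Submodule ℝ E) [FiniteDimensional ℝ S]
    [FiniteDimensional ℝ C] [FiniteDimensional ℝ V] (u : E)
    (hV : ∀ Y ∈ S, ∀ Z ∈ C, NormedSpace.exp Y * (u + Z) * NormedSpace.exp (-Y) - u ∈ V)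
    (hsurj : ∀ v ∈ V, ∃ Y ∈ S, ∃ Z ∈ C, Y * u - u * Y + Z = v) :
    ∀ᶠ v : V in 𝓝 0, ∃ Y ∈ S, ∃ Z ∈ C,
      NormedSpace.exp Y * (u + Z) * NormedSpace.exp (-Y) = u + v := by
  set Φ : S × C → E := fun p =>
    NormedSpace.exp (p.1 : E) * (u + p.2) * NormedSpace.exp (-(p.1 : E)) - u with hΦ
  have hΦV : ∀ p, Φ p ∈ V := fun p => hV _ p.1.2 _ p.2.2
  set L : S × C →L[ℝ] E := (ContinuousLinearMap.mul ℝ E).flip u ∘L S.subtypeL ∘L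
    ContinuousLinearMap.fst ℝ S C - ContinuousLinearMap.mul ℝ E u ∘L S.subtypeL ∘L
    ContinuousLinearMap.fst ℝ S C + C.subtypeL ∘L ContinuousLinearMap.snd ℝ S C with hL
  have hLa : ∀ p : S × C, L p = p.1 * u - u * p.1 + p.2 := fun p => rfl
  have hd : HasStrictFDerivAt Φ L 0 := by
    have e0 : HasStrictFDerivAt (NormedSpace.exp : E → E) (1 : E →L[ℝ] E) 0 :=
      hasStrictFDerivAt_exp_zero
    have h1 : HasStrictFDerivAt (fun p : S × C => (p.1 : E))
        (S.subtypeL ∘L ContinuousLinearMap.fst ℝ S C) 0 :=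
      (S.subtypeL ∘L ContinuousLinearMap.fst ℝ S C).hasStrictFDerivAt
    have h2 : HasStrictFDerivAt (fun p : S × C => (p.2 : E))
        (C.subtypeL ∘L ContinuousLinearMap.snd ℝ S C) 0 :=
      (C.subtypeL ∘L ContinuousLinearMap.snd ℝ S C).hasStrictFDerivAt
    have e1 : HasStrictFDerivAt (fun p : S × C => NormedSpace.exp (p.1 : E))
        ((1 : E →L[ℝ] E) ∘L (S.subtypeL ∘L ContinuousLinearMap.fst ℝ S C)) 0 :=
      HasStrictFDerivAt.comp (g := NormedSpace.exp) (0 : S × C) (by simpa using e0) h1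
    have e2 : HasStrictFDerivAt (fun p : S × C => NormedSpace.exp (-(p.1 : E)))
        ((1 : E →L[ℝ] E) ∘L (-(S.subtypeL ∘L ContinuousLinearMap.fst ℝ S C))) 0 :=
      HasStrictFDerivAt.comp (g := NormedSpace.exp) (0 : S × C) (by simpa using e0) h1.neg
    have h3 := ((e1.mul' (h2.const_add u)).mul' e2).sub_const u
    refine h3.congr_fderiv ?_
    ext p
    · simp [hLa]; abel
    · simp [hLa]
  set Ψ : S × C → V := fun p => ⟨Φ p, hΦV p⟩
  -- `L p` is a limit of difference quotients of `Φ`, which lie in the closed subspace `V`.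
  have hLV : ∀ p, L p ∈ V := by
    intro p
    have hc : HasDerivAt (fun t : ℝ => Φ (t • p)) (L p) 0 := by
      have h4 : HasDerivAt (fun t : ℝ => t • p) p 0 := by
        simpa using (hasDerivAt_id (0 : ℝ)).smul_const p
      have h5 : HasFDerivAt Φ L ((fun t : ℝ => t • p) 0) := by simpa using hd.hasFDerivAt
      exact h5.comp_hasDerivAt (0 : ℝ) h4
    refine V.closed_of_finiteDimensional.mem_of_tendsto hc.tendsto_slope_zero
      (Eventually.of_forall fun t => V.smul_mem _ (V.sub_mem (hΦV _) (hΦV _)))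
  have hd' : HasStrictFDerivAt Ψ (L.codRestrict V hLV) 0 := by
    rw [hasStrictFDerivAt_iff_isLittleO] at hd ⊢
    exact Asymptotics.IsLittleO.of_norm_left (Asymptotics.IsLittleO.norm_left hd :)
  have hr : (L.codRestrict V hLV).range = ⊤ := by
    rw [LinearMap.range_eq_top]
    rintro ⟨v, hv⟩
    obtain ⟨Y, hY, Z, hZ, h⟩ := hsurj v hv
    exact ⟨(⟨Y, hY⟩, ⟨Z, hZ⟩), Subtype.ext h⟩
  have hm := hd'.map_nhds_eq_of_surj hr
  have hΨ0 : Ψ 0 = 0 := Subtype.ext (by simp [Ψ, hΦ])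
  rw [hΨ0] at hm
  have : Set.range Ψ ∈ 𝓝 (0 : V) := by
    rw [← hm]; exact Filter.mem_map.2 (Filter.univ_mem' fun p => ⟨p, rfl⟩)
  filter_upwards [this] with v hv
  obtain ⟨p, rfl⟩ := hv
  exact ⟨p.1, p.1.2, p.2, p.2.2, by simp [Ψ, hΦ]⟩

end BanachAlgebra

/-! ### The exponential map of a closed linear group -/

/-- A closed set `T` that is stable under integral multiples and contains no line of a subspace `C`
meets `C` only in `0`, near `0`. -/
theorem eventually_eq_zero_of_int_smul_mem {E : Type*} [NormedAddCommGroup E] [NormedSpace ℝ E]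
    [FiniteDimensional ℝ E] {T : Set E} (hT : IsClosed T)
    (hTm : ∀ Y ∈ T, ∀ m : ℤ, (m : ℝ) • Y ∈ T) (C : Submodule ℝ E)
    (hC : ∀ z ∈ C, (∀ t : ℝ, t • z ∈ T) → z = 0) :
    ∀ᶠ Y in 𝓝 (0 : E), Y ∈ C → Y ∈ T → Y = 0 := by
  have := FiniteDimensional.proper ℝ E
  by_contra hcon
  rw [not_eventually] at hcon
  obtain ⟨Y, hY0, hY⟩ := exists_seq_forall_of_frequently hcon
  push Not at hY
  have hpos : ∀ k, 0 < ‖Y k‖ := fun k => norm_pos_iff.2 (hY k).2.2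
  -- The counterexamples `Y k` tend to 0. A limit `z` of their directions will span a line inside
  -- `T`, against `hC`.
  set Z : ℕ → E := fun k => ‖Y k‖⁻¹ • Y k with hZ
  have hZs : ∀ k, Z k ∈ Metric.sphere (0 : E) 1 := by
    intro k
    simp [hZ, norm_smul, (hpos k).ne']
  obtain ⟨z, hz, hlim⟩ := (isCompact_sphere (0 : E) 1).ultrafilter_le_nhds
    (Ultrafilter.map Z (hyperfilter ℕ)) (by
      rw [le_principal_iff, Ultrafilter.mem_coe, Ultrafilter.mem_map]
      exact Filter.univ_mem' hZs)
  have hlim : Tendsto Z (hyperfilter ℕ) (𝓝 z) := hlim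
  have hle : (hyperfilter ℕ : Filter ℕ) ≤ atTop := Nat.hyperfilter_le_atTop
  have hzC : z ∈ C := C.closed_of_finiteDimensional.mem_of_tendsto hlim
    (Eventually.of_forall fun k => C.smul_mem _ (hY k).1)
  have hzG : ∀ t : ℝ, t • z ∈ T := by
    intro t
    have hn : Tendsto (fun k => ‖Y k‖) (hyperfilter ℕ) (𝓝 0) := by
      simpa using (hY0.mono_left hle).norm
    -- Rounding `t` down to an integral multiple of `‖Y k‖` costs at most `‖Y k‖`, so integral
    -- multiples of `Y k`, which lie in `T`, tend to `t • z`.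
    have ht : Tendsto (fun k => (⌊t / ‖Y k‖⌋ : ℝ) * ‖Y k‖) (hyperfilter ℕ) (𝓝 t) := by
      have h0 : Tendsto (fun k => t - ‖Y k‖) (hyperfilter ℕ) (𝓝 t) := by
        simpa using tendsto_const_nhds.sub hn
      refine tendsto_of_tendsto_of_tendsto_of_le_of_le h0 tendsto_const_nhds (fun k => ?_) fun k => ?_
      · have := Int.sub_one_lt_floor (t / ‖Y k‖)
        have := mul_le_mul_of_nonneg_right this.le (hpos k).le
        rwa [sub_mul, div_mul_cancel₀ _ (hpos k).ne', one_mul] at this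
      · have := mul_le_mul_of_nonneg_right (Int.floor_le (t / ‖Y k‖)) (hpos k).le
        rwa [div_mul_cancel₀ _ (hpos k).ne'] at this
    refine hT.mem_of_tendsto (ht.smul hlim) (Eventually.of_forall fun k => ?_)
    have e : ((⌊t / ‖Y k‖⌋ : ℝ) * ‖Y k‖) • Z k = (⌊t / ‖Y k‖⌋ : ℝ) • Y k := by
      rw [hZ, smul_smul, mul_assoc, mul_inv_cancel₀ (hpos k).ne', mul_one]
    rw [e]
    exact hTm _ (hY k).2.1 _
  have hz0 : z = 0 := hC z hzC hzG
  rw [hz0, mem_sphere_zero_iff_norm, norm_zero] at hz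
  exact zero_ne_one hz

/-- Products of exponentials of subspaces that span cover a neighborhood of `1`. -/
theorem eventually_exists_exp_mul {E : Type*} [NormedRing E] [NormedAlgebra ℝ E]
    [FiniteDimensional ℝ E] (S₁ S₂ S₃ C : Submodule ℝ E) (hS : S₁ ⊔ S₂ ⊔ S₃ ⊔ C = ⊤)
    {U : Set E} (hU : U ∈ 𝓝 0) :
    ∀ᶠ g in 𝓝 (1 : E), ∃ Y₁ ∈ S₁, ∃ Y₂ ∈ S₂, ∃ Y₃ ∈ S₃, ∃ Y₄ ∈ C,
      Y₁ ∈ U ∧ Y₂ ∈ U ∧ Y₃ ∈ U ∧ Y₄ ∈ U ∧ NormedSpace.exp Y₁ * NormedSpace.exp Y₂ *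
        NormedSpace.exp Y₃ * NormedSpace.exp Y₄ = g := by
  have := FiniteDimensional.complete ℝ E
  set π₁ : S₁ × S₂ × S₃ × C →L[ℝ] E := S₁.subtypeL ∘L ContinuousLinearMap.fst ℝ _ _ with h1
  set π₂ : S₁ × S₂ × S₃ × C →L[ℝ] E :=
    S₂.subtypeL ∘L ContinuousLinearMap.fst ℝ _ _ ∘L ContinuousLinearMap.snd ℝ _ _ with h2
  set π₃ : S₁ × S₂ × S₃ × C →L[ℝ] E :=
    S₃.subtypeL ∘L ContinuousLinearMap.fst ℝ _ _ ∘L ContinuousLinearMap.snd ℝ _ _ ∘L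
      ContinuousLinearMap.snd ℝ _ _ with h3
  set π₄ : S₁ × S₂ × S₃ × C →L[ℝ] E :=
    C.subtypeL ∘L ContinuousLinearMap.snd ℝ _ _ ∘L ContinuousLinearMap.snd ℝ _ _ ∘L
      ContinuousLinearMap.snd ℝ _ _ with h4
  set Φ : S₁ × S₂ × S₃ × C → E := fun p => NormedSpace.exp (π₁ p) * NormedSpace.exp (π₂ p) *
    NormedSpace.exp (π₃ p) * NormedSpace.exp (π₄ p) with hΦ
  have hexp : ∀ π : S₁ × S₂ × S₃ × C →L[ℝ] E,
      HasStrictFDerivAt (fun p => NormedSpace.exp (π p)) π 0 := by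
    intro π
    have e0 : HasStrictFDerivAt (NormedSpace.exp : E → E) (1 : E →L[ℝ] E) (π 0) := by
      rw [map_zero]; exact hasStrictFDerivAt_exp_zero
    exact (e0.comp 0 π.hasStrictFDerivAt).congr_fderiv (ContinuousLinearMap.ext fun p => rfl)
  have hd : HasStrictFDerivAt Φ (π₁ + π₂ + π₃ + π₄) 0 := by
    have h := (((hexp π₁).mul' (hexp π₂)).mul' (hexp π₃)).mul' (hexp π₄)
    refine h.congr_fderiv (ContinuousLinearMap.ext fun p => ?_)
    simp only [Pi.mul_apply, map_zero, NormedSpace.exp_zero, mul_one, MulOpposite.op_one,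
      add_apply, one_smul]
    abel
  have hr : (π₁ + π₂ + π₃ + π₄).range = ⊤ := by
    rw [LinearMap.range_eq_top]
    intro v
    obtain ⟨x, hx, y, hy, rfl⟩ := Submodule.mem_sup.1 (hS ▸ Submodule.mem_top : v ∈ S₁ ⊔ S₂ ⊔ S₃ ⊔ C)
    obtain ⟨x', hx', x₃, h₃, rfl⟩ := Submodule.mem_sup.1 hx
    obtain ⟨x₁, h₁, x₂, h₂, rfl⟩ := Submodule.mem_sup.1 hx'
    exact ⟨(⟨x₁, h₁⟩, ⟨x₂, h₂⟩, ⟨x₃, h₃⟩, ⟨y, hy⟩), rfl⟩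
  have hm := hd.map_nhds_eq_of_surj hr
  have hΦ0 : Φ 0 = 1 := by simp [hΦ]
  rw [hΦ0] at hm
  have hgood : {p : S₁ × S₂ × S₃ × C | π₁ p ∈ U ∧ π₂ p ∈ U ∧ π₃ p ∈ U ∧ π₄ p ∈ U} ∈
      𝓝 (0 : S₁ × S₂ × S₃ × C) := by
    have ht : ∀ π : S₁ × S₂ × S₃ × C →L[ℝ] E, Tendsto π (𝓝 0) (𝓝 0) :=
      fun π => by simpa using π.continuous.tendsto 0
    filter_upwards [ht π₁ hU, ht π₂ hU, ht π₃ hU, ht π₄ hU] with p h1 h2 h3 h4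
    exact ⟨h1, h2, h3, h4⟩
  have himg := Filter.image_mem_map (m := Φ) hgood
  rw [hm] at himg
  filter_upwards [himg] with g ⟨p, ⟨h1, h2, h3, h4⟩, hp⟩
  exact ⟨π₁ p, p.1.2, π₂ p, p.2.1.2, π₃ p, p.2.2.1.2, π₄ p, p.2.2.2.2, h1, h2, h3, h4, hp⟩

section ClosedSubgroup

attribute [local instance] Matrix.linftyOpNormedRing Matrix.linftyOpNormedAlgebra

variable {n : ℕ}

theorem continuous_expGL : Continuous (expGL : Matrix (Fin n) (Fin n) ℝ → GL (Fin n) ℝ) := by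
  refine Units.continuous_iff.2 ⟨?_, ?_⟩
  · exact NormedSpace.exp_continuous
  · exact NormedSpace.exp_continuous.comp continuous_neg

theorem expGL_neg (X : Matrix (Fin n) (Fin n) ℝ) : expGL (-X) = (expGL X)⁻¹ := by
  rw [eq_inv_iff_mul_eq_one, ← expGL_add (Commute.refl X).neg_left, neg_add_cancel, expGL_zero]

theorem expGL_int_smul (X : Matrix (Fin n) (Fin n) ℝ) (m : ℤ) :
    expGL ((m : ℝ) • X) = expGL X ^ m := by
  have hnat : ∀ k : ℕ, expGL ((k : ℝ) • X) = expGL X ^ k := by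
    intro k
    induction k with
    | zero => simp [expGL_zero]
    | succ k ih =>
      rw [Nat.cast_succ, add_smul, one_smul, expGL_add ((Commute.refl X).smul_left _), ih, pow_succ]
  obtain ⟨k, rfl | rfl⟩ := m.eq_nat_or_neg
  · simpa using hnat k
  · simp [neg_smul, expGL_neg, hnat k]

/-- A linear complement of the Lie algebra meets the logarithm of the group only in `0`, near `0`. -/
theorem eventually_eq_zero_of_expGL_mem {G : Subgroup (GL (Fin n) ℝ)}
    (hG : IsClosed (G : Set (GL (Fin n) ℝ))) (C : Submodule ℝ (Matrix (Fin n) (Fin n) ℝ))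
    (hC : Disjoint (lieSubspace G hG) C) :
    ∀ᶠ Y in 𝓝 (0 : Matrix (Fin n) (Fin n) ℝ), Y ∈ C → expGL Y ∈ G → Y = 0 :=
  eventually_eq_zero_of_int_smul_mem (T := {Y | expGL Y ∈ G}) (hG.preimage continuous_expGL)
    (fun Y hY m => by
      change expGL _ ∈ G
      rw [expGL_int_smul]; exact G.zpow_mem hY m) C
    fun z hz h => Submodule.disjoint_def.1 hC z h hz

/-- If the Lie algebra is a sum of three subspaces, the product of their exponentials covers a
neighborhood of the identity. -/
theorem eventually_exists_expGL_mul {G : Subgroup (GL (Fin n) ℝ)}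
    (hG : IsClosed (G : Set (GL (Fin n) ℝ))) (S₁ S₂ S₃ : Submodule ℝ (Matrix (Fin n) (Fin n) ℝ))
    (hS : S₁ ⊔ S₂ ⊔ S₃ = lieSubspace G hG) {U : Set (Matrix (Fin n) (Fin n) ℝ)} (hU : U ∈ 𝓝 0) :
    ∀ᶠ g in 𝓝 (1 : GL (Fin n) ℝ), g ∈ G → ∃ Y₁ ∈ S₁, ∃ Y₂ ∈ S₂, ∃ Y₃ ∈ S₃,
      Y₁ ∈ U ∧ Y₂ ∈ U ∧ Y₃ ∈ U ∧ expGL Y₁ * expGL Y₂ * expGL Y₃ = g := by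
  obtain ⟨C, hC⟩ := (lieSubspace G hG).exists_isCompl
  have h := eventually_exists_exp_mul S₁ S₂ S₃ C (by rw [hS, hC.sup_eq_top])
    (Filter.inter_mem hU (eventually_eq_zero_of_expGL_mem hG C hC.disjoint))
  have hval : Tendsto (fun g : GL (Fin n) ℝ => (g : Matrix (Fin n) (Fin n) ℝ)) (𝓝 1) (𝓝 1) :=
    Units.continuous_val.tendsto (1 : GL (Fin n) ℝ)
  have hmem : ∀ X ∈ lieSubspace G hG, expGL X ∈ G := fun X hX => by simpa using hX 1
  have hle : S₁ ≤ lieSubspace G hG ∧ S₂ ≤ lieSubspace G hG ∧ S₃ ≤ lieSubspace G hG := by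
    rw [← hS]
    exact ⟨le_sup_left.trans le_sup_left, le_sup_right.trans le_sup_left, le_sup_right⟩
  have h' := hval.eventually h
  filter_upwards [h'] with g ⟨Y₁, h₁, Y₂, h₂, Y₃, h₃, Y₄, h₄, hU₁, hU₂, hU₃, hU₄, hp⟩ hgG
  have hp' : expGL Y₁ * expGL Y₂ * expGL Y₃ * expGL Y₄ = g := Units.ext hp
  have h123 : expGL Y₁ * expGL Y₂ * expGL Y₃ ∈ G :=
    G.mul_mem (G.mul_mem (hmem _ (hle.1 h₁)) (hmem _ (hle.2.1 h₂))) (hmem _ (hle.2.2 h₃))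
  -- For `g ∈ G` the factor coming from the complement also lies in `G`, and being small it is
  -- trivial.
  have h40 : Y₄ = 0 := hU₄.2 h₄ (by
    rw [← hp'] at hgG
    exact (G.mul_mem_cancel_left h123).1 hgG)
  rw [h40, expGL_zero, mul_one] at hp'
  exact ⟨Y₁, h₁, Y₂, h₂, Y₃, h₃, hU₁.1, hU₂.1, hU₃.1, hp'⟩

/-- Two of the three summands are taken trivial. The closed subgroup is arbitrary because the result
serves both `G` and the subgroup of elements commuting with `θ`. -/
theorem eventually_exists_expGL {G : Subgroup (GL (Fin n) ℝ)}
    (hG : IsClosed (G : Set (GL (Fin n) ℝ))) :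
    ∀ᶠ g in 𝓝 (1 : GL (Fin n) ℝ), g ∈ G → ∃ Y ∈ lieSubspace G hG, expGL Y = g := by
  filter_upwards [eventually_exists_expGL_mul hG (lieSubspace G hG) ⊥ ⊥ (by simp)
    Filter.univ_mem] with g hg hgG
  obtain ⟨Y, hY, Y₂, h₂, Y₃, h₃, -, -, -, h⟩ := hg hgG
  rw [(Submodule.mem_bot ℝ).1 h₂, (Submodule.mem_bot ℝ).1 h₃, expGL_zero, mul_one, mul_one] at h
  exact ⟨Y, hY, h⟩

end ClosedSubgroup

/-! ### Linear algebra -/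

section LinearAlgebra

variable {V : Type*} [AddCommGroup V] [Module ℝ V]

/-- The inner product space structure of a positive definite symmetric form. -/
abbrev innerProductCore (B : V →ₗ[ℝ] V →ₗ[ℝ] ℝ) (hB : ∀ x y, B x y = B y x)
    (hpos : ∀ x, x ≠ 0 → 0 < B x x) : InnerProductSpace.Core ℝ V where
  inner := fun x y => B x y
  conj_inner_symm := fun x y => by simp [hB x y]
  re_inner_nonneg := fun x => by
    rcases eq_or_ne x 0 with rfl | h
    · simp
    · simpa using (hpos x h).le
  add_left := fun x y z => by simp
  smul_left := fun x y r => by simp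
  definite := fun x h => by
    by_contra hx
    exact (hpos x hx).ne' h

variable [FiniteDimensional ℝ V]

/-- An operator that is symmetric for a positive definite form is diagonalizable. -/
theorem iSup_eigenspace_eq_top_of_symm (B : V →ₗ[ℝ] V →ₗ[ℝ] ℝ) (hB : ∀ x y, B x y = B y x)
    (hpos : ∀ x, x ≠ 0 → 0 < B x x) (T : Module.End ℝ V) (hT : ∀ x y, B (T x) y = B x (T y)) :
    ⨆ μ, T.eigenspace μ = ⊤ := by
  let core := innerProductCore B hB hpos
  let _ : NormedAddCommGroup V := core.toNormedAddCommGroup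
  let _ : InnerProductSpace ℝ V := InnerProductSpace.ofCore core.toCore
  have hs : LinearMap.IsSymmetric T := fun x y => hT x y
  have := hs.orthogonalComplement_iSup_eigenspaces_eq_bot
  rwa [Submodule.orthogonal_eq_bot_iff] at this

/-- Commuting operators that are symmetric for a positive definite form are simultaneously
diagonalizable. -/
theorem iSup_iInf_eigenspace_eq_top_of_symm (B : V →ₗ[ℝ] V →ₗ[ℝ] ℝ) (hB : ∀ x y, B x y = B y x)
    (hpos : ∀ x, x ≠ 0 → 0 < B x x) {ι : Type*} (T : ι → Module.End ℝ V)
    (hT : ∀ i x y, B (T i x) y = B x (T i y)) (hc : ∀ i j, Commute (T i) (T j)) :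
    ⨆ χ : ι → ℝ, ⨅ i, (T i).eigenspace (χ i) = ⊤ := by
  let core := innerProductCore B hB hpos
  let _ : NormedAddCommGroup V := core.toNormedAddCommGroup
  let _ : InnerProductSpace ℝ V := InnerProductSpace.ofCore core.toCore
  exact LinearMap.IsSymmetric.iSup_iInf_eq_top_of_commute (fun i x y => hT i x y)
    fun i j _ => hc i j

theorem tendsto_det {ι : Type*} {l : Filter ι} [TopologicalSpace V] [IsTopologicalAddGroup V]
    [ContinuousSMul ℝ V] [T2Space V] {F : ι → Module.End ℝ V} {A : Module.End ℝ V}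
    (hF : ∀ x, Tendsto (fun t => F t x) l (𝓝 (A x))) :
    Tendsto (fun t => LinearMap.det (F t)) l (𝓝 (LinearMap.det A)) := by
  let b := Module.finBasis ℝ V
  have hdet : ∀ T : Module.End ℝ V, LinearMap.det T = (LinearMap.toMatrix b b T).det :=
    fun T => (LinearMap.det_toMatrix b T).symm
  simp only [hdet]
  refine ((continuous_id.matrix_det).tendsto _).comp ?_
  refine tendsto_pi_nhds.2 fun i => tendsto_pi_nhds.2 fun j => ?_
  simp only [LinearMap.toMatrix_apply]
  exact ((b.coord i).continuous_of_finiteDimensional.tendsto _).comp (hF (b j))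

/-- Injectivity is an open condition. -/
theorem eventually_ker_eq_bot {ι : Type*} {l : Filter ι} [TopologicalSpace V]
    [IsTopologicalAddGroup V] [ContinuousSMul ℝ V] [T2Space V] {F : ι → Module.End ℝ V}
    {A : Module.End ℝ V} (hF : ∀ x, Tendsto (fun t => F t x) l (𝓝 (A x)))
    (hA : LinearMap.ker A = ⊥) : ∀ᶠ t in l, LinearMap.ker (F t) = ⊥ := by
  have hA' : LinearMap.det A ≠ 0 := by
    intro h
    exact (LinearMap.bot_lt_ker_of_det_eq_zero h).ne' hA
  filter_upwards [(tendsto_det hF).eventually_ne hA'] with t ht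
  by_contra hk
  exact ht (LinearMap.det_eq_zero_iff_ker_ne_bot.2 hk)

/-- The kernel of a small perturbation of a semisimple operator. -/
theorem eventually_ker_le_ker {ι : Type*} {l : Filter ι}
    [TopologicalSpace V] [IsTopologicalAddGroup V] [ContinuousSMul ℝ V] [T2Space V]
    {F : ι → Module.End ℝ V} {A : Module.End ℝ V}
    (hF : ∀ x, Tendsto (fun t => F t x) l (𝓝 (A x)))
    (hA : Disjoint (LinearMap.ker A) (LinearMap.range A))
    (hker : ∀ t, ∀ x, A x = 0 → A (F t x) = 0)
    (hrange : ∀ t, ∀ x ∈ LinearMap.range A, F t x ∈ LinearMap.range A) :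
    ∀ᶠ t in l, LinearMap.ker (F t) ≤ LinearMap.ker A := by
  set R := LinearMap.range A
  have hAR : ∀ x ∈ R, A x ∈ R := fun x _ => ⟨x, rfl⟩
  -- Both summands are stable under `F t`. On the range `A` is invertible, so `F t` is eventually
  -- injective there, and a kernel vector of `F t` has no component in it.
  have hsup : LinearMap.ker A ⊔ R = ⊤ := by
    refine Submodule.eq_top_of_disjoint _ _ ?_ hA
    rw [add_comm]; exact (LinearMap.finrank_range_add_finrank_ker A).ge
  have hk : LinearMap.ker (A.restrict hAR) = ⊥ := by
    rw [LinearMap.ker_eq_bot']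
    intro x hx
    have : A x = 0 := congrArg Subtype.val hx
    exact Subtype.ext (Submodule.disjoint_def.1 hA _ this x.2)
  have hev := eventually_ker_eq_bot (V := R) (l := l) (F := fun t => (F t).restrict (hrange t))
    (A := A.restrict hAR) (fun x => by
      rw [tendsto_subtype_rng]; exact hF x) hk
  filter_upwards [hev] with t ht x hx
  obtain ⟨y, hy, z, hz, rfl⟩ := Submodule.mem_sup.1 (hsup ▸ Submodule.mem_top : x ∈ LinearMap.ker A ⊔ R)
  rw [LinearMap.mem_ker, map_add] at hx
  have h1 : F t z = 0 := by
    refine Submodule.disjoint_def.1 hA _ ?_ (hrange t z hz)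
    rw [eq_neg_of_add_eq_zero_right hx, LinearMap.mem_ker, map_neg, hker t y hy, neg_zero]
  have h2 : (⟨z, hz⟩ : R) = 0 := LinearMap.ker_eq_bot'.1 ht ⟨z, hz⟩ (Subtype.ext h1)
  have h3 : z = 0 := congrArg Subtype.val h2
  simpa [h3] using hy

/-- For an analytic family of operators, a lower bound for the algebraic multiplicity of the
eigenvalue `0` spreads from a neighborhood of one parameter to all parameters. -/
theorem le_finrank_maxGenEigenspace_of_analytic {d : ℕ} {F : ℝ → Module.End ℝ V}
    (hF : ∀ (ℓ : V →ₗ[ℝ] ℝ) (x : V), AnalyticOnNhd ℝ (fun t => ℓ (F t x)) Set.univ)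
    (h0 : ∀ᶠ t in 𝓝 0, d ≤ Module.finrank ℝ ((F t).maxGenEigenspace 0)) (t : ℝ) :
    d ≤ Module.finrank ℝ ((F t).maxGenEigenspace 0) := by
  -- The algebraic multiplicity of 0 is the order of vanishing of the characteristic polynomial. The
  -- bound becomes the vanishing of `d` coefficients, to which the identity theorem applies.
  have key : ∀ T : Module.End ℝ V, d ≤ Module.finrank ℝ (T.maxGenEigenspace 0) ↔
      ∀ j < d, T.charpoly.coeff j = 0 := by
    intro T
    rw [LinearMap.finrank_maxGenEigenspace_zero_eq]
    refine ⟨fun h j hj => Polynomial.coeff_eq_zero_of_lt_natTrailingDegree (hj.trans_le h),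
      fun h => ?_⟩
    exact Polynomial.le_natTrailingDegree T.charpoly_monic.ne_zero h
  simp only [key] at h0 ⊢
  intro j hj
  let b := Module.finBasis ℝ V
  -- The universal characteristic polynomial exhibits the coefficient as a fixed polynomial in the
  -- matrix entries, hence as analytic in `t`.
  have hcoeff : ∀ T : Module.End ℝ V, T.charpoly.coeff j =
      MvPolynomial.aeval (fun ij : Fin _ × Fin _ => b.coord ij.1 (T (b ij.2)))
        ((Matrix.charpoly.univ ℝ (Fin (Module.finrank ℝ V))).coeff j) := by
    intro T
    have h := Matrix.charpoly.univ_coeff_eval₂Hom (Fin (Module.finrank ℝ V)) (algebraMap ℝ ℝ)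
      (fun ij => b.coord ij.1 (T (b ij.2))) j
    rw [← LinearMap.charpoly_toMatrix T b]
    refine Eq.trans ?_ h.symm
    congr 2
    ext i k
    simp [LinearMap.toMatrix_apply]
  have han : AnalyticOnNhd ℝ (fun t => (F t).charpoly.coeff j) Set.univ := by
    simp only [hcoeff]
    intro t _
    exact AnalyticAt.aeval_mvPolynomial (fun ij => hF _ _ t trivial) _
  have := han.eqOn_zero_of_preconnected_of_eventuallyEq_zero isPreconnected_univ (Set.mem_univ 0)
    (h0.mono fun t ht => ht j hj)
  exact this (Set.mem_univ t)

end LinearAlgebra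

/-! ### The adjoint action -/

namespace ConnectedRealAlgebraicGroup

variable {n : ℕ} (G : ConnectedRealAlgebraicGroup n)

instance : IsTopologicalAddGroup G.lieAlgebra :=
  inferInstanceAs (IsTopologicalAddGroup G.lieAlgebra.toSubmodule.toAddSubgroup)

theorem conj_mem_lieAlgebra (g : G.Pts) (X : G.lieAlgebra) :
    ((g : GL (Fin n) ℝ) : Matrix (Fin n) (Fin n) ℝ) * X *
      (((g : GL (Fin n) ℝ)⁻¹ : GL (Fin n) ℝ) : Matrix (Fin n) (Fin n) ℝ) ∈ G.lieAlgebra := by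
  intro t
  have h := expGL_conj (g : GL (Fin n) ℝ) (t • (X : Matrix (Fin n) (Fin n) ℝ))
  rw [mul_smul_comm, smul_mul_assoc] at h
  rw [h]
  exact mul_mem (mul_mem g.2 (X.2 t)) (inv_mem g.2)

/-- The adjoint action of `G` on `𝔤`, as linear maps. -/
def adHom (g : G.Pts) : G.lieAlgebra →ₗ⁅ℝ⁆ G.lieAlgebra where
  toFun X := ⟨_, G.conj_mem_lieAlgebra g X⟩
  map_add' X Y := Subtype.ext (by simp [mul_add, add_mul])
  map_smul' c X := Subtype.ext (by simp)
  map_lie' {X Y} := Subtype.ext (by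
    simp only [LieSubalgebra.coe_bracket, Ring.lie_def]
    have h : (((g : GL (Fin n) ℝ)⁻¹ : GL (Fin n) ℝ) : Matrix (Fin n) (Fin n) ℝ) *
        ((g : GL (Fin n) ℝ) : Matrix (Fin n) (Fin n) ℝ) = 1 := Units.inv_mul _
    generalize ((g : GL (Fin n) ℝ) : Matrix (Fin n) (Fin n) ℝ) = a at h
    generalize (((g : GL (Fin n) ℝ)⁻¹ : GL (Fin n) ℝ) : Matrix (Fin n) (Fin n) ℝ) = b at h
    have e : ∀ P Q : Matrix (Fin n) (Fin n) ℝ, a * P * b * (a * Q * b) = a * (P * Q) * b := by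
      intro P Q
      calc a * P * b * (a * Q * b) = a * P * (b * a) * Q * b := by noncomm_ring
        _ = _ := by rw [h]; noncomm_ring
    rw [e, e]; noncomm_ring)

theorem coe_adHom (g : G.Pts) (X : G.lieAlgebra) :
    (G.adHom g X : Matrix (Fin n) (Fin n) ℝ) = ((g : GL (Fin n) ℝ) : Matrix (Fin n) (Fin n) ℝ) * X *
      (((g : GL (Fin n) ℝ)⁻¹ : GL (Fin n) ℝ) : Matrix (Fin n) (Fin n) ℝ) := rfl

theorem adHom_one (X : G.lieAlgebra) : G.adHom 1 X = X :=
  Subtype.ext (by simp [coe_adHom])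

theorem adHom_mul (g h : G.Pts) (X : G.lieAlgebra) :
    G.adHom (g * h) X = G.adHom g (G.adHom h X) :=
  Subtype.ext (by simp [coe_adHom, mul_assoc])

/-- The adjoint action of `G` on `𝔤`. -/
def Ad (g : G.Pts) : G.lieAlgebra ≃ₗ⁅ℝ⁆ G.lieAlgebra where
  __ := G.adHom g
  invFun := G.adHom g⁻¹
  left_inv X := by
    change G.adHom g⁻¹ (G.adHom g X) = X
    rw [← adHom_mul, inv_mul_cancel, adHom_one]
  right_inv X := by
    change G.adHom g (G.adHom g⁻¹ X) = X
    rw [← adHom_mul, mul_inv_cancel, adHom_one]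

theorem coe_Ad (g : G.Pts) (X : G.lieAlgebra) :
    (G.Ad g X : Matrix (Fin n) (Fin n) ℝ) = ((g : GL (Fin n) ℝ) : Matrix (Fin n) (Fin n) ℝ) * X *
      (((g : GL (Fin n) ℝ)⁻¹ : GL (Fin n) ℝ) : Matrix (Fin n) (Fin n) ℝ) := rfl

@[simp] theorem Ad_one (X : G.lieAlgebra) : G.Ad 1 X = X := G.adHom_one X

theorem Ad_mul (g h : G.Pts) (X : G.lieAlgebra) : G.Ad (g * h) X = G.Ad g (G.Ad h X) :=
  G.adHom_mul g h X

@[simp] theorem Ad_inv_Ad (g : G.Pts) (X : G.lieAlgebra) : G.Ad g⁻¹ (G.Ad g X) = X := by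
  rw [← Ad_mul, inv_mul_cancel, Ad_one]

@[simp] theorem Ad_Ad_inv (g : G.Pts) (X : G.lieAlgebra) : G.Ad g (G.Ad g⁻¹ X) = X := by
  rw [← Ad_mul, mul_inv_cancel, Ad_one]

theorem Ad_add (g : G.Pts) (X Y : G.lieAlgebra) : G.Ad g (X + Y) = G.Ad g X + G.Ad g Y :=
  map_add (G.Ad g) X Y

theorem Ad_smul (g : G.Pts) (c : ℝ) (X : G.lieAlgebra) : G.Ad g (c • X) = c • G.Ad g X :=
  map_smul (G.Ad g) c X

theorem Ad_lie (g : G.Pts) (X Y : G.lieAlgebra) : G.Ad g ⁅X, Y⁆ = ⁅G.Ad g X, G.Ad g Y⁆ :=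
  LieEquiv.map_lie (G.Ad g) X Y

theorem killingForm_Ad (g : G.Pts) (X Y : G.lieAlgebra) :
    killingForm ℝ G.lieAlgebra (G.Ad g X) (G.Ad g Y) = killingForm ℝ G.lieAlgebra X Y :=
  LieAlgebra.killingForm_of_equiv_apply (G.Ad g) X Y

/-- `Ad g` as a linear endomorphism. -/
def AdEnd (g : G.Pts) : Module.End ℝ G.lieAlgebra := (G.Ad g : G.lieAlgebra →ₗ[ℝ] G.lieAlgebra)

@[simp] theorem AdEnd_apply (g : G.Pts) (X : G.lieAlgebra) : G.AdEnd g X = G.Ad g X := rfl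

theorem exp_Ad (g : G.Pts) (X : G.lieAlgebra) : G.exp (G.Ad g X) = g * G.exp X * g⁻¹ :=
  Subtype.ext (expGL_conj (g : GL (Fin n) ℝ) (X : Matrix (Fin n) (Fin n) ℝ))

theorem exp_neg (X : G.lieAlgebra) : G.exp (-X) = (G.exp X)⁻¹ :=
  Subtype.ext (expGL_neg _)

theorem continuous_exp : Continuous G.exp :=
  (continuous_expGL.comp continuous_subtype_val).subtype_mk _

theorem continuous_Ad_of {T : Type*} [TopologicalSpace T] {g : T → G.Pts} {X : T → G.lieAlgebra}
    (hg : Continuous g) (hX : Continuous X) : Continuous fun t => G.Ad (g t) (X t) := by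
  refine Continuous.subtype_mk (f := fun t => _) ?_ _
  have h1 : Continuous fun t => ((g t : GL (Fin n) ℝ) : Matrix (Fin n) (Fin n) ℝ) :=
    Units.continuous_val.comp (continuous_subtype_val.comp hg)
  have h2 : Continuous fun t =>
      (((g t : GL (Fin n) ℝ)⁻¹ : GL (Fin n) ℝ) : Matrix (Fin n) (Fin n) ℝ) :=
    Units.continuous_val.comp (continuous_inv.comp (continuous_subtype_val.comp hg))
  exact (h1.mul (continuous_subtype_val.comp hX)).mul h2

theorem continuous_Ad_apply (X : G.lieAlgebra) : Continuous fun g : G.Pts => G.Ad g X :=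
  G.continuous_Ad_of continuous_id continuous_const

section

attribute [local instance] Matrix.linftyOpNormedRing Matrix.linftyOpNormedAlgebra

theorem Ad_exp_eigen {u X : G.lieAlgebra} {c : ℝ} (h : ⁅u, X⁆ = c • X) :
    G.Ad (G.exp u) X = Real.exp c • X :=
  Subtype.ext (exp_conj_eigen (congrArg Subtype.val h))

theorem Ad_exp_sub_mem (S : Submodule ℝ G.lieAlgebra) {W X : G.lieAlgebra}
    (hS : ∀ Y ∈ S, ⁅W, Y⁆ ∈ S) (hX : ⁅W, X⁆ ∈ S) : G.Ad (G.exp W) X - X ∈ S := by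
  have h := exp_conj_sub_mem (S.map G.lieAlgebra.toSubmodule.subtype)
    (W := (W : Matrix (Fin n) (Fin n) ℝ)) (x := X) (by
      rintro _ ⟨Y, hY, rfl⟩
      exact ⟨⁅W, Y⁆, hS Y hY, rfl⟩) ⟨_, hX, rfl⟩
  obtain ⟨Y, hY, h⟩ := h
  have : Y = G.Ad (G.exp W) X - X := Subtype.ext h
  exact this ▸ hY

theorem Ad_exp_mem (S : Submodule ℝ G.lieAlgebra) {W X : G.lieAlgebra}
    (hS : ∀ Y ∈ S, ⁅W, Y⁆ ∈ S) (hX : X ∈ S) : G.Ad (G.exp W) X ∈ S := by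
  simpa using S.add_mem (G.Ad_exp_sub_mem S hS (hS X hX)) hX

theorem Ad_exp_eq_self {W X : G.lieAlgebra} (h : ⁅W, X⁆ = 0) : G.Ad (G.exp W) X = X := by
  have := G.Ad_exp_eigen (u := W) (X := X) (c := 0) (by rw [h, zero_smul])
  rwa [Real.exp_zero, one_smul] at this

theorem hasDerivAt_Ad_exp (ℓ : G.lieAlgebra →ₗ[ℝ] ℝ) (Y X : G.lieAlgebra) :
    HasDerivAt (fun t : ℝ => ℓ (G.Ad (G.exp (t • Y)) X)) (ℓ ⁅Y, X⁆) 0 := by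
  obtain ⟨L, hL⟩ := LinearMap.exists_extend (p := G.lieAlgebra.toSubmodule) ℓ
  have hL' : ∀ Z : G.lieAlgebra, ℓ Z = L (Z : Matrix (Fin n) (Fin n) ℝ) :=
    fun Z => (LinearMap.congr_fun hL Z).symm
  simp only [hL']
  have h1 := (hasDerivAt_exp_smul_const (𝕂 := ℝ) (Y : Matrix (Fin n) (Fin n) ℝ) (0 : ℝ)).mul_const
    (X : Matrix (Fin n) (Fin n) ℝ)
  have h2 := hasDerivAt_exp_smul_const (𝕂 := ℝ) (-(Y : Matrix (Fin n) (Fin n) ℝ)) (0 : ℝ)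
  have h3 := h1.mul h2
  have h4 := (LinearMap.toContinuousLinearMap L).hasFDerivAt.comp_hasDerivAt (0 : ℝ) h3
  refine (h4.congr_deriv ?_).congr_of_eventuallyEq (Eventually.of_forall fun t => ?_)
  · change L _ = L _
    congr 1
    simp [Ring.lie_def, sub_eq_add_neg]
  · change L _ = L _
    congr 1
    change NormedSpace.exp (t • (Y : Matrix (Fin n) (Fin n) ℝ)) * X *
      NormedSpace.exp (-(t • (Y : Matrix (Fin n) (Fin n) ℝ))) = _
    rw [← smul_neg]; rfl

/-- Matrix coefficients of the adjoint action are analytic along products of one-parameter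
groups and along exponentials of affine lines. -/
theorem analyticOnNhd_coeff (ℓ : G.lieAlgebra →ₗ[ℝ] ℝ) (X : G.lieAlgebra) (g : ℝ → G.Pts)
    (h1 : AnalyticOnNhd ℝ (fun t => ((g t : GL (Fin n) ℝ) : Matrix (Fin n) (Fin n) ℝ)) Set.univ)
    (h2 : AnalyticOnNhd ℝ (fun t => (((g t : GL (Fin n) ℝ)⁻¹ : GL (Fin n) ℝ) :
      Matrix (Fin n) (Fin n) ℝ)) Set.univ) :
    AnalyticOnNhd ℝ (fun t => ℓ (G.Ad (g t) X)) Set.univ := by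
  obtain ⟨L, hL⟩ := LinearMap.exists_extend (p := G.lieAlgebra.toSubmodule) ℓ
  have hL' : ∀ Z : G.lieAlgebra, ℓ Z = L (Z : Matrix (Fin n) (Fin n) ℝ) :=
    fun Z => (LinearMap.congr_fun hL Z).symm
  simp only [hL', coe_Ad]
  intro t _
  have h3 := ((h1 t trivial).mul (analyticAt_const (v := (X : Matrix (Fin n) (Fin n) ℝ)))).mul
    (h2 t trivial)
  exact ((LinearMap.toContinuousLinearMap L).analyticAt _).comp h3

theorem analyticOnNhd_exp_affine (X Y : Matrix (Fin n) (Fin n) ℝ) :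
    AnalyticOnNhd ℝ (fun t : ℝ => NormedSpace.exp (X + t • Y)) Set.univ := by
  intro t _
  have h : AnalyticAt ℝ (fun t : ℝ => X + t • Y) t :=
    analyticAt_const.add (analyticAt_id.smul analyticAt_const)
  exact AnalyticAt.comp (g := NormedSpace.exp) (f := fun t : ℝ => X + t • Y)
    (NormedSpace.exp_analytic (𝕂 := ℝ) (X + t • Y)) h

end

theorem eventually_exists_exp : ∀ᶠ g in 𝓝 (1 : G.Pts), ∃ X, G.exp X = g := by
  have h := (continuous_subtype_val.tendsto (1 : G.Pts)).eventually
    (eventually_exists_expGL G.isClosed)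
  filter_upwards [h] with g hg
  obtain ⟨Y, hY, h⟩ := hg g.2
  exact ⟨⟨Y, hY⟩, Subtype.ext h⟩

theorem eventually_exists_exp_mul (S₁ S₂ S₃ : Submodule ℝ G.lieAlgebra) (hS : S₁ ⊔ S₂ ⊔ S₃ = ⊤)
    {U : Set (Matrix (Fin n) (Fin n) ℝ)} (hU : U ∈ 𝓝 0) :
    ∀ᶠ g in 𝓝 (1 : G.Pts), ∃ Y₁ ∈ S₁, ∃ Y₂ ∈ S₂, ∃ Y₃ ∈ S₃, (Y₁ : Matrix (Fin n) (Fin n) ℝ) ∈ U ∧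
      (Y₂ : Matrix (Fin n) (Fin n) ℝ) ∈ U ∧ (Y₃ : Matrix (Fin n) (Fin n) ℝ) ∈ U ∧
      G.exp Y₁ * G.exp Y₂ * G.exp Y₃ = g := by
  have hS' : S₁.map G.lieAlgebra.toSubmodule.subtype ⊔ S₂.map G.lieAlgebra.toSubmodule.subtype ⊔
      S₃.map G.lieAlgebra.toSubmodule.subtype = lieSubspace G.toSubgroup G.isClosed := by
    rw [← Submodule.map_sup, ← Submodule.map_sup, hS]
    exact Submodule.map_subtype_top _
  have h := (continuous_subtype_val.tendsto (1 : G.Pts)).eventually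
    (eventually_exists_expGL_mul G.isClosed _ _ _ hS' hU)
  filter_upwards [h] with g hg
  obtain ⟨_, ⟨Y₁, h₁, rfl⟩, _, ⟨Y₂, h₂, rfl⟩, _, ⟨Y₃, h₃, rfl⟩, hU₁, hU₂, hU₃, h⟩ := hg g.2
  exact ⟨Y₁, h₁, Y₂, h₂, Y₃, h₃, hU₁, hU₂, hU₃, Subtype.ext h⟩

instance : ConnectedSpace G.Pts := by
  obtain ⟨H, hH, h⟩ := G.isIdentityComponent
  have hc : IsConnected (G.toSubgroup : Set (GL (Fin n) ℝ)) := by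
    rw [h, Subgroup.coe_map]
    exact isConnected_connectedComponent.image _ continuous_subtype_val.continuousOn
  exact isConnected_iff_connectedSpace.1 hc

/-- An open subgroup is also closed, and `G` is connected. -/
theorem eq_top_of_mem_nhds_one (H : Subgroup G.Pts) (hH : (H : Set G.Pts) ∈ 𝓝 1) : H = ⊤ := by
  have ho : IsOpen (H : Set G.Pts) := H.isOpen_of_mem_nhds hH
  have hcl : IsClopen (H : Set G.Pts) := ⟨H.isClosed_of_isOpen ho, ho⟩
  have := hcl.eq_univ ⟨1, H.one_mem⟩
  exact SetLike.coe_injective (by simpa using this)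

/-- `G` is generated by exponentials. -/
theorem exists_list_exp (g : G.Pts) : ∃ l : List G.lieAlgebra, g = (l.map G.exp).prod := by
  have htop : Subgroup.closure (Set.range G.exp) = ⊤ :=
    G.eq_top_of_mem_nhds_one _ (by
      filter_upwards [G.eventually_exists_exp] with g hg
      exact Subgroup.subset_closure hg)
  have hg : g ∈ Subgroup.closure (Set.range G.exp) := htop ▸ Subgroup.mem_top g
  induction hg using Subgroup.closure_induction with
  | mem x hx => obtain ⟨X, rfl⟩ := hx; exact ⟨[X], by simp⟩
  | one => exact ⟨[], by simp⟩
  | mul x y _ _ hx hy =>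
    obtain ⟨l, rfl⟩ := hx
    obtain ⟨l', rfl⟩ := hy
    exact ⟨l ++ l', by simp⟩
  | inv x _ hx =>
    obtain ⟨l, rfl⟩ := hx
    refine ⟨(l.map fun X => -X).reverse, ?_⟩
    rw [List.prod_inv_reverse, List.map_reverse, List.map_map, List.map_map]
    congr 3
    funext X
    exact (G.exp_neg X).symm

end ConnectedRealAlgebraicGroup

/-! ### The inner product of a Cartan involution and eigenspaces of elements of `𝔭` -/

namespace ConnectedRealAlgebraicGroup

namespace CartanData

variable {n : ℕ} {G : ConnectedRealAlgebraicGroup n} (D : G.CartanData)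

/-- The inner product `⟨X, Y⟩ = -B(X, θ Y)`. -/
def form : G.lieAlgebra →ₗ[ℝ] G.lieAlgebra →ₗ[ℝ] ℝ :=
  -(killingForm ℝ G.lieAlgebra).compl₂ (D.θ : G.lieAlgebra →ₗ[ℝ] G.lieAlgebra)

theorem form_apply (X Y : G.lieAlgebra) :
    D.form X Y = -killingForm ℝ G.lieAlgebra X (D.θ Y) := rfl

theorem killingForm_θ (X Y : G.lieAlgebra) :
    killingForm ℝ G.lieAlgebra (D.θ X) (D.θ Y) = killingForm ℝ G.lieAlgebra X Y :=
  LieAlgebra.killingForm_of_equiv_apply D.θ X Y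

theorem killingForm_symm (X Y : G.lieAlgebra) :
    killingForm ℝ G.lieAlgebra X Y = killingForm ℝ G.lieAlgebra Y X :=
  LieModule.traceForm_comm ℝ G.lieAlgebra G.lieAlgebra X Y

theorem form_symm (X Y : G.lieAlgebra) : D.form X Y = D.form Y X := by
  rw [form_apply, form_apply, ← D.killingForm_θ Y, D.θ_θ, killingForm_symm]

theorem form_pos (X : G.lieAlgebra) (hX : X ≠ 0) : 0 < D.form X X :=
  neg_pos.2 (D.killing_neg X hX)

theorem form_nonneg (X : G.lieAlgebra) : 0 ≤ D.form X X := by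
  rcases eq_or_ne X 0 with rfl | h
  · simp
  · exact (D.form_pos X h).le

theorem eq_zero_of_form {X : G.lieAlgebra} (h : D.form X X = 0) : X = 0 := by
  by_contra hX
  exact (D.form_pos X hX).ne' h

/-- By invariance of the Killing form, the adjoint of `ad X` is `-ad (θ X)`: elements of `𝔭` act
symmetrically, elements of `𝔨` skew-symmetrically. -/
theorem form_lie (X Y Z : G.lieAlgebra) : D.form ⁅X, Y⁆ Z = -D.form Y ⁅D.θ X, Z⁆ := by
  have h1 : D.θ ⁅D.θ X, Z⁆ = ⁅X, D.θ Z⁆ := by rw [LieEquiv.map_lie, D.θ_θ]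
  have h2 : killingForm ℝ G.lieAlgebra ⁅Y, X⁆ (D.θ Z) = killingForm ℝ G.lieAlgebra Y ⁅X, D.θ Z⁆ :=
    LieModule.traceForm_apply_lie_apply ℝ G.lieAlgebra G.lieAlgebra Y X (D.θ Z)
  rw [form_apply, form_apply, h1, ← h2, ← lie_skew Y X, map_neg, LinearMap.neg_apply, neg_neg]

/-- An element of the Killing radical is orthogonal to its image under `θ`, against definiteness.
The consequences used are that the centre is trivial and that derivations are inner. -/
theorem isKilling (D : G.CartanData) : LieAlgebra.IsKilling ℝ G.lieAlgebra where
  killingCompl_top_eq_bot := by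
    refine (LieSubmodule.eq_bot_iff _).2 fun X hX => ?_
    rw [LieIdeal.mem_killingCompl] at hX
    refine D.eq_zero_of_form ?_
    rw [form_apply, killingForm_symm, hX _ (by simp), neg_zero]

theorem eq_zero_of_lie (D : G.CartanData) {X : G.lieAlgebra} (h : ∀ Y : G.lieAlgebra, ⁅X, Y⁆ = 0) :
    X = 0 := by
  have := D.isKilling
  have h1 : LieDerivation.ad ℝ G.lieAlgebra X = 0 := by
    ext1 Y; simpa using h Y
  exact (LieDerivation.IsKilling.ad_apply_eq_zero_iff ℝ G.lieAlgebra X).1 h1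

/-- The span of the eigenspaces of `ad u` for eigenvalues in `s`. -/
def _root_.ConnectedRealAlgebraicGroup.spec (u : G.lieAlgebra) (s : Set ℝ) :
    Submodule ℝ G.lieAlgebra :=
  ⨆ c ∈ s, (LieAlgebra.ad ℝ G.lieAlgebra u).eigenspace c

theorem mem_spec {u X : G.lieAlgebra} {s : Set ℝ} {c : ℝ} (hc : c ∈ s) (h : ⁅u, X⁆ = c • X) :
    X ∈ spec u s :=
  Submodule.mem_iSup_of_mem c (Submodule.mem_iSup_of_mem hc (Module.End.mem_eigenspace_iff.2 h))

theorem spec_le {u : G.lieAlgebra} {s : Set ℝ} {W : Submodule ℝ G.lieAlgebra}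
    (h : ∀ c ∈ s, ∀ X, ⁅u, X⁆ = c • X → X ∈ W) : spec u s ≤ W :=
  iSup₂_le fun c hc X hX => h c hc X (Module.End.mem_eigenspace_iff.1 hX)

theorem spec_mono (u : G.lieAlgebra) {s t : Set ℝ} (h : s ⊆ t) : spec u s ≤ spec u t :=
  spec_le fun _ hc _ hX => mem_spec (h hc) hX

theorem spec_neg (u : G.lieAlgebra) (s : Set ℝ) : spec (-u) s = spec u (-s) := by
  refine le_antisymm (spec_le fun c hc X hX => ?_) (spec_le fun c hc X hX => ?_)
  · refine mem_spec (c := -c) (by simpa using hc) ?_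
    rw [neg_smul, ← hX, neg_lie, neg_neg]
  · refine mem_spec (c := -c) hc ?_
    rw [neg_smul, ← hX, neg_lie]

theorem mem_spec_zero {u X : G.lieAlgebra} : X ∈ spec u {0} ↔ ⁅u, X⁆ = 0 := by
  refine ⟨fun h => ?_, fun h => mem_spec (c := 0) rfl (by rw [h, zero_smul])⟩
  have : spec u {0} ≤ LinearMap.ker (LieAlgebra.ad ℝ G.lieAlgebra u) :=
    spec_le fun c hc Y hY => by
      rw [Set.mem_singleton_iff.1 hc, zero_smul] at hY
      exact hY
  exact this h

theorem lie_mem_spec {u X Y : G.lieAlgebra} {s t r : Set ℝ} (hX : X ∈ spec u s)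
    (hY : Y ∈ spec u t) (h : ∀ a ∈ s, ∀ b ∈ t, a + b ∈ r) : ⁅X, Y⁆ ∈ spec u r := by
  have h1 : spec u s ≤ (spec u r).comap
      ((LieAlgebra.ad ℝ G.lieAlgebra : G.lieAlgebra →ₗ[ℝ] Module.End ℝ G.lieAlgebra).flip Y) := by
    refine spec_le fun a ha X hX => ?_
    have h2 : spec u t ≤ (spec u r).comap (LieAlgebra.ad ℝ G.lieAlgebra X) := by
      refine spec_le fun b hb Y hY => ?_
      refine mem_spec (h a ha b hb) ?_
      change ⁅u, ⁅X, Y⁆⁆ = (a + b) • ⁅X, Y⁆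
      rw [leibniz_lie, hX, hY, smul_lie, lie_smul, add_smul]
    exact h2 hY
  exact h1 hX

theorem lie_self_mem_spec {u X : G.lieAlgebra} {s : Set ℝ} (hX : X ∈ spec u s) :
    ⁅u, X⁆ ∈ spec u s :=
  lie_mem_spec (s := {0}) (t := s) (mem_spec_zero.2 (lie_self u)) hX
    fun a ha b hb => by rw [Set.mem_singleton_iff.1 ha, zero_add]; exact hb

theorem Ad_mem_spec {g : G.Pts} {u u' X : G.lieAlgebra} (hg : G.Ad g u = u') {s : Set ℝ}
    (hX : X ∈ spec u s) : G.Ad g X ∈ spec u' s := by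
  have h1 : spec u s ≤ (spec u' s).comap (G.AdEnd g) := by
    refine spec_le fun a ha X hX => mem_spec ha ?_
    rw [AdEnd_apply, ← hg, ← G.Ad_lie, hX, G.Ad_smul]
  exact h1 hX

theorem killingForm_spec {u X Y : G.lieAlgebra} {s t : Set ℝ} (hX : X ∈ spec u s)
    (hY : Y ∈ spec u t) (h : ∀ a ∈ s, ∀ b ∈ t, a + b ≠ 0) : killingForm ℝ G.lieAlgebra X Y = 0 := by
  have h1 : spec u s ≤ LinearMap.ker ((killingForm ℝ G.lieAlgebra).flip Y) := by
    refine spec_le fun a ha X hX => ?_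
    have h2 : spec u t ≤ LinearMap.ker (killingForm ℝ G.lieAlgebra X) := by
      refine spec_le fun b hb Y hY => ?_
      have h3 : killingForm ℝ G.lieAlgebra ⁅X, u⁆ Y = killingForm ℝ G.lieAlgebra X ⁅u, Y⁆ :=
        LieModule.traceForm_apply_lie_apply ℝ G.lieAlgebra G.lieAlgebra X u Y
      rw [← lie_skew, hX, hY, map_neg, map_smul, map_smul, LinearMap.neg_apply,
        LinearMap.smul_apply, smul_eq_mul, smul_eq_mul] at h3
      have h4 : (a + b) * killingForm ℝ G.lieAlgebra X Y = 0 := by linarith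
      exact (mul_eq_zero.1 h4).resolve_left (h a ha b hb)
    exact h2 hY
  exact h1 hX

/-- On an eigenvector with eigenvalue `c < 0` the flow is multiplication by `exp (t c)`. -/
theorem Ad_exp_smul_tendsto_zero {u X : G.lieAlgebra} (hX : X ∈ spec u (Set.Iio 0)) :
    Tendsto (fun t : ℝ => G.Ad (G.exp (t • u)) X) atTop (𝓝 0) := by
  let W : Submodule ℝ G.lieAlgebra :=
    { carrier := {X | Tendsto (fun t : ℝ => G.Ad (G.exp (t • u)) X) atTop (𝓝 0)}
      zero_mem' := by simp
      add_mem' := fun {X Y} hX hY => by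
        have h : Tendsto _ atTop _ := Tendsto.add hX hY
        change Tendsto _ _ _
        simpa only [add_zero, ← G.Ad_add] using h
      smul_mem' := fun c X hX => by
        have h : Tendsto _ atTop _ := Tendsto.const_smul hX c
        change Tendsto _ _ _
        simpa only [smul_zero, ← G.Ad_smul] using h }
  have h : spec u (Set.Iio 0) ≤ W := by
    refine spec_le fun c hc X hX => ?_
    have h1 : ∀ t : ℝ, G.Ad (G.exp (t • u)) X = Real.exp (t * c) • X := fun t =>
      G.Ad_exp_eigen (by rw [smul_lie, hX, smul_smul])
    change Tendsto (fun t : ℝ => G.Ad (G.exp (t • u)) X) atTop (𝓝 0)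
    simp only [h1]
    have h2 : Tendsto (fun t : ℝ => Real.exp (t * c)) atTop (𝓝 0) :=
      Real.tendsto_exp_atBot.comp (tendsto_id.atTop_mul_const_of_neg hc)
    simpa using h2.smul_const X
  exact h hX

section SymmetricElement

variable {u : G.lieAlgebra} (hu : D.θ u = -u)

include hu

theorem form_lie_of_neg (X Y : G.lieAlgebra) : D.form ⁅u, X⁆ Y = D.form X ⁅u, Y⁆ := by
  rw [form_lie, hu, neg_lie, map_neg, neg_neg]

theorem spec_univ : spec u Set.univ = ⊤ := by
  have h := iSup_eigenspace_eq_top_of_symm D.form D.form_symm D.form_pos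
    (LieAlgebra.ad ℝ G.lieAlgebra u) (fun X Y => D.form_lie_of_neg hu X Y)
  rw [← h]
  simp [spec]

theorem spec_sup_eq_top {s t : Set ℝ} (h : s ∪ t = Set.univ) : spec u s ⊔ spec u t = ⊤ := by
  rw [eq_top_iff, ← D.spec_univ hu, ← h]
  refine spec_le fun c hc X hX => ?_
  rcases hc with hc | hc
  · exact Submodule.mem_sup_left (mem_spec hc hX)
  · exact Submodule.mem_sup_right (mem_spec hc hX)

theorem form_spec {s t : Set ℝ} (h : Disjoint s t) {X Y : G.lieAlgebra}
    (hX : X ∈ spec u s) (hY : Y ∈ spec u t) : D.form X Y = 0 := by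
  have h1 : spec u s ≤ LinearMap.ker (D.form.flip Y) := by
    refine spec_le fun a ha X hX => ?_
    have h2 : spec u t ≤ LinearMap.ker (D.form X) := by
      refine spec_le fun b hb Y hY => ?_
      have h3 := D.form_lie_of_neg hu X Y
      rw [hX, hY, map_smul, map_smul, LinearMap.smul_apply, smul_eq_mul, smul_eq_mul] at h3
      have h4 : (a - b) * D.form X Y = 0 := by linarith
      refine (mul_eq_zero.1 h4).resolve_left (sub_ne_zero.2 ?_)
      rintro rfl
      exact Set.disjoint_left.1 h ha hb
    exact h2 hY
  exact h1 hX

theorem disjoint_spec {s t : Set ℝ} (h : Disjoint s t) : Disjoint (spec u s) (spec u t) :=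
  Submodule.disjoint_def.2 fun _ hX hY => D.eq_zero_of_form (D.form_spec hu h hX hY)

theorem θ_mem_spec {s : Set ℝ} {X : G.lieAlgebra} (hX : X ∈ spec u s) : D.θ X ∈ spec u (-s) := by
  have h1 : spec u s ≤ (spec u (-s)).comap (D.θ : G.lieAlgebra →ₗ[ℝ] G.lieAlgebra) := by
    refine spec_le fun a ha X hX => mem_spec (c := -a) (by simpa using ha) ?_
    change ⁅u, D.θ X⁆ = -a • D.θ X
    have h2 := congrArg D.θ hX
    rw [LieEquiv.map_lie, hu, map_smul, neg_lie] at h2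
    rw [neg_smul, ← h2, neg_neg]
  exact h1 hX

/-- Invariant subspaces are sums of their intersections with eigenspaces. -/
theorem le_spec_of_disjoint {s : Set ℝ} {Q : Submodule ℝ G.lieAlgebra}
    (hQ : ∀ X ∈ Q, ⁅u, X⁆ ∈ Q) (hd : Disjoint Q (spec u sᶜ)) : Q ≤ spec u s := by
  have htop : ⨆ c, (LieAlgebra.ad ℝ G.lieAlgebra u).genEigenspace c 1 = ⊤ :=
    iSup_eigenspace_eq_top_of_symm D.form D.form_symm D.form_pos
      (LieAlgebra.ad ℝ G.lieAlgebra u) (fun X Y => D.form_lie_of_neg hu X Y)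
  rw [Submodule.eq_iSup_inf_genEigenspace (f := LieAlgebra.ad ℝ G.lieAlgebra u) 1 hQ htop]
  refine iSup_le fun c X hX => ?_
  have hX2 : ⁅u, X⁆ = c • X := Module.End.mem_eigenspace_iff.1 hX.2
  by_cases hc : c ∈ s
  · exact mem_spec hc hX2
  · rw [Submodule.disjoint_def.1 hd X hX.1 (mem_spec hc hX2)]
    exact Submodule.zero_mem _

/-- The nilradical is thereby determined by the parabolic subalgebra and the Killing form, so
whatever preserves the latter two preserves it. For the converse, the nonpositive component `Z` is
tested against `θ Z`. -/
theorem mem_spec_pos_iff {X : G.lieAlgebra} : X ∈ spec u (Set.Ioi 0) ↔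
    ∀ Y ∈ spec u (Set.Ici 0), killingForm ℝ G.lieAlgebra X Y = 0 := by
  have h0 : ∀ X ∈ spec u (Set.Ioi 0), ∀ Y ∈ spec u (Set.Ici 0),
      killingForm ℝ G.lieAlgebra X Y = 0 := fun X hX Y hY =>
    killingForm_spec hX hY fun a ha b hb => (add_pos_of_pos_of_nonneg ha hb).ne'
  refine ⟨fun hX => h0 X hX, fun h => ?_⟩
  obtain ⟨Y, hY, Z, hZ, rfl⟩ := Submodule.mem_sup.1
    (D.spec_sup_eq_top hu (s := Set.Ioi 0) (t := Set.Iic 0) Set.Ioi_union_Iic ▸ Submodule.mem_top :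
      X ∈ spec u (Set.Ioi 0) ⊔ spec u (Set.Iic 0))
  have hθ : D.θ Z ∈ spec u (Set.Ici 0) := by simpa using D.θ_mem_spec hu hZ
  have h1 := h _ hθ
  rw [map_add, LinearMap.add_apply, h0 Y hY _ hθ, zero_add] at h1
  rw [D.eq_zero_of_form (X := Z) (by rw [form_apply, h1, neg_zero]), add_zero]
  exact hY

theorem finrank_spec_add : Module.finrank ℝ (spec u (Set.Ici 0)) +
    Module.finrank ℝ (spec u (Set.Iio 0)) = Module.finrank ℝ G.lieAlgebra := by
  refine Submodule.finrank_add_eq_of_isCompl ⟨D.disjoint_spec hu ?_, codisjoint_iff.2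
    (D.spec_sup_eq_top hu ?_)⟩
  · rw [Set.disjoint_left]; intro a ha hb; exact absurd (Set.mem_Iio.1 hb) (not_lt.2 ha)
  · exact Set.union_comm _ _ ▸ Set.Iio_union_Ici

end SymmetricElement

end CartanData

end ConnectedRealAlgebraicGroup

/-! ### Local conjugation near `u`, and `𝔞` as its own centralizer in `𝔭` -/

namespace ConnectedRealAlgebraicGroup

variable {n : ℕ} {G : ConnectedRealAlgebraicGroup n}

section

attribute [local instance] Matrix.linftyOpNormedRing Matrix.linftyOpNormedAlgebra

/-- The image of `(Y, Z) ↦ Ad (exp Y) (u + Z)` near `u`. -/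
theorem eventually_exists_Ad_exp (S C V : Submodule ℝ G.lieAlgebra) (u : G.lieAlgebra)
    (hV : ∀ Y ∈ S, ∀ Z ∈ C, G.Ad (G.exp Y) (u + Z) - u ∈ V)
    (hsurj : ∀ v ∈ V, ∃ Y ∈ S, ∃ Z ∈ C, ⁅Y, u⁆ + Z = v) :
    ∀ᶠ X in 𝓝 (0 : G.lieAlgebra), X ∈ V → ∃ Y ∈ S, ∃ Z ∈ C, G.Ad (G.exp Y) (u + Z) = u + X := by
  let ι := G.lieAlgebra.toSubmodule.subtype
  have h := eventually_exists_exp_conj (S.map ι) (C.map ι) (V.map ι)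
    (u : Matrix (Fin n) (Fin n) ℝ) (by
      rintro _ ⟨Y, hY, rfl⟩ _ ⟨Z, hZ, rfl⟩
      exact ⟨_, hV Y hY Z hZ, rfl⟩) (by
      rintro _ ⟨v, hv, rfl⟩
      obtain ⟨Y, hY, Z, hZ, rfl⟩ := hsurj v hv
      exact ⟨_, ⟨Y, hY, rfl⟩, _, ⟨Z, hZ, rfl⟩, rfl⟩)
  obtain ⟨U, hU, hUs⟩ := mem_nhds_subtype _ _ _ |>.1 h
  have hU' : (Subtype.val : G.lieAlgebra → Matrix (Fin n) (Fin n) ℝ) ⁻¹' U ∈ 𝓝 (0 : G.lieAlgebra) :=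
    (continuous_subtype_val.tendsto (0 : G.lieAlgebra)) hU
  filter_upwards [hU'] with X hX hXV
  obtain ⟨_, ⟨Y, hY, rfl⟩, _, ⟨Z, hZ, rfl⟩, h⟩ :=
    hUs (show (⟨X, ⟨X, hXV, rfl⟩⟩ : V.map ι) ∈ Subtype.val ⁻¹' U from hX)
  exact ⟨Y, hY, Z, hZ, Subtype.ext h⟩

end

namespace CartanData

variable (D : G.CartanData)

theorem a_eq_exp (u : D.𝔞) : D.a u = G.exp u := rfl

theorem θ_coe (u : D.𝔞) : D.θ u = -(u : G.lieAlgebra) := D.𝔞_maximal.prop.1 _ u.2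

/-- By maximality: `𝔞 + ℝ X` is again an abelian subspace of `𝔭`. -/
theorem mem_𝔞_of_commute {X : G.lieAlgebra} (hX : D.θ X = -X) (h : ∀ H ∈ D.𝔞, ⁅H, X⁆ = 0) :
    X ∈ D.𝔞 := by
  have hc : ∀ H ∈ D.𝔞, ⁅X, H⁆ = 0 := fun H hH => by rw [← lie_skew, h H hH, neg_zero]
  have hle := D.𝔞_maximal.le_of_ge (y := D.𝔞 ⊔ Submodule.span ℝ {X}) ⟨?_, ?_⟩ le_sup_left
  · exact hle (Submodule.mem_sup_right (Submodule.mem_span_singleton_self X))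
  · intro Y hY
    obtain ⟨H, hH, Z, hZ, rfl⟩ := Submodule.mem_sup.1 hY
    obtain ⟨c, rfl⟩ := Submodule.mem_span_singleton.1 hZ
    rw [map_add, map_smul, hX, D.𝔞_maximal.prop.1 H hH, smul_neg, neg_add]
  · intro Y hY Y' hY'
    obtain ⟨H, hH, Z, hZ, rfl⟩ := Submodule.mem_sup.1 hY
    obtain ⟨c, rfl⟩ := Submodule.mem_span_singleton.1 hZ
    obtain ⟨H', hH', Z', hZ', rfl⟩ := Submodule.mem_sup.1 hY'
    obtain ⟨c', rfl⟩ := Submodule.mem_span_singleton.1 hZ'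
    simp only [add_lie, lie_add, smul_lie, lie_smul, D.𝔞_maximal.prop.2 H hH H' hH', h H hH,
      hc H' hH', lie_self, smul_zero, add_zero]

/-! ### Restricted roots and the Weyl chamber -/

/-- The joint eigenspace of `𝔞` for the eigenvalue function `χ`. -/
def jointEigenspace (χ : D.𝔞 → ℝ) : Submodule ℝ G.lieAlgebra :=
  ⨅ H : D.𝔞, (LieAlgebra.ad ℝ G.lieAlgebra (H : G.lieAlgebra)).eigenspace (χ H)

theorem mem_jointEigenspace {χ : D.𝔞 → ℝ} {X : G.lieAlgebra} :
    X ∈ D.jointEigenspace χ ↔ ∀ H : D.𝔞, ⁅(H : G.lieAlgebra), X⁆ = χ H • X := by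
  simp [jointEigenspace, Submodule.mem_iInf]

theorem iSup_jointEigenspace : ⨆ χ, D.jointEigenspace χ = ⊤ := by
  refine iSup_iInf_eigenspace_eq_top_of_symm D.form D.form_symm D.form_pos
    (fun H : D.𝔞 => LieAlgebra.ad ℝ G.lieAlgebra (H : G.lieAlgebra))
    (fun H X Y => D.form_lie_of_neg (D.θ_coe H) X Y) fun H H' => ?_
  rw [commute_iff_lie_eq, ← LieHom.map_lie, D.lie_eq_zero, map_zero]

theorem spec_le_iSup_jointEigenspace (u : D.𝔞) (s : Set ℝ) :
    spec (u : G.lieAlgebra) s ≤ ⨆ χ ∈ {χ : D.𝔞 → ℝ | χ u ∈ s}, D.jointEigenspace χ := by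
  intro X hX
  set W₁ := ⨆ χ ∈ {χ : D.𝔞 → ℝ | χ u ∈ s}, D.jointEigenspace χ with hW₁
  set W₂ := ⨆ χ ∈ {χ : D.𝔞 → ℝ | χ u ∈ sᶜ}, D.jointEigenspace χ
  have hsup : W₁ ⊔ W₂ = ⊤ := by
    rw [eq_top_iff, ← D.iSup_jointEigenspace]
    refine iSup_le fun χ => ?_
    by_cases h : χ u ∈ s
    · exact (le_iSup₂_of_le (f := fun χ (_ : χ ∈ {χ : D.𝔞 → ℝ | χ u ∈ s}) => D.jointEigenspace χ)
        χ h le_rfl).trans le_sup_left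
    · exact (le_iSup₂_of_le (f := fun χ (_ : χ ∈ {χ : D.𝔞 → ℝ | χ u ∈ sᶜ}) => D.jointEigenspace χ)
        χ h le_rfl).trans le_sup_right
  have hle : ∀ t : Set ℝ, ⨆ χ ∈ {χ : D.𝔞 → ℝ | χ u ∈ t}, D.jointEigenspace χ ≤
      spec (u : G.lieAlgebra) t := fun t =>
    iSup₂_le fun χ hχ Y hY => mem_spec hχ (D.mem_jointEigenspace.1 hY u)
  obtain ⟨Y, hY, Z, hZ, rfl⟩ := Submodule.mem_sup.1 (hsup ▸ Submodule.mem_top : X ∈ W₁ ⊔ W₂)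
  have hZs : Z ∈ spec (u : G.lieAlgebra) s := by
    simpa using Submodule.sub_mem _ hX (hle s hY)
  have hZ0 : Z = 0 := Submodule.disjoint_def.1
    (D.disjoint_spec (D.θ_coe u) (disjoint_compl_right (a := s))) Z hZs (hle _ hZ)
  simpa [hZ0] using hY

/-- For `u` in the open chamber, `u - t H₀` is still in the chamber for small `t > 0`, so a root
positive at `H₀` is strictly positive at `u`. Negative roots are treated through their opposites,
which are roots by `θ`. -/
theorem root_sign : ∃ H₀ : D.𝔞, ∀ (χ : D.𝔞 → ℝ) (X : G.lieAlgebra), X ≠ 0 →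
    (∀ H : D.𝔞, ⁅(H : G.lieAlgebra), X⁆ = χ H • X) → (χ H₀ = 0 → ∀ H, χ H = 0) ∧
      ∀ u ∈ interior D.chamber, (0 < χ H₀ → 0 < χ u) ∧ (χ H₀ < 0 → χ u < 0) := by
  obtain ⟨H₀, hreg, hC⟩ := D.isChamber
  have hpos : ∀ α, G.IsRestrictedRoot D.𝔞 α → 0 < α H₀ → ∀ u ∈ interior D.chamber, 0 < α u := by
    intro α hα h0 u hu
    have hc : Tendsto (fun t : ℝ => u - t • H₀) (𝓝[>] 0) (𝓝 u) := by
      have : Continuous fun t : ℝ => u - t • H₀ := by fun_prop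
      simpa using (this.tendsto 0).mono_left nhdsWithin_le_nhds
    obtain ⟨t, ht, ht0⟩ := ((hc.eventually (mem_interior_iff_mem_nhds.1 hu)).and
      self_mem_nhdsWithin).exists
    rw [hC] at ht
    have h1 := ht α hα h0
    rw [map_sub, map_smul, smul_eq_mul] at h1
    have := mul_pos (Set.mem_Ioi.1 ht0) h0
    linarith
  refine ⟨H₀, fun χ X hX h => ?_⟩
  have hinj : ∀ c d : ℝ, c • X = d • X → c = d := fun c d hcd => smul_left_injective ℝ hX hcd
  -- An eigenvalue function is automatically linear, since its eigenvector is nonzero.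
  let α : D.𝔞 →ₗ[ℝ] ℝ :=
    { toFun := χ
      map_add' := fun H H' => hinj _ _ (by
        rw [← h, add_smul, ← h, ← h, Submodule.coe_add, add_lie])
      map_smul' := fun c H => hinj _ _ (by
        rw [← h, RingHom.id_apply, smul_eq_mul, mul_smul, ← h, Submodule.coe_smul, smul_lie]) }
  by_cases hα0 : α = 0
  · have h0 : ∀ H, χ H = 0 := fun H => LinearMap.congr_fun hα0 H
    exact ⟨fun _ => h0, fun u _ => ⟨fun h1 => absurd (h0 H₀) h1.ne', fun h1 => absurd (h0 H₀) h1.ne⟩⟩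
  · have hα : G.IsRestrictedRoot D.𝔞 α := ⟨hα0, X, hX, h⟩
    have hα' : G.IsRestrictedRoot D.𝔞 (-α) := by
      refine ⟨neg_ne_zero.2 hα0, D.θ X, fun h0 => hX ?_, fun H => ?_⟩
      · rw [← D.θ_θ X, h0, map_zero]
      · have h2 := congrArg D.θ (h H)
        rw [LieEquiv.map_lie, D.θ_coe, map_smul, neg_lie] at h2
        rw [LinearMap.neg_apply, neg_smul, ← neg_eq_iff_eq_neg]
        exact h2
    refine ⟨fun h0 => absurd h0 (hreg α hα), fun u hu => ⟨fun h0 => hpos α hα h0 u hu, fun h0 => ?_⟩⟩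
    exact neg_pos.1 (hpos (-α) hα' (neg_pos.2 h0) u hu)

/-- Interior points of the chamber are regular: a weight vanishing at one of them vanishes on `𝔞`.
-/
theorem spec_zero_eq_centralizer {u : D.𝔞} (hu : u ∈ interior D.chamber) {X : G.lieAlgebra}
    (hX : X ∈ spec (u : G.lieAlgebra) {0}) (H : D.𝔞) : ⁅(H : G.lieAlgebra), X⁆ = 0 := by
  obtain ⟨H₀, h₀⟩ := D.root_sign
  have h := D.spec_le_iSup_jointEigenspace u {0} hX
  suffices hle : ⨆ χ ∈ {χ : D.𝔞 → ℝ | χ u ∈ ({0} : Set ℝ)}, D.jointEigenspace χ ≤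
      LinearMap.ker (LieAlgebra.ad ℝ G.lieAlgebra (H : G.lieAlgebra)) from hle h
  refine iSup₂_le fun χ hχ Y hY => ?_
  rcases eq_or_ne Y 0 with rfl | hY0
  · exact Submodule.zero_mem _
  have hY' := D.mem_jointEigenspace.1 hY
  obtain ⟨h1, h2⟩ := h₀ χ Y hY0 hY'
  have hχ0 : χ H₀ = 0 := by
    rcases lt_trichotomy (χ H₀) 0 with h | h | h
    · exact absurd hχ ((h2 u hu).2 h).ne
    · exact h
    · exact absurd hχ ((h2 u hu).1 h).ne'
  change ⁅(H : G.lieAlgebra), Y⁆ = 0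
  rw [hY', h1 hχ0, zero_smul]

/-- Membership in `N` involves all interior directions, while the computations use `u` alone;
constancy of signs bridges the two. -/
theorem spec_pos_le {u u' : D.𝔞} (hu : u ∈ interior D.chamber) (hu' : u' ∈ interior D.chamber) :
    spec (u : G.lieAlgebra) (Set.Ioi 0) ≤ spec (u' : G.lieAlgebra) (Set.Ioi 0) := by
  obtain ⟨H₀, h₀⟩ := D.root_sign
  refine (D.spec_le_iSup_jointEigenspace u _).trans (iSup₂_le fun χ hχ Y hY => ?_)
  rcases eq_or_ne Y 0 with rfl | hY0
  · exact Submodule.zero_mem _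
  have hY' := D.mem_jointEigenspace.1 hY
  obtain ⟨h1, h2⟩ := h₀ χ Y hY0 hY'
  have hχ : 0 < χ u := hχ
  refine mem_spec (c := χ u') ?_ (hY' u')
  rcases lt_trichotomy (χ H₀) 0 with h | h | h
  · exact absurd ((h2 u hu).2 h) hχ.le.not_gt
  · exact absurd (h1 h u) hχ.ne'
  · exact (h2 u' hu').1 h

theorem a_pow (u : D.𝔞) (k : ℕ) : D.a u ^ k = D.a ((k : ℝ) • u) := by
  induction k with
  | zero => simp [D.a_zero]
  | succ k ih => rw [pow_succ, ih, ← D.a_add, Nat.cast_succ, add_smul, one_smul]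

theorem exp_mem_N {u : D.𝔞} (hu : u ∈ interior D.chamber) {W : G.lieAlgebra}
    (hW : W ∈ spec (u : G.lieAlgebra) (Set.Ioi 0)) : G.exp W ∈ D.N := by
  intro u' hu'
  have hW' : W ∈ spec (-(u' : G.lieAlgebra)) (Set.Iio 0) := by
    rw [spec_neg]; simpa using D.spec_pos_le hu hu' hW
  have h1 := (Ad_exp_smul_tendsto_zero hW').comp (tendsto_natCast_atTop_atTop (R := ℝ))
  have h2 := (G.continuous_exp.tendsto 0).comp h1
  rw [G.exp_zero] at h2
  refine h2.congr fun k => ?_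
  simp only [Function.comp_apply]
  rw [G.exp_Ad, smul_neg, G.exp_neg, inv_inv, D.a_pow]
  rfl

/-! ### Horospherical subgroups -/

section SymmetricElement

variable {u : G.lieAlgebra}

theorem Ad_exp_mem_spec {W X : G.lieAlgebra} {s t : Set ℝ} (hW : W ∈ spec u t)
    (hts : ∀ a ∈ t, ∀ b ∈ s, a + b ∈ s) (hX : X ∈ spec u s) : G.Ad (G.exp W) X ∈ spec u s :=
  G.Ad_exp_mem _ (fun _ hY => lie_mem_spec hW hY hts) hX

/-- For small `Y` this is the inverse function theorem, as `ad u` is invertible on the negative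
part. In general, `exp (t u)` fixes `u` and contracts `Y`, so conjugating by it reduces to small
`Y`. -/
theorem exists_Ad_exp_eq_add {Y : G.lieAlgebra} (hY : Y ∈ spec u (Set.Iio 0)) :
    ∃ W ∈ spec u (Set.Iio 0), G.Ad (G.exp W) u = u + Y := by
  have hev := eventually_exists_Ad_exp (spec u (Set.Iio 0)) ⊥ (spec u (Set.Iio 0)) u
    (by
      intro Y hY Z hZ
      rw [(Submodule.mem_bot ℝ).1 hZ, add_zero]
      refine G.Ad_exp_sub_mem _ (fun X hX => lie_mem_spec hY hX fun a ha b hb => ?_) ?_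
      · exact add_neg (Set.mem_Iio.1 ha) (Set.mem_Iio.1 hb)
      · rw [← lie_skew]; exact Submodule.neg_mem _ (lie_self_mem_spec hY))
    (by
      intro v hv
      have hle : spec u (Set.Iio 0) ≤ (spec u (Set.Iio 0)).map (LieAlgebra.ad ℝ G.lieAlgebra u) := by
        refine spec_le fun c hc X hX => ⟨c⁻¹ • X, Submodule.smul_mem _ _ (mem_spec hc hX), ?_⟩
        change ⁅u, c⁻¹ • X⁆ = X
        rw [lie_smul, hX, smul_smul, inv_mul_cancel₀ (ne_of_lt hc), one_smul]
      obtain ⟨X, hX, rfl⟩ := hle hv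
      refine ⟨-X, Submodule.neg_mem _ hX, 0, Submodule.zero_mem _, ?_⟩
      rw [add_zero, neg_lie, lie_skew]; rfl)
  have hc := (Ad_exp_smul_tendsto_zero hY).eventually hev
  obtain ⟨t, ht⟩ := hc.exists
  have hcomm : G.Ad (G.exp (t • u)) u = u := G.Ad_exp_eq_self (by rw [smul_lie, lie_self, smul_zero])
  have hcomm' : G.Ad (G.exp (t • u))⁻¹ u = u := by
    have h := G.Ad_inv_Ad (G.exp (t • u)) u
    rwa [hcomm] at h
  obtain ⟨W, hW, Z, hZ, h⟩ := ht (Ad_mem_spec hcomm hY)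
  rw [(Submodule.mem_bot ℝ).1 hZ, add_zero] at h
  refine ⟨G.Ad (G.exp (t • u))⁻¹ W, Ad_mem_spec hcomm' hW, ?_⟩
  rw [G.exp_Ad, inv_inv, G.Ad_mul, G.Ad_mul, hcomm, h, G.Ad_add, hcomm', G.Ad_inv_Ad]

/-- If `Ad q` moves the nonnegative part to a complement of the negative part, then `q` differs
from the stabilizer of the nonnegative part by an exponential of the negative part. -/
theorem exists_exp_mul_stabilizes (hu : D.θ u = -u) {q : G.Pts}
    (hq : ∀ X ∈ spec u (Set.Ici 0), G.Ad q X ∈ spec u (Set.Iio 0) → X = 0) :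
    ∃ W ∈ spec u (Set.Iio 0), ∀ X ∈ spec u (Set.Ici 0),
      G.Ad (G.exp W * q) X ∈ spec u (Set.Ici 0) := by
  set P := spec u (Set.Ici 0) with hP
  set N := spec u (Set.Iio 0) with hN
  set e : G.lieAlgebra ≃ₗ[ℝ] G.lieAlgebra := (G.Ad q).toLinearEquiv with he
  have hdisj : Disjoint (P.map (e : G.lieAlgebra →ₗ[ℝ] G.lieAlgebra)) N := by
    rw [Submodule.disjoint_def]
    rintro _ ⟨X, hX, rfl⟩ hXN
    have := hq X hX hXN
    rw [this, map_zero]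
  have htop : P.map (e : G.lieAlgebra →ₗ[ℝ] G.lieAlgebra) ⊔ N = ⊤ := by
    refine Submodule.eq_top_of_disjoint _ _ ?_ hdisj
    rw [LinearEquiv.finrank_map_eq e P]
    exact (D.finrank_spec_add hu).ge
  -- Decompose `u = Ad q Z + Y`. Since `u - Y` is conjugate to `u` under the negative part, `exp
  -- (-W) q` carries `Z ∈ P` to `u`. The image of the subalgebra `P` is then stable under `ad u`,
  -- and transversality to `N` leaves only nonnegative weights in it.
  obtain ⟨_, ⟨Z, hZ, rfl⟩, Y, hY, huY⟩ := Submodule.mem_sup.1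
    (htop ▸ Submodule.mem_top : u ∈ P.map (e : G.lieAlgebra →ₗ[ℝ] G.lieAlgebra) ⊔ N)
  obtain ⟨W, hW, hWu⟩ := exists_Ad_exp_eq_add (Submodule.neg_mem _ hY)
  have hZu : G.Ad q Z = G.Ad (G.exp W) u := by
    rw [hWu, ← huY]; simp [he]
  have hZu' : G.Ad (G.exp (-W) * q) Z = u := by
    rw [G.Ad_mul, hZu, G.exp_neg, G.Ad_inv_Ad]
  refine ⟨-W, Submodule.neg_mem _ hW, ?_⟩
  have hNN : ∀ V ∈ N, ∀ X ∈ N, G.Ad (G.exp V) X ∈ N := fun V hV X hX =>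
    Ad_exp_mem_spec hV (fun a ha b hb => add_neg (Set.mem_Iio.1 ha) (Set.mem_Iio.1 hb)) hX
  suffices h : P.map (G.AdEnd (G.exp (-W) * q)) ≤ spec u (Set.Ici 0) from
    fun X hX => h ⟨X, hX, rfl⟩
  refine D.le_spec_of_disjoint hu ?_ ?_
  · rintro _ ⟨X, hX, rfl⟩
    refine ⟨⁅Z, X⁆, lie_mem_spec hZ hX (fun a ha b hb => Set.mem_Ici.2 (add_nonneg ha hb)), ?_⟩
    rw [AdEnd_apply, AdEnd_apply, G.Ad_lie, hZu']
  · rw [Submodule.disjoint_def]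
    rintro _ ⟨X, hX, rfl⟩ hXN
    rw [Set.compl_Ici] at hXN
    have h1 := hNN W hW _ hXN
    rw [AdEnd_apply, ← G.Ad_mul, G.exp_neg, mul_inv_cancel_left] at h1
    rw [hq X hX h1, map_zero]

end SymmetricElement

end CartanData

end ConnectedRealAlgebraicGroup

/-! ### The stabilizer of a triangular decomposition centralizes `𝔞` -/

namespace ConnectedRealAlgebraicGroup

variable {n : ℕ} {G : ConnectedRealAlgebraicGroup n}

theorem Ad_inv_mem {g : G.Pts} {S : Submodule ℝ G.lieAlgebra} (h : ∀ X ∈ S, G.Ad g X ∈ S)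
    {X : G.lieAlgebra} (hX : X ∈ S) : G.Ad g⁻¹ X ∈ S := by
  have hle : S.map (G.AdEnd g) ≤ S := by
    rintro _ ⟨Y, hY, rfl⟩
    exact h Y hY
  have hf : Module.finrank ℝ (S.map (G.AdEnd g)) = Module.finrank ℝ S :=
    LinearEquiv.finrank_map_eq (G.Ad g).toLinearEquiv S
  have heq := Submodule.eq_of_le_of_finrank_eq hle hf
  rw [← heq] at hX
  obtain ⟨Y, hY, rfl⟩ := hX
  rw [AdEnd_apply, G.Ad_inv_Ad]
  exact hY

/-- `Ad l` preserves the zero, positive and negative parts of `ad u`. -/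
def PreservesParts (u : G.lieAlgebra) (l : G.Pts) : Prop :=
  (∀ X ∈ spec u {0}, G.Ad l X ∈ spec u {0}) ∧
  (∀ X ∈ spec u (Set.Ioi 0), G.Ad l X ∈ spec u (Set.Ioi 0)) ∧
  ∀ X ∈ spec u (Set.Iio 0), G.Ad l X ∈ spec u (Set.Iio 0)

theorem PreservesParts.mul {u : G.lieAlgebra} {l l' : G.Pts} (h : PreservesParts u l)
    (h' : PreservesParts u l') : PreservesParts u (l * l') :=
  ⟨fun X hX => by rw [G.Ad_mul]; exact h.1 _ (h'.1 X hX),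
    fun X hX => by rw [G.Ad_mul]; exact h.2.1 _ (h'.2.1 X hX),
    fun X hX => by rw [G.Ad_mul]; exact h.2.2 _ (h'.2.2 X hX)⟩

theorem PreservesParts.inv {u : G.lieAlgebra} {l : G.Pts} (h : PreservesParts u l) :
    PreservesParts u l⁻¹ :=
  ⟨fun _ hX => Ad_inv_mem h.1 hX, fun _ hX => Ad_inv_mem h.2.1 hX,
    fun _ hX => Ad_inv_mem h.2.2 hX⟩

theorem preservesParts_of_Ad_eq {u : G.lieAlgebra} {l : G.Pts} (h : G.Ad l u = u) :
    PreservesParts u l :=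
  ⟨fun _ hX => CartanData.Ad_mem_spec h hX, fun _ hX => CartanData.Ad_mem_spec h hX,
    fun _ hX => CartanData.Ad_mem_spec h hX⟩

theorem preservesParts_exp {u Y : G.lieAlgebra} (h : Y ∈ spec u {0}) :
    PreservesParts u (G.exp Y) :=
  preservesParts_of_Ad_eq (G.Ad_exp_eq_self (by
    rw [← lie_skew, CartanData.mem_spec_zero.1 h, neg_zero]))

namespace CartanData

variable (D : G.CartanData)

section

variable {u : D.𝔞} (hu : u ∈ interior D.chamber)

theorem coe_mem_spec_zero (H : D.𝔞) : (H : G.lieAlgebra) ∈ spec (u : G.lieAlgebra) {0} :=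
  mem_spec_zero.2 (D.lie_eq_zero u H)

theorem θ_mem_spec_zero {X : G.lieAlgebra} (hX : X ∈ spec (u : G.lieAlgebra) {0}) :
    D.θ X ∈ spec (u : G.lieAlgebra) {0} := by
  simpa using D.θ_mem_spec (D.θ_coe u) hX

include hu

theorem mem_𝔞_of_spec_zero {X : G.lieAlgebra} (hX : X ∈ spec (u : G.lieAlgebra) {0})
    (hθ : D.θ X = -X) : X ∈ D.𝔞 :=
  D.mem_𝔞_of_commute hθ fun H hH => D.spec_zero_eq_centralizer hu hX ⟨H, hH⟩

theorem sub_θ_mem {X : G.lieAlgebra} (hX : X ∈ spec (u : G.lieAlgebra) {0}) :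
    X - D.θ X ∈ D.𝔞 :=
  D.mem_𝔞_of_spec_zero hu (Submodule.sub_mem _ hX (D.θ_mem_spec_zero hX)) (by
    rw [map_sub, D.θ_θ]; abel)

/-- The image splits into `A ∈ 𝔞` and a `θ`-fixed `M` commuting with `A`. Its `ad` is conjugate to
`ad X`, hence diagonalizable over `ℝ`, while `ad A` is symmetric and `ad M` skew; therefore `ad M =
0`. -/
theorem Ad_mem_𝔞 {l : G.Pts} (hl : ∀ X ∈ spec (u : G.lieAlgebra) {0}, G.Ad l X ∈ spec (u : G.lieAlgebra) {0})
    {X : G.lieAlgebra} (hX : X ∈ D.𝔞) : G.Ad l X ∈ D.𝔞 := by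
  set X' := G.Ad l X with hX'
  have hX'l : X' ∈ spec (u : G.lieAlgebra) {0} := hl _ (D.coe_mem_spec_zero ⟨X, hX⟩)
  set A := (2⁻¹ : ℝ) • (X' - D.θ X') with hA
  set M := (2⁻¹ : ℝ) • (X' + D.θ X') with hM
  have hAM : X' = A + M := by rw [hA, hM]; module
  have hA𝔞 : A ∈ D.𝔞 := D.𝔞.smul_mem _ (D.sub_θ_mem hu hX'l)
  have hMl : M ∈ spec (u : G.lieAlgebra) {0} :=
    Submodule.smul_mem _ _ (Submodule.add_mem _ hX'l (D.θ_mem_spec_zero hX'l))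
  have hθM : D.θ M = M := by rw [hM, map_smul, map_add, D.θ_θ, add_comm]
  have hθA : D.θ A = -A := D.θ_coe ⟨A, hA𝔞⟩
  have hcomm : ⁅A, M⁆ = 0 := D.spec_zero_eq_centralizer hu hMl ⟨A, hA𝔞⟩
  -- On such a `w`, `ad M` acts as the symmetric operator `c - ad A`, which commutes with it; with
  -- skewness this gives `‖[M, w]‖² = -‖[M, w]‖²`.
  have hkey : ∀ (c : ℝ) (w : G.lieAlgebra), ⁅X', w⁆ = c • w → ⁅M, w⁆ = 0 := by
    intro c w hw
    have h1 : ⁅M, w⁆ = c • w - ⁅A, w⁆ := by rw [← hw, hAM, add_lie]; abel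
    have hMA : ⁅M, ⁅A, w⁆⁆ = ⁅A, ⁅M, w⁆⁆ := by
      rw [leibniz_lie, ← lie_skew M A, hcomm, neg_zero, zero_lie, zero_add]
    have h2 : ⁅M, ⁅M, w⁆⁆ = c • ⁅M, w⁆ - ⁅A, ⁅M, w⁆⁆ := by
      conv_lhs => rw [h1]
      rw [lie_sub, lie_smul, hMA]
    have h3 : D.form ⁅M, w⁆ ⁅M, w⁆ = -D.form w ⁅M, ⁅M, w⁆⁆ := by rw [D.form_lie, hθM]
    have h4 : D.form w ⁅M, ⁅M, w⁆⁆ = D.form ⁅M, w⁆ ⁅M, w⁆ := by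
      rw [h2, map_sub, map_smul, ← D.form_lie_of_neg hθA]
      have h5 : D.form ⁅M, w⁆ ⁅M, w⁆ = D.form (c • w - ⁅A, w⁆) ⁅M, w⁆ := by rw [← h1]
      rw [h5, map_sub, map_smul, LinearMap.sub_apply, LinearMap.smul_apply]
    exact D.eq_zero_of_form (by linarith)
  have hM0 : M = 0 := by
    refine D.eq_zero_of_lie fun Y => ?_
    have htop : G.Ad l⁻¹ Y ∈ spec X Set.univ := by
      rw [D.spec_univ (D.θ_coe ⟨X, hX⟩)]; exact Submodule.mem_top
    have hY := Ad_mem_spec (g := l) hX'.symm htop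
    rw [G.Ad_Ad_inv] at hY
    have hle : spec X' Set.univ ≤ LinearMap.ker (LieAlgebra.ad ℝ G.lieAlgebra M) :=
      spec_le fun c _ w hw => hkey c w hw
    exact hle hY
  rw [hAM, hM0, add_zero]
  exact hA𝔞

/-- `Ad l` preserves `𝔞`, hence also its Killing complement in the centralizer of `u`, which is the
`θ`-fixed part. Consequently `Ad l` is an isometry of that centralizer. -/
theorem Ad_θ_comm {l : G.Pts} (hl : PreservesParts (u : G.lieAlgebra) l) {X : G.lieAlgebra}
    (hX : X ∈ spec (u : G.lieAlgebra) {0}) : G.Ad l (D.θ X) = D.θ (G.Ad l X) := by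
  have hfix : ∀ M ∈ spec (u : G.lieAlgebra) {0}, D.θ M = M → D.θ (G.Ad l M) = G.Ad l M := by
    intro M hMl hM
    set Z := G.Ad l M
    have hZ : Z ∈ spec (u : G.lieAlgebra) {0} := hl.1 M hMl
    have hA := D.sub_θ_mem hu hZ
    set A := Z - D.θ Z with hAdef
    have hθA : D.θ A = -A := D.θ_coe ⟨A, hA⟩
    have hAinv : D.θ (G.Ad l⁻¹ A) = -G.Ad l⁻¹ A := D.θ_coe ⟨_, D.Ad_mem_𝔞 hu hl.inv.1 hA⟩
    have h1 : killingForm ℝ G.lieAlgebra Z A = 0 := by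
      have h2 : killingForm ℝ G.lieAlgebra Z A =
          killingForm ℝ G.lieAlgebra M (G.Ad l⁻¹ A) := by
        rw [← G.killingForm_Ad l M, G.Ad_Ad_inv]
      have h3 := D.killingForm_θ M (G.Ad l⁻¹ A)
      rw [hM, hAinv, map_neg] at h3
      rw [h2]; linarith
    have h4 : killingForm ℝ G.lieAlgebra (D.θ Z) A = 0 := by
      have h5 := D.killingForm_θ Z A
      rw [hθA, map_neg, h1] at h5
      linarith
    have h6 : A = 0 := by
      refine D.eq_zero_of_form ?_
      rw [form_apply, hθA, map_neg, neg_neg]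
      have h7 : killingForm ℝ G.lieAlgebra A A = killingForm ℝ G.lieAlgebra (Z - D.θ Z) A := rfl
      rw [h7, LinearMap.map_sub₂, h1, h4, sub_zero]
    exact (sub_eq_zero.1 h6).symm
  have hA := D.sub_θ_mem hu hX
  have hM : D.θ (X + D.θ X) = X + D.θ X := by rw [map_add, D.θ_θ, add_comm]
  have h1 := hfix _ (Submodule.add_mem _ hX (D.θ_mem_spec_zero hX)) hM
  have h2 : D.θ (G.Ad l (X - D.θ X)) = -G.Ad l (X - D.θ X) :=
    D.θ_coe ⟨_, D.Ad_mem_𝔞 hu hl.1 hA⟩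
  rw [map_add, map_add] at h1
  rw [map_sub, map_sub] at h2
  have h3 : (2 : ℝ) • D.θ (G.Ad l X) = (2 : ℝ) • G.Ad l (D.θ X) := by
    rw [two_smul, two_smul]
    calc D.θ (G.Ad l X) + D.θ (G.Ad l X) = (D.θ (G.Ad l X) + D.θ (G.Ad l (D.θ X))) +
          (D.θ (G.Ad l X) - D.θ (G.Ad l (D.θ X))) := by abel
      _ = _ := by rw [h1, h2]; abel
  exact (smul_right_injective _ (two_ne_zero (α := ℝ)) h3).symm

theorem form_Ad_of_preservesParts {l : G.Pts} (hl : PreservesParts (u : G.lieAlgebra) l)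
    {X Y : G.lieAlgebra} (hY : Y ∈ spec (u : G.lieAlgebra) {0}) :
    D.form (G.Ad l X) (G.Ad l Y) = D.form X Y := by
  rw [form_apply, form_apply, ← D.Ad_θ_comm hu hl hY, G.killingForm_Ad]

/-- An isometry has no nontrivial Jordan block: if `Z = Ad l Y - Y` is fixed, then `⟨Z, Ad l Y⟩ =
⟨Z, Y⟩`. -/
theorem Ad_sub_eq_zero {l : G.Pts} (hl : PreservesParts (u : G.lieAlgebra) l)
    {Y : G.lieAlgebra} (hY : Y ∈ spec (u : G.lieAlgebra) {0})
    (h : G.Ad l (G.Ad l Y - Y) = G.Ad l Y - Y) : G.Ad l Y - Y = 0 := by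
  refine D.eq_zero_of_form ?_
  have h1 := D.form_Ad_of_preservesParts hu hl (X := G.Ad l Y - Y) hY
  rw [h] at h1
  rw [map_sub (D.form _), h1, sub_self]

end

/-- The fixed vectors of `Ad l` in the centralizer of `u`. -/
def fixedPart (u : G.lieAlgebra) (l : G.Pts) : Submodule ℝ G.lieAlgebra :=
  spec u {0} ⊓ LinearMap.ker (G.AdEnd l - 1)

omit D in
theorem mem_fixedPart {u : G.lieAlgebra} {l : G.Pts} {X : G.lieAlgebra} :
    X ∈ fixedPart u l ↔ X ∈ spec u {0} ∧ G.Ad l X = X := by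
  simp [fixedPart, sub_eq_zero]

/-- As `Y` is fixed by `Ad l`, the elements `l` and `exp (t Y)` commute, and `Ad l - 1` is
semisimple on the centralizer of `u`; so `eventually_ker_le_ker` applies. -/
theorem eventually_fixedPart_le {u : D.𝔞} (hu : u ∈ interior D.chamber) {l : G.Pts}
    (hl : PreservesParts (u : G.lieAlgebra) l) {Y : G.lieAlgebra}
    (hY : Y ∈ fixedPart (u : G.lieAlgebra) l) :
    ∀ᶠ t : ℝ in 𝓝 0, fixedPart (u : G.lieAlgebra) (l * G.exp (t • Y)) ≤
      fixedPart (u : G.lieAlgebra) l := by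
  rw [mem_fixedPart] at hY
  have hlt : ∀ t : ℝ, PreservesParts (u : G.lieAlgebra) (l * G.exp (t • Y)) := fun t =>
    hl.mul (preservesParts_exp (Submodule.smul_mem _ t hY.1))
  let T : ∀ g : G.Pts, PreservesParts (u : G.lieAlgebra) g →
      Module.End ℝ (spec (u : G.lieAlgebra) {0}) := fun g hg => (G.AdEnd g).restrict hg.1
  have hcomm : ∀ (t : ℝ) (X : G.lieAlgebra),
      G.Ad l (G.Ad (l * G.exp (t • Y)) X) = G.Ad (l * G.exp (t • Y)) (G.Ad l X) := by
    intro t X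
    have h1 : l * G.exp (t • Y) * l⁻¹ = G.exp (t • Y) := by
      rw [← G.exp_Ad, G.Ad_smul, hY.2]
    rw [← G.Ad_mul, ← G.Ad_mul]
    congr 2
    calc l * (l * G.exp (t • Y)) = l * (l * G.exp (t • Y) * l⁻¹) * l := by group
      _ = _ := by rw [h1]
  have hcomm' : ∀ t, Commute (T _ (hlt t) - 1) (T l hl - 1) := fun t => by
    have h : Commute (T _ (hlt t)) (T l hl) := by
      refine LinearMap.ext fun x => Subtype.ext ?_
      exact (hcomm t x).symm
    exact (h.sub_right (Commute.one_right _)).sub_left (Commute.one_left _)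
  have hdisj : Disjoint (LinearMap.ker (T l hl - 1)) (LinearMap.range (T l hl - 1)) := by
    rw [Submodule.disjoint_def]
    rintro _ hx ⟨y, rfl⟩
    refine Subtype.ext ?_
    refine D.Ad_sub_eq_zero hu hl y.2 ?_
    have := congrArg Subtype.val (LinearMap.mem_ker.1 hx)
    exact sub_eq_zero.1 this
  have hev := eventually_ker_le_ker (l := 𝓝 (0 : ℝ)) (F := fun t => T _ (hlt t) - 1)
    (A := T l hl - 1) (fun x => by
      refine Tendsto.sub ?_ tendsto_const_nhds
      rw [tendsto_subtype_rng]
      have hc : Continuous fun t : ℝ => G.Ad (l * G.exp (t • Y)) (x : G.lieAlgebra) :=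
        G.continuous_Ad_of (continuous_const.mul (G.continuous_exp.comp (by fun_prop)))
          continuous_const
      have := hc.tendsto 0
      rw [zero_smul, G.exp_zero, mul_one] at this
      exact this) hdisj
    (fun t x hx => by
      have := congrArg (fun f : Module.End ℝ _ => f x) (hcomm' t).eq
      change (T _ (hlt t) - 1) ((T l hl - 1) x) = (T l hl - 1) ((T _ (hlt t) - 1) x) at this
      rw [← this, hx, map_zero])
    (fun t => by
      rintro _ ⟨y, rfl⟩
      have := congrArg (fun f : Module.End ℝ _ => f y) (hcomm' t).eq
      exact ⟨_, this.symm⟩)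
  filter_upwards [hev] with t ht X hX
  rw [mem_fixedPart] at hX ⊢
  refine ⟨hX.1, ?_⟩
  have h1 : (⟨X, hX.1⟩ : spec (u : G.lieAlgebra) {0}) ∈ LinearMap.ker (T _ (hlt t) - 1) := by
    rw [LinearMap.mem_ker]
    refine Subtype.ext ?_
    change G.Ad _ X - X = 0
    rw [hX.2, sub_self]
  have h2 := congrArg Subtype.val (LinearMap.mem_ker.1 (ht h1))
  exact sub_eq_zero.1 h2

theorem lie_eq_zero_of_eventually {X Y : G.lieAlgebra}
    (h : ∀ᶠ t : ℝ in 𝓝 0, G.Ad (G.exp (t • Y)) X = X) : ⁅Y, X⁆ = 0 := by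
  by_contra hne
  obtain ⟨ℓ, hℓ⟩ := Module.Projective.exists_dual_ne_zero ℝ hne
  have h1 := G.hasDerivAt_Ad_exp ℓ Y X
  have h2 : HasDerivAt (fun t : ℝ => ℓ (G.Ad (G.exp (t • Y)) X)) 0 0 :=
    (hasDerivAt_const (0 : ℝ) (ℓ X)).congr_of_eventuallyEq (h.mono fun t ht => by simp only [ht])
  exact hℓ (h1.unique h2)

/-- Every element that preserves the parts of `ad u` agrees on `𝔞` with one whose fixed vectors
in the centralizer of `u` commute. -/
theorem exists_fixedPart_abelian {u : D.𝔞} (hu : u ∈ interior D.chamber) {l : G.Pts}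
    (hl : PreservesParts (u : G.lieAlgebra) l) :
    ∃ l', PreservesParts (u : G.lieAlgebra) l' ∧ (∀ H ∈ D.𝔞, G.Ad l' H = G.Ad l H) ∧
      ∀ X ∈ fixedPart (u : G.lieAlgebra) l', ∀ Y ∈ fixedPart (u : G.lieAlgebra) l', ⁅X, Y⁆ = 0 := by
  let S : Set G.Pts := {l' | PreservesParts (u : G.lieAlgebra) l' ∧ ∀ H ∈ D.𝔞, G.Ad l' H = G.Ad l H}
  -- Take the fixed space of least dimension. Perturbing to `l' exp (t Y)` with `Y` fixed does not
  -- change the action on `𝔞` and cannot enlarge the fixed space, so leaves it equal; then `exp (t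
  -- Y)` fixes it pointwise, and differentiation gives commutation.
  obtain ⟨l', ⟨hl', hagree⟩, hmin⟩ := (measure fun l' : G.Pts =>
    Module.finrank ℝ (fixedPart (u : G.lieAlgebra) l')).wf.has_min S ⟨l, hl, fun _ _ => rfl⟩
  refine ⟨l', hl', hagree, fun Y hY X hX => ?_⟩
  refine lie_eq_zero_of_eventually ?_
  filter_upwards [D.eventually_fixedPart_le hu hl' hY] with t ht
  have hmem : l' * G.exp (t • Y) ∈ S := by
    refine ⟨hl'.mul (preservesParts_exp (Submodule.smul_mem _ t hY.1)), fun H hH => ?_⟩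
    rw [G.Ad_mul, G.Ad_exp_eq_self, hagree H hH]
    rw [smul_lie, ← lie_skew, D.spec_zero_eq_centralizer hu hY.1 ⟨H, hH⟩, neg_zero, smul_zero]
  have hle : Module.finrank ℝ (fixedPart (u : G.lieAlgebra) l') ≤
      Module.finrank ℝ (fixedPart (u : G.lieAlgebra) (l' * G.exp (t • Y))) :=
    not_lt.1 (hmin _ hmem)
  have heq := Submodule.eq_of_le_of_finrank_le ht hle
  have hX' : X ∈ fixedPart (u : G.lieAlgebra) (l' * G.exp (t • Y)) := heq ▸ hX
  have h1 := (mem_fixedPart.1 hX').2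
  have h2 := (mem_fixedPart.1 hX).2
  rw [G.Ad_mul] at h1
  have h3 := congrArg (G.Ad l'⁻¹) (h1.trans h2.symm)
  rwa [G.Ad_inv_Ad, G.Ad_inv_Ad] at h3

end CartanData

end ConnectedRealAlgebraicGroup

/-! ### Multiplicity of the eigenvalue 1 of `Ad g`, and rigidity on `𝔞` -/

namespace ConnectedRealAlgebraicGroup

variable {n : ℕ} {G : ConnectedRealAlgebraicGroup n}

section

attribute [local instance] Matrix.linftyOpNormedRing Matrix.linftyOpNormedAlgebra

theorem analyticOnNhd_Ad_exp_affine (ℓ : G.lieAlgebra →ₗ[ℝ] ℝ) (H X Y : G.lieAlgebra) :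
    AnalyticOnNhd ℝ (fun t : ℝ => ℓ (G.Ad (G.exp (H + t • X)) Y)) Set.univ := by
  refine G.analyticOnNhd_coeff ℓ Y (fun t => G.exp (H + t • X)) ?_ ?_
  · exact analyticOnNhd_exp_affine (H : Matrix (Fin n) (Fin n) ℝ) X
  · have h := analyticOnNhd_exp_affine (-(H : Matrix (Fin n) (Fin n) ℝ)) (-X)
    refine h.congr isOpen_univ fun t _ => ?_
    change NormedSpace.exp _ = NormedSpace.exp (-((H : Matrix (Fin n) (Fin n) ℝ) + t • (X : Matrix (Fin n) (Fin n) ℝ)))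
    rw [neg_add, smul_neg]

theorem analyticOnNhd_Ad_list (ℓ : G.lieAlgebra →ₗ[ℝ] ℝ) (L : List G.lieAlgebra)
    (Y : G.lieAlgebra) :
    AnalyticOnNhd ℝ (fun t : ℝ => ℓ (G.Ad (L.map fun X => G.exp (t • X)).prod Y)) Set.univ := by
  refine G.analyticOnNhd_coeff ℓ Y (fun t => (L.map fun X => G.exp (t • X)).prod) ?_ ?_
  · induction L with
    | nil => exact analyticOnNhd_const
    | cons X L ih =>
      have h := analyticOnNhd_exp_affine 0 (X : Matrix (Fin n) (Fin n) ℝ)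
      intro t ht
      refine ((h t ht).mul (ih t ht)).congr (Eventually.of_forall fun s => ?_)
      simp only [zero_add, List.map_cons, List.prod_cons]
      rfl
  · induction L with
    | nil => exact analyticOnNhd_const
    | cons X L ih =>
      have h := analyticOnNhd_exp_affine 0 (-(X : Matrix (Fin n) (Fin n) ℝ))
      intro t ht
      refine ((ih t ht).mul (h t ht)).congr (Eventually.of_forall fun s => ?_)
      simp only [zero_add, List.map_cons, List.prod_cons, Subgroup.coe_mul, mul_inv_rev,
        smul_neg]
      rfl

end

theorem finrank_ker_le_maxGenEigenspace (T : Module.End ℝ G.lieAlgebra) :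
    Module.finrank ℝ (LinearMap.ker T) ≤ Module.finrank ℝ (T.maxGenEigenspace 0) := by
  refine Submodule.finrank_mono ?_
  rw [← Module.End.eigenspace_zero]
  exact Module.End.genEigenspace_le_maximal _ _ _

namespace CartanData

variable (D : G.CartanData)

/-- `ad H` commutes with its adjoint `-ad (θ H)`, and a normal operator has the same kernel as its
square. -/
theorem eq_zero_of_lie_lie {H Y : G.lieAlgebra} (hH : ⁅H, D.θ H⁆ = 0) (h : ⁅H, ⁅H, Y⁆⁆ = 0) :
    ⁅H, Y⁆ = 0 := by
  set X := ⁅H, Y⁆ with hX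
  have h1 : ⁅H, ⁅D.θ H, X⁆⁆ = 0 := by
    rw [leibniz_lie, hH, zero_lie, h, lie_zero, add_zero]
  have h2 : ⁅D.θ H, X⁆ = 0 := by
    refine D.eq_zero_of_form ?_
    rw [D.form_lie, D.θ_θ, h1, map_zero, neg_zero]
  refine D.eq_zero_of_form ?_
  conv_lhs => enter [1]; rw [hX]
  rw [D.form_lie, h2, map_zero, neg_zero]

/-- The centralizer of a subspace. -/
def _root_.ConnectedRealAlgebraicGroup.centralizerOf (C : Submodule ℝ G.lieAlgebra) :
    Submodule ℝ G.lieAlgebra :=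
  ⨅ H : C, LinearMap.ker (LieAlgebra.ad ℝ G.lieAlgebra (H : G.lieAlgebra))

omit D in
theorem mem_centralizerOf {C : Submodule ℝ G.lieAlgebra} {X : G.lieAlgebra} :
    X ∈ centralizerOf C ↔ ∀ H ∈ C, ⁅H, X⁆ = 0 := by
  simp [centralizerOf, Submodule.mem_iInf]

variable {u : D.𝔞} (hu : u ∈ interior D.chamber)

include hu

theorem lie_θ_self {H : G.lieAlgebra} (hH : H ∈ spec (u : G.lieAlgebra) {0}) :
    ⁅H, D.θ H⁆ = 0 := by
  have h := D.spec_zero_eq_centralizer hu hH ⟨_, D.sub_θ_mem hu hH⟩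
  rw [Subtype.coe_mk, sub_lie, lie_self, zero_sub, neg_eq_zero] at h
  rw [← lie_skew, h, neg_zero]

/-- Choose `H` so that `ad H` has the smallest kernel. For small `t ≠ 0` the kernel of `ad (H + t
H')` lies in that of `ad H`, so equals it, and is then killed by `ad H'`. -/
theorem exists_generic {C : Submodule ℝ G.lieAlgebra} (hC : C ≤ spec (u : G.lieAlgebra) {0})
    (hab : ∀ X ∈ C, ∀ Y ∈ C, ⁅X, Y⁆ = 0) :
    ∃ H ∈ C, ∀ X, ⁅H, X⁆ = 0 → X ∈ centralizerOf C := by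
  obtain ⟨H, hH, hmin⟩ := (measure fun H : G.lieAlgebra => Module.finrank ℝ
    (LinearMap.ker (LieAlgebra.ad ℝ G.lieAlgebra H))).wf.has_min (C : Set G.lieAlgebra)
    ⟨0, C.zero_mem⟩
  refine ⟨H, hH, fun X hX => mem_centralizerOf.2 fun H' hH' => ?_⟩
  have hcomm : Commute (LieAlgebra.ad ℝ G.lieAlgebra H) (LieAlgebra.ad ℝ G.lieAlgebra H') := by
    rw [commute_iff_lie_eq, ← LieHom.map_lie, hab H hH H' hH', map_zero]
  have hcomm' : ∀ t : ℝ, Commute (LieAlgebra.ad ℝ G.lieAlgebra H)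
      (LieAlgebra.ad ℝ G.lieAlgebra H + t • LieAlgebra.ad ℝ G.lieAlgebra H') := fun t =>
    (Commute.refl _).add_right (hcomm.smul_right t)
  have hev := eventually_ker_le_ker (l := 𝓝[≠] (0 : ℝ))
    (F := fun t => LieAlgebra.ad ℝ G.lieAlgebra H + t • LieAlgebra.ad ℝ G.lieAlgebra H')
    (A := LieAlgebra.ad ℝ G.lieAlgebra H) (fun x => by
      have hc : Continuous fun t : ℝ => ⁅H, x⁆ + t • ⁅H', x⁆ := by fun_prop
      have := (hc.tendsto 0).mono_left (nhdsWithin_le_nhds (s := {0}ᶜ))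
      rw [zero_smul, add_zero] at this
      exact this)
    (by
      rw [Submodule.disjoint_def]
      rintro _ hx ⟨y, rfl⟩
      exact D.eq_zero_of_lie_lie (D.lie_θ_self hu (hC hH)) hx)
    (fun t x hx => by
      have := LinearMap.congr_fun (hcomm' t).eq x
      rw [Module.End.mul_apply, Module.End.mul_apply, hx, map_zero] at this
      exact this)
    (fun t => by
      rintro _ ⟨y, rfl⟩
      exact ⟨_, LinearMap.congr_fun (hcomm' t).eq y⟩)
  obtain ⟨t, ht, ht0⟩ := (hev.and self_mem_nhdsWithin).exists
  have hmem : H + t • H' ∈ C := C.add_mem hH (C.smul_mem t hH')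
  have heqad : LieAlgebra.ad ℝ G.lieAlgebra (H + t • H') =
      LieAlgebra.ad ℝ G.lieAlgebra H + t • LieAlgebra.ad ℝ G.lieAlgebra H' := by
    rw [map_add, map_smul]
  rw [← heqad] at ht
  have hle : Module.finrank ℝ (LinearMap.ker (LieAlgebra.ad ℝ G.lieAlgebra H)) ≤
      Module.finrank ℝ (LinearMap.ker (LieAlgebra.ad ℝ G.lieAlgebra (H + t • H'))) :=
    not_lt.1 (hmin _ hmem)
  have heq := Submodule.eq_of_le_of_finrank_le ht hle
  have hX' : X ∈ LinearMap.ker (LieAlgebra.ad ℝ G.lieAlgebra (H + t • H')) := heq ▸ hX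
  have h1 : ⁅H + t • H', X⁆ = 0 := hX'
  rw [add_lie, hX, zero_add, smul_lie] at h1
  exact (smul_eq_zero.1 h1).resolve_left ht0

/-- The multiplicity of the eigenvalue `1` of `Ad g` is at least the dimension of any abelian
subspace of the centralizer of `u`. -/
theorem finrank_le_maxGenEigenspace {C : Submodule ℝ G.lieAlgebra}
    (hC : C ≤ spec (u : G.lieAlgebra) {0}) (hab : ∀ X ∈ C, ∀ Y ∈ C, ⁅X, Y⁆ = 0) (g : G.Pts) :
    Module.finrank ℝ C ≤ Module.finrank ℝ ((G.AdEnd g - 1).maxGenEigenspace 0) := by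
  obtain ⟨H, hH, hgen⟩ := D.exists_generic hu hC hab
  -- By the inverse function theorem every element near `H` is conjugate to some `H + Z` with `Z`
  -- centralizing `C`, and `Ad (exp (H + Z))` fixes `C` pointwise.
  have hnear : ∀ᶠ X in 𝓝 (0 : G.lieAlgebra), Module.finrank ℝ C ≤
      Module.finrank ℝ ((G.AdEnd (G.exp (H + X)) - 1).maxGenEigenspace 0) := by
    have hev := eventually_exists_Ad_exp (⊤ : Submodule ℝ G.lieAlgebra) (centralizerOf C) ⊤ H
      (fun _ _ _ _ => Submodule.mem_top) (by
        intro v _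
        have hdisj : Disjoint (LinearMap.range (LieAlgebra.ad ℝ G.lieAlgebra H))
            (LinearMap.ker (LieAlgebra.ad ℝ G.lieAlgebra H)) := by
          rw [Submodule.disjoint_def]
          rintro _ ⟨y, rfl⟩ hx
          exact D.eq_zero_of_lie_lie (D.lie_θ_self hu (hC hH)) hx
        have htop := Submodule.eq_top_of_disjoint _ _
          (LinearMap.finrank_range_add_finrank_ker (LieAlgebra.ad ℝ G.lieAlgebra H)).ge hdisj
        obtain ⟨_, ⟨Y, rfl⟩, Z, hZ, rfl⟩ := Submodule.mem_sup.1 (htop ▸ Submodule.mem_top :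
          v ∈ LinearMap.range (LieAlgebra.ad ℝ G.lieAlgebra H) ⊔
            LinearMap.ker (LieAlgebra.ad ℝ G.lieAlgebra H))
        refine ⟨-Y, Submodule.mem_top, Z, hgen Z hZ, ?_⟩
        rw [neg_lie, lie_skew]; rfl)
    filter_upwards [hev] with X hX
    obtain ⟨Y, -, Z, hZ, h⟩ := hX Submodule.mem_top
    rw [← h, G.exp_Ad]
    refine le_trans ?_ (finrank_ker_le_maxGenEigenspace _)
    have hf : Module.finrank ℝ (C.map (G.AdEnd (G.exp Y))) = Module.finrank ℝ C :=
      LinearEquiv.finrank_map_eq (G.Ad (G.exp Y)).toLinearEquiv C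
    rw [← hf]
    refine Submodule.finrank_mono ?_
    rintro _ ⟨c, hc, rfl⟩
    have hfix : G.Ad (G.exp (H + Z)) c = c := G.Ad_exp_eq_self (by
      rw [add_lie, hab H hH c hc, zero_add, ← lie_skew, mem_centralizerOf.1 hZ c hc, neg_zero])
    rw [LinearMap.mem_ker, LinearMap.sub_apply, Module.End.one_apply, sub_eq_zero, AdEnd_apply,
      AdEnd_apply, ← G.Ad_mul, inv_mul_cancel_right, G.Ad_mul, hfix]
  have hexp : ∀ X : G.lieAlgebra, Module.finrank ℝ C ≤
      Module.finrank ℝ ((G.AdEnd (G.exp X) - 1).maxGenEigenspace 0) := by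
    intro X
    have h := le_finrank_maxGenEigenspace_of_analytic (d := Module.finrank ℝ C)
      (F := fun t : ℝ => G.AdEnd (G.exp (H + t • (X - H))) - 1)
      (fun ℓ x => by
        have h1 := (analyticOnNhd_Ad_exp_affine ℓ H (X - H) x).sub
          (analyticOnNhd_const (v := ℓ x))
        refine h1.congr isOpen_univ fun t _ => ?_
        rw [LinearMap.sub_apply, map_sub]; rfl)
      (by
        have hc : Continuous fun t : ℝ => t • (X - H) := by fun_prop
        have h1 := hc.tendsto 0
        rw [zero_smul] at h1
        exact h1.eventually hnear) 1
    have h' : H + (1 : ℝ) • (X - H) = X := by rw [one_smul]; abel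
    beta_reduce at h
    rwa [h'] at h
  -- Scaling all factors of a product of exponentials by `t` gives an analytic path. For small `t`
  -- it consists of single exponentials, where the bound is known, so the bound continues to `t =
  -- 1`.
  obtain ⟨L, rfl⟩ := G.exists_list_exp g
  have h := le_finrank_maxGenEigenspace_of_analytic (d := Module.finrank ℝ C)
    (F := fun t : ℝ => G.AdEnd (L.map fun X => G.exp (t • X)).prod - 1)
    (fun ℓ x => by
      have h1 := (analyticOnNhd_Ad_list ℓ L x).sub (analyticOnNhd_const (v := ℓ x))
      refine h1.congr isOpen_univ fun t _ => ?_
      rw [LinearMap.sub_apply, map_sub]; rfl)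
    (by
      have hc : Continuous fun t : ℝ => (L.map fun X => G.exp (t • X)).prod :=
        continuous_list_prod L fun X _ => G.continuous_exp.comp (by fun_prop)
      have h1 := hc.tendsto 0
      have h2 : (L.map fun X => G.exp ((0 : ℝ) • X)).prod = 1 := by
        simp [G.exp_zero]
      rw [h2] at h1
      filter_upwards [h1.eventually G.eventually_exists_exp] with t ⟨X, hX⟩
      rw [← hX]
      exact hexp X) 1
  have h' : (L.map fun X => G.exp ((1 : ℝ) • X)) = L.map G.exp :=
    List.map_congr_left fun X _ => by rw [one_smul]
  beta_reduce at h
  rwa [h'] at h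

omit hu in
theorem exists_parts (X : G.lieAlgebra) : ∃ A ∈ spec (u : G.lieAlgebra) (Set.Iio 0),
    ∃ B ∈ spec (u : G.lieAlgebra) {0}, ∃ C ∈ spec (u : G.lieAlgebra) (Set.Ioi 0),
      X = A + B + C := by
  have h1 := D.spec_sup_eq_top (D.θ_coe u) (s := Set.Iic 0) (t := Set.Ioi 0) Set.Iic_union_Ioi
  obtain ⟨Y, hY, C, hC, rfl⟩ := Submodule.mem_sup.1 (h1 ▸ Submodule.mem_top :
    X ∈ spec (u : G.lieAlgebra) (Set.Iic 0) ⊔ spec (u : G.lieAlgebra) (Set.Ioi 0))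
  have hle : spec (u : G.lieAlgebra) (Set.Iic 0) ≤
      spec (u : G.lieAlgebra) (Set.Iio 0) ⊔ spec (u : G.lieAlgebra) {0} := by
    refine spec_le fun c hc Z hZ => ?_
    rcases lt_or_eq_of_le (Set.mem_Iic.1 hc) with h | h
    · exact Submodule.mem_sup_left (mem_spec (c := c) h hZ)
    · exact Submodule.mem_sup_right (mem_spec (c := c) h hZ)
  obtain ⟨A, hA, B, hB, rfl⟩ := Submodule.mem_sup.1 (hle hY)
  exact ⟨A, hA, B, hB, C, hC, rfl⟩

omit hu in
theorem parts_unique {A B C : G.lieAlgebra} (hA : A ∈ spec (u : G.lieAlgebra) (Set.Iio 0))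
    (hB : B ∈ spec (u : G.lieAlgebra) {0}) (hC : C ∈ spec (u : G.lieAlgebra) (Set.Ioi 0))
    (h : A + B + C = 0) : A = 0 ∧ B = 0 ∧ C = 0 := by
  have hθ := D.θ_coe u
  have dAB : Disjoint (Set.Iio (0 : ℝ)) {0} := by simp
  have dBC : Disjoint ({0} : Set ℝ) (Set.Ioi 0) := by simp
  have dAC : Disjoint (Set.Iio (0 : ℝ)) (Set.Ioi 0) :=
    Set.disjoint_left.2 fun x hx hx' => lt_asymm (Set.mem_Iio.1 hx) hx'
  have fAB := D.form_spec hθ dAB hA hB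
  have fBC := D.form_spec hθ dBC hB hC
  have fAC := D.form_spec hθ dAC hA hC
  have hA0 : A = 0 := by
    refine D.eq_zero_of_form ?_
    have := congrArg (D.form A) h
    rwa [map_add, map_add, fAB, fAC, add_zero, add_zero, map_zero] at this
  have hC0 : C = 0 := by
    refine D.eq_zero_of_form ?_
    have := congrArg (D.form C) h
    rwa [map_add, map_add, D.form_symm C A, D.form_symm C B, fBC, fAC, zero_add, zero_add,
      map_zero] at this
  refine ⟨hA0, ?_, hC0⟩
  simpa [hA0, hC0] using h

omit hu in
/-- For large `t`, the element `l exp (-t u)` has no fixed vectors in the positive and negative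
parts. -/
theorem eventually_no_fixed {l : G.Pts} (hl : PreservesParts (u : G.lieAlgebra) l) :
    ∀ᶠ t : ℝ in atTop,
      (∀ X ∈ spec (u : G.lieAlgebra) (Set.Ioi 0), G.Ad (l * G.exp (t • -(u : G.lieAlgebra))) X = X → X = 0) ∧
      ∀ X ∈ spec (u : G.lieAlgebra) (Set.Iio 0), G.Ad (l * G.exp (t • -(u : G.lieAlgebra))) X = X → X = 0 := by
  have hgen : ∀ (S : Submodule ℝ G.lieAlgebra) (g : ℝ → G.Pts) (hg : ∀ t, ∀ X ∈ S, G.Ad (g t) X ∈ S),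
      (∀ X ∈ S, Tendsto (fun t => G.Ad (g t) X) atTop (𝓝 0)) →
      ∀ᶠ t : ℝ in atTop, ∀ X ∈ S, G.Ad (g t) X = X → X = 0 := by
    intro S g hg hlim
    have hev := eventually_ker_eq_bot (V := S) (l := atTop)
      (F := fun t => (G.AdEnd (g t)).restrict (hg t) - 1) (A := -1) (fun x => by
        rw [tendsto_subtype_rng]
        have := (hlim x x.2).sub_const (x : G.lieAlgebra)
        rw [zero_sub] at this
        exact this) (by
        rw [LinearMap.ker_eq_bot']
        intro x hx
        simpa using hx)
    filter_upwards [hev] with t ht X hX h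
    have := LinearMap.ker_eq_bot'.1 ht ⟨X, hX⟩ (Subtype.ext (sub_eq_zero.2 h))
    exact congrArg Subtype.val this
  have hexp : ∀ t : ℝ, PreservesParts (u : G.lieAlgebra) (G.exp (t • -(u : G.lieAlgebra))) :=
    fun t => preservesParts_exp (Submodule.smul_mem _ t (Submodule.neg_mem _
      (D.coe_mem_spec_zero u)))
  have hlt : ∀ t : ℝ, PreservesParts (u : G.lieAlgebra) (l * G.exp (t • -(u : G.lieAlgebra))) :=
    fun t => hl.mul (hexp t)
  have h1 := hgen (spec (u : G.lieAlgebra) (Set.Ioi 0)) (fun t => l * G.exp (t • -(u : G.lieAlgebra)))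
    (fun t => (hlt t).2.1) (fun X hX => by
      have hX' : X ∈ spec (-(u : G.lieAlgebra)) (Set.Iio 0) := by
        rw [spec_neg]; simpa using hX
      have hc : Continuous (G.Ad l) := G.continuous_Ad_of continuous_const continuous_id
      have := (hc.tendsto 0).comp (Ad_exp_smul_tendsto_zero hX')
      rw [map_zero] at this
      refine this.congr fun t => ?_
      rw [Function.comp_apply, G.Ad_mul])
  -- On the negative part the inverse element contracts, and it has the same fixed vectors.
  have h2 := hgen (spec (u : G.lieAlgebra) (Set.Iio 0))
    (fun t => (l * G.exp (t • -(u : G.lieAlgebra)))⁻¹)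
    (fun t => (hlt t).inv.2.2) (fun X hX => by
      refine (Ad_exp_smul_tendsto_zero (hl.inv.2.2 X hX)).congr fun t => ?_
      rw [mul_inv_rev, ← G.exp_neg, smul_neg, neg_neg, G.Ad_mul])
  filter_upwards [h1, h2] with t ht1 ht2
  refine ⟨ht1, fun X hX h => ht2 X hX ?_⟩
  conv_lhs => rw [← h]
  rw [G.Ad_inv_Ad]

/-- An element that preserves the parts of `ad u` centralizes `𝔞`. -/
theorem Ad_eq_self_of_preservesParts {l : G.Pts} (hl : PreservesParts (u : G.lieAlgebra) l)
    {H : G.lieAlgebra} (hH : H ∈ D.𝔞) : G.Ad l H = H := by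
  obtain ⟨l', hl', hagree, hab⟩ := D.exists_fixedPart_abelian hu hl
  rw [← hagree H hH]
  set V := fixedPart (u : G.lieAlgebra) l' with hV
  have hVl : V ≤ spec (u : G.lieAlgebra) {0} := inf_le_left
  have h𝔞l : D.𝔞 ≤ spec (u : G.lieAlgebra) {0} := fun X hX => D.coe_mem_spec_zero ⟨X, hX⟩
  have hcV : ∀ X ∈ D.𝔞, ∀ Y ∈ V, ⁅X, Y⁆ = 0 := fun X hX Y hY =>
    D.spec_zero_eq_centralizer hu (hVl hY) ⟨X, hX⟩
  have hCab : ∀ X ∈ D.𝔞 ⊔ V, ∀ Y ∈ D.𝔞 ⊔ V, ⁅X, Y⁆ = 0 := by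
    intro X hX Y hY
    obtain ⟨X₁, h₁, X₂, h₂, rfl⟩ := Submodule.mem_sup.1 hX
    obtain ⟨Y₁, k₁, Y₂, k₂, rfl⟩ := Submodule.mem_sup.1 hY
    rw [add_lie, lie_add, lie_add, D.𝔞_maximal.prop.2 X₁ h₁ Y₁ k₁, hcV X₁ h₁ Y₂ k₂,
      ← lie_skew, hcV Y₁ k₁ X₂ h₂, hab X₂ h₂ Y₂ k₂]
    simp
  obtain ⟨t, ht1, ht2⟩ := (D.eventually_no_fixed hl').exists
  set g := l' * G.exp (t • -(u : G.lieAlgebra)) with hg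
  have hgQ : PreservesParts (u : G.lieAlgebra) g :=
    hl'.mul (preservesParts_exp (Submodule.smul_mem _ t (Submodule.neg_mem _
      (D.coe_mem_spec_zero u))))
  have hg0 : ∀ X ∈ spec (u : G.lieAlgebra) {0}, G.Ad g X = G.Ad l' X := by
    intro X hX
    rw [hg, G.Ad_mul, G.Ad_exp_eq_self]
    rw [smul_lie, neg_lie, mem_spec_zero.1 hX, neg_zero, smul_zero]
  have hfr := D.finrank_le_maxGenEigenspace hu (sup_le h𝔞l hVl) hCab g
  -- By induction on the exponent: the positive and negative components vanish by the choice of `t`,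
  -- and on the centralizer of `u` an isometry has no Jordan blocks.
  have hmax : (G.AdEnd g - 1).maxGenEigenspace 0 ≤ V := by
    intro X hX
    obtain ⟨m, hm⟩ := Module.End.mem_maxGenEigenspace _ _ _ |>.1 hX
    rw [zero_smul, sub_zero] at hm
    clear hX
    induction m generalizing X with
    | zero =>
      have hX0 : X = 0 := by simpa using hm
      rw [hX0]; exact V.zero_mem
    | succ m ih =>
      have hY := ih (X := (G.AdEnd g - 1) X) (by rw [pow_succ] at hm; exact hm)
      have hYX : (G.AdEnd g - 1) X = G.Ad g X - X := rfl
      rw [hYX] at hY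
      obtain ⟨A, hA, B, hB, C, hC, rfl⟩ := D.exists_parts X
      obtain ⟨hYl, hYfix⟩ := mem_fixedPart.1 hY
      set Y := G.Ad g (A + B + C) - (A + B + C) with hYdef
      have hdec : (G.Ad g A - A) + (G.Ad g B - B - Y) + (G.Ad g C - C) = 0 := by
        rw [hYdef, G.Ad_add, G.Ad_add]; abel
      obtain ⟨hA0, hB0, hC0⟩ := D.parts_unique
        (Submodule.sub_mem _ (hgQ.2.2 A hA) hA)
        (Submodule.sub_mem _ (Submodule.sub_mem _ (hgQ.1 B hB) hB) hYl)
        (Submodule.sub_mem _ (hgQ.2.1 C hC) hC) hdec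
      have hA' : A = 0 := ht2 A hA (sub_eq_zero.1 hA0)
      have hC' : C = 0 := ht1 C hC (sub_eq_zero.1 hC0)
      rw [hg0 B hB, sub_eq_zero] at hB0
      have hB1 := D.Ad_sub_eq_zero hu hl' hB (by rw [hB0]; exact hYfix)
      rw [hA', hC', zero_add, add_zero]
      exact mem_fixedPart.2 ⟨hB, sub_eq_zero.1 hB1⟩
  -- The multiplicity of the eigenvalue 1 is at least the dimension of `𝔞 ⊔ V` and at most that of
  -- `V`.
  have heq : V = D.𝔞 ⊔ V := Submodule.eq_of_le_of_finrank_le le_sup_right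
    (hfr.trans (Submodule.finrank_mono hmax))
  have hHV : H ∈ V := heq ▸ Submodule.mem_sup_left hH
  exact (mem_fixedPart.1 hHV).2

end CartanData

end ConnectedRealAlgebraicGroup

/-! ### Functions of diagonalizable maps -/

section LinearAlgebra

variable {V : Type*} [AddCommGroup V] [Module ℝ V] [FiniteDimensional ℝ V]

/-- Interpolate `f` by a polynomial at the finitely many eigenvalues. -/
theorem exists_apply_eq_smul_of_eigen (T : Module.End ℝ V) (f : ℝ → ℝ) :
    ∃ S : Module.End ℝ V, ∀ (c : ℝ) (x : V), T x = c • x → S x = f c • x := by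
  let s : Finset ℝ := (Module.End.finite_hasEigenvalue T).toFinset
  refine ⟨Polynomial.aeval T (Lagrange.interpolate s id f), fun c x hx => ?_⟩
  rcases eq_or_ne x 0 with rfl | hx0
  · simp
  have hv : T.HasEigenvector c x := ⟨Module.End.mem_eigenspace_iff.2 hx, hx0⟩
  have hc : c ∈ s := (Set.Finite.mem_toFinset _).2 (Module.End.hasEigenvalue_of_hasEigenvector hv)
  rw [Module.End.aeval_apply_of_hasEigenvector hv]
  congr 1
  exact Lagrange.eval_interpolate_at_node f Function.injective_id.injOn hc

theorem nonneg_of_eigen (B : V →ₗ[ℝ] V →ₗ[ℝ] ℝ) (hB : ∀ x y, B x y = B y x)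
    (hpos : ∀ x, x ≠ 0 → 0 < B x x) (T : Module.End ℝ V) (hT : ∀ x y, B (T x) y = B x (T y))
    (S : Module.End ℝ V) (f : ℝ → ℝ) (hf : ∀ c, 0 ≤ f c)
    (hS : ∀ (c : ℝ) (x : V), T x = c • x → S x = f c • x) (y : V) : 0 ≤ B (S y) y := by
  have hy : y ∈ ⨆ μ, T.eigenspace μ := by
    rw [iSup_eigenspace_eq_top_of_symm B hB hpos T hT]; exact Submodule.mem_top
  obtain ⟨g, hg, rfl⟩ := (Submodule.mem_iSup_iff_exists_finsupp _ _).1 hy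
  have hg' : ∀ c, T (g c) = c • g c := fun c => Module.End.mem_eigenspace_iff.1 (hg c)
  have horth : ∀ c c', c ≠ c' → B (g c) (g c') = 0 := by
    intro c c' hne
    have h := hT (g c) (g c')
    rw [hg', hg', map_smul, map_smul, LinearMap.smul_apply, smul_eq_mul, smul_eq_mul] at h
    have h2 : (c - c') * B (g c) (g c') = 0 := by linarith
    exact (mul_eq_zero.1 h2).resolve_left (sub_ne_zero.2 hne)
  rw [Finsupp.sum, map_sum]
  simp only [map_sum, LinearMap.sum_apply]
  refine Finset.sum_nonneg fun c _ => ?_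
  refine Finset.sum_nonneg fun c' _ => ?_
  rw [hS c' _ (hg' c'), map_smul, LinearMap.smul_apply, smul_eq_mul]
  refine mul_nonneg (hf c') ?_
  rcases eq_or_ne c' c with rfl | hne
  · rcases eq_or_ne (g c') 0 with h0 | h0
    · simp [h0]
    · exact (hpos _ h0).le
  · exact (horth c' c hne).ge

theorem isCompact_setOf_form_le [TopologicalSpace V] [IsTopologicalAddGroup V]
    [ContinuousSMul ℝ V] [T2Space V] (B : V →ₗ[ℝ] V →ₗ[ℝ] ℝ)
    (hpos : ∀ x, x ≠ 0 → 0 < B x x) (C : ℝ) : IsCompact {x | B x x ≤ C} := by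
  let e : V ≃L[ℝ] (Fin (Module.finrank ℝ V) → ℝ) := ContinuousLinearEquiv.ofFinrankEq (by simp)
  have hcont : Continuous fun x : V => B x x := by
    let b := Module.finBasis ℝ V
    have h : ∀ x, B x x = ∑ i, b.repr x i * B (b i) x := fun x => by
      have h1 : B.flip x x = B.flip x (∑ i, b.repr x i • b i) := by rw [b.sum_repr x]
      rw [map_sum] at h1
      refine h1.trans (Finset.sum_congr rfl fun i _ => ?_)
      rw [map_smul, smul_eq_mul, LinearMap.flip_apply]
    simp only [h]
    refine continuous_finsetSum _ fun i _ => ?_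
    exact (LinearMap.continuous_of_finiteDimensional (b.coord i)).mul
      (LinearMap.continuous_of_finiteDimensional (B (b i)))
  have hclosed : IsClosed {x | B x x ≤ C} := isClosed_le hcont continuous_const
  let q : (Fin (Module.finrank ℝ V) → ℝ) → ℝ := fun y => B (e.symm y) (e.symm y)
  have hq : Continuous q := hcont.comp e.symm.continuous
  obtain ⟨m, hm0, hm⟩ : ∃ m : ℝ, 0 < m ∧ ∀ y ∈ Metric.sphere (0 : Fin (Module.finrank ℝ V) → ℝ) 1,
      m ≤ q y := by
    rcases (Metric.sphere (0 : Fin (Module.finrank ℝ V) → ℝ) 1).eq_empty_or_nonempty with h | h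
    · exact ⟨1, one_pos, by simp [h]⟩
    · obtain ⟨y, hy, hmin⟩ := (isCompact_sphere _ _).exists_isMinOn h hq.continuousOn
      refine ⟨q y, hpos _ fun h0 => ?_, fun z hz => hmin hz⟩
      have : y = 0 := by simpa using h0
      rw [this] at hy
      simp at hy
  have hbound : ∀ y, m * ‖y‖ ^ 2 ≤ q y := by
    intro y
    rcases eq_or_ne y 0 with rfl | hy
    · simp [q]
    have hn : 0 < ‖y‖ := norm_pos_iff.2 hy
    have h1 := hm (‖y‖⁻¹ • y) (by simp [norm_smul, hn.ne'])
    have h2 : q (‖y‖⁻¹ • y) = (‖y‖ ^ 2)⁻¹ * q y := by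
      simp only [q, map_smul, LinearMap.smul_apply, smul_eq_mul]
      rw [← mul_assoc, ← mul_inv, sq]
    rw [h2, ← div_eq_inv_mul, le_div_iff₀ (by positivity)] at h1
    exact h1
  have himg : e '' {x | B x x ≤ C} ⊆ Metric.closedBall 0 (Real.sqrt (C / m)) := by
    rintro _ ⟨x, hx, rfl⟩
    rw [mem_closedBall_zero_iff]
    refine Real.le_sqrt_of_sq_le ?_
    rw [le_div_iff₀ hm0, mul_comm]
    refine (hbound (e x)).trans ?_
    simpa [q] using hx
  have hc : IsCompact (e '' {x | B x x ≤ C}) :=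
    (isCompact_closedBall _ _).of_isClosed_subset (e.toHomeomorph.isClosedMap _ hclosed) himg
  exact (e.toHomeomorph.isCompact_image).1 hc

end LinearAlgebra

/-! ### The polar decomposition -/

namespace ConnectedRealAlgebraicGroup

namespace CartanData

variable {n : ℕ} {G : ConnectedRealAlgebraicGroup n} (D : G.CartanData)

/-- Eigenvectors of `Ad (exp u)` are eigenvectors of `ad u`, for `u ∈ 𝔭`. -/
theorem lie_eq_smul_of_Ad_exp {u : G.lieAlgebra} (hu : D.θ u = -u) {X : G.lieAlgebra} {c : ℝ}
    (h : G.Ad (G.exp u) X = Real.exp c • X) : ⁅u, X⁆ = c • X := by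
  let Q : Submodule ℝ G.lieAlgebra := (G.AdEnd (G.exp u)).eigenspace (Real.exp c)
  have hmem : ∀ {Y}, Y ∈ Q ↔ G.Ad (G.exp u) Y = Real.exp c • Y := Module.End.mem_eigenspace_iff
  have hQ : ∀ Y ∈ Q, ⁅u, Y⁆ ∈ Q := fun Y hY => by
    rw [hmem] at hY ⊢
    rw [G.Ad_lie, hY, G.Ad_exp_eq_self (lie_self u), lie_smul]
  have hle : Q ≤ spec u {c} := by
    have htop : ⨆ c, (LieAlgebra.ad ℝ G.lieAlgebra u).genEigenspace c 1 = ⊤ :=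
      iSup_eigenspace_eq_top_of_symm D.form D.form_symm D.form_pos
        (LieAlgebra.ad ℝ G.lieAlgebra u) (fun X Y => D.form_lie_of_neg hu X Y)
    rw [Submodule.eq_iSup_inf_genEigenspace (f := LieAlgebra.ad ℝ G.lieAlgebra u) 1 hQ htop]
    refine iSup_le fun c' Y hY => ?_
    have hY2 : ⁅u, Y⁆ = c' • Y := Module.End.mem_eigenspace_iff.1 hY.2
    have hY1 := hmem.1 hY.1
    rw [G.Ad_exp_eigen hY2] at hY1
    rcases eq_or_ne Y 0 with rfl | hY0
    · exact Submodule.zero_mem _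
    · have h1 : Real.exp c' = Real.exp c := smul_left_injective ℝ hY0 hY1
      exact mem_spec (c := c) rfl (by rw [hY2, Real.exp_injective h1])
  have h1 : spec u {c} ≤ (LieAlgebra.ad ℝ G.lieAlgebra u).eigenspace c :=
    spec_le fun c' hc' Y hY => Module.End.mem_eigenspace_iff.2 (by
      rw [Set.mem_singleton_iff.1 hc'] at hY; exact hY)
  exact Module.End.mem_eigenspace_iff.1 (h1 (hle (hmem.2 h)))

/-- Two linear maps on `𝔤` that agree on the eigenvectors of `ad u` are equal. -/
theorem eq_of_eigen {u : G.lieAlgebra} (hu : D.θ u = -u) {S T : Module.End ℝ G.lieAlgebra}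
    (h : ∀ (c : ℝ) (X : G.lieAlgebra), ⁅u, X⁆ = c • X → S X = T X) : S = T := by
  have hle : spec u Set.univ ≤ LinearMap.ker (S - T) := spec_le fun c _ X hX => by
    rw [LinearMap.mem_ker, LinearMap.sub_apply, h c X hX, sub_self]
  rw [D.spec_univ hu, top_le_iff, LinearMap.ker_eq_top, sub_eq_zero] at hle
  exact hle

/-- For elements of `𝔭` the eigenspaces of `Ad (exp u)` determine `ad u`, as the real exponential is
injective; the centre is trivial. -/
theorem eq_of_Ad_exp_eq {u v : G.lieAlgebra} (hu : D.θ u = -u) (hv : D.θ v = -v)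
    (h : ∀ X, G.Ad (G.exp u) X = G.Ad (G.exp v) X) : u = v := by
  have h1 : LieAlgebra.ad ℝ G.lieAlgebra u = LieAlgebra.ad ℝ G.lieAlgebra v := by
    refine D.eq_of_eigen hu fun c X hX => ?_
    change ⁅u, X⁆ = ⁅v, X⁆
    rw [hX, D.lie_eq_smul_of_Ad_exp hv (by rw [← h, G.Ad_exp_eigen hX])]
  rw [← sub_eq_zero]
  refine D.eq_zero_of_lie fun Y => ?_
  rw [sub_lie, sub_eq_zero]
  exact LinearMap.congr_fun h1 Y

theorem θ_Ad_exp {u : G.lieAlgebra} (hu : D.θ u = -u) (X : G.lieAlgebra) :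
    D.θ (G.Ad (G.exp u) X) = G.Ad (G.exp (-u)) (D.θ X) := by
  have h := D.eq_of_eigen hu
    (S := (D.θ : G.lieAlgebra →ₗ[ℝ] G.lieAlgebra) ∘ₗ G.AdEnd (G.exp u))
    (T := G.AdEnd (G.exp (-u)) ∘ₗ (D.θ : G.lieAlgebra →ₗ[ℝ] G.lieAlgebra)) fun c X hX => by
      change D.θ (G.Ad (G.exp u) X) = G.Ad (G.exp (-u)) (D.θ X)
      have h2 : ⁅-u, D.θ X⁆ = c • D.θ X := by
        rw [← hu, ← LieEquiv.map_lie, hX, map_smul]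
      rw [G.Ad_exp_eigen hX, G.Ad_exp_eigen h2, map_smul]
  exact LinearMap.congr_fun h X

/-- `Ad(g)* Ad(g)`, where the adjoint is taken for the inner product `form`. -/
def square (g : G.Pts) (X : G.lieAlgebra) : G.lieAlgebra := D.θ (G.Ad g⁻¹ (D.θ (G.Ad g X)))

theorem form_Ad_Ad (g : G.Pts) (X Y : G.lieAlgebra) :
    D.form (G.Ad g X) (G.Ad g Y) = D.form (D.square g X) Y := by
  rw [D.form_symm (D.square g X), form_apply, form_apply, square, D.θ_θ, killingForm_symm,
    ← G.killingForm_Ad g Y, G.Ad_Ad_inv, ← D.killingForm_θ (G.Ad g Y), D.θ_θ]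

theorem θ_square (g : G.Pts) (X : G.lieAlgebra) : D.square g (D.θ (D.square g X)) = D.θ X := by
  simp [square, D.θ_θ]

/-- `Ad(g)* Ad(g)` is a positive symmetric Lie automorphism. Its eigenvalues multiply under
brackets, so its logarithm is a derivation, hence `ad X` for some `X`. Conjugation by `θ` inverts
the automorphism, which puts `X` in `𝔭`. -/
theorem exists_square_eq (g : G.Pts) :
    ∃ X, D.θ X = -X ∧ ∀ Y, D.square g Y = G.Ad (G.exp X) Y := by
  have := D.isKilling
  let p : Module.End ℝ G.lieAlgebra :=
    (D.θ : G.lieAlgebra →ₗ[ℝ] G.lieAlgebra) ∘ₗ G.AdEnd g⁻¹ ∘ₗ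
      (D.θ : G.lieAlgebra →ₗ[ℝ] G.lieAlgebra) ∘ₗ G.AdEnd g
  have hp : ∀ X, p X = D.square g X := fun _ => rfl
  have htop : ⨆ μ, p.eigenspace μ = ⊤ :=
    iSup_eigenspace_eq_top_of_symm D.form D.form_symm D.form_pos p fun X Y => by
      rw [hp, hp, ← D.form_Ad_Ad, D.form_symm X, ← D.form_Ad_Ad, D.form_symm]
  have hext : ∀ S T : Module.End ℝ G.lieAlgebra,
      (∀ (μ : ℝ) (X : G.lieAlgebra), p X = μ • X → S X = T X) → S = T := by
    intro S T h
    have hle : ⨆ μ, p.eigenspace μ ≤ LinearMap.ker (S - T) := iSup_le fun μ X hX => by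
      rw [LinearMap.mem_ker, LinearMap.sub_apply, h μ X (Module.End.mem_eigenspace_iff.1 hX),
        sub_self]
    rw [htop, top_le_iff, LinearMap.ker_eq_top, sub_eq_zero] at hle
    exact hle
  have hμ : ∀ (μ : ℝ) (X : G.lieAlgebra), p X = μ • X → X ≠ 0 → 0 < μ := by
    intro μ X hX h0
    have h1 := D.form_Ad_Ad g X X
    rw [← hp, hX, map_smul, LinearMap.smul_apply, smul_eq_mul] at h1
    have h2 : 0 < D.form (G.Ad g X) (G.Ad g X) := D.form_pos _ fun h => h0 (by
      rw [← G.Ad_inv_Ad g X, h, map_zero])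
    rw [h1] at h2
    exact pos_of_mul_pos_left h2 (D.form_nonneg X)
  obtain ⟨δ, hδ⟩ := exists_apply_eq_smul_of_eigen p Real.log
  have hplie : ∀ X Y, p ⁅X, Y⁆ = ⁅p X, p Y⁆ := by
    intro X Y
    simp only [hp, square, G.Ad_lie, LieEquiv.map_lie]
  have hder : ∀ X Y, δ ⁅X, Y⁆ = ⁅X, δ Y⁆ - ⁅Y, δ X⁆ := by
    let ad := (LieAlgebra.ad ℝ G.lieAlgebra : G.lieAlgebra →ₗ[ℝ] Module.End ℝ G.lieAlgebra)
    have hX : ∀ (Y : G.lieAlgebra) (ν : ℝ), p Y = ν • Y →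
        δ ∘ₗ ad.flip Y = ad.flip (δ Y) - ad Y ∘ₗ δ := by
      intro Y ν hY
      refine hext _ _ fun μ X hX => ?_
      change δ ⁅X, Y⁆ = ⁅X, δ Y⁆ - ⁅Y, δ X⁆
      rcases eq_or_ne X 0 with rfl | hX0
      · simp
      rcases eq_or_ne Y 0 with rfl | hY0
      · simp
      have h1 : p ⁅X, Y⁆ = (μ * ν) • ⁅X, Y⁆ := by
        rw [hplie, hX, hY, smul_lie, lie_smul, smul_smul]
      rw [hδ _ _ h1, hδ _ _ hX, hδ _ _ hY, Real.log_mul (hμ μ X hX hX0).ne' (hμ ν Y hY hY0).ne',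
        lie_smul, lie_smul, ← lie_skew Y X, add_smul, smul_neg, sub_neg_eq_add, add_comm]
    intro X Y
    have hY : δ ∘ₗ ad X = ad X ∘ₗ δ - ad.flip (δ X) := by
      refine hext _ _ fun ν Y hY => ?_
      exact LinearMap.congr_fun (hX Y ν hY) X
    exact LinearMap.congr_fun hY Y
  obtain ⟨X, hX⟩ := LieDerivation.IsKilling.exists_eq_ad
    ({ δ with leibniz' := hder } : LieDerivation ℝ G.lieAlgebra G.lieAlgebra)
  have hXδ : ∀ Y, ⁅X, Y⁆ = δ Y := fun Y => by
    have h := LieDerivation.congr_fun hX Y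
    rwa [LieDerivation.ad_apply_apply] at h
  refine ⟨X, ?_, ?_⟩
  · rw [← add_eq_zero_iff_eq_neg]
    refine D.eq_zero_of_lie fun Y => ?_
    have h := hext ((D.θ : G.lieAlgebra →ₗ[ℝ] G.lieAlgebra) ∘ₗ δ)
      (-(δ ∘ₗ (D.θ : G.lieAlgebra →ₗ[ℝ] G.lieAlgebra))) fun μ Z hZ => by
        change D.θ (δ Z) = -δ (D.θ Z)
        rcases eq_or_ne Z 0 with rfl | hZ0
        · simp
        have h1 := D.θ_square g Z
        rw [← hp Z, hZ, map_smul, ← hp, map_smul] at h1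
        have h2 : p (D.θ Z) = μ⁻¹ • D.θ Z := by
          rw [eq_inv_smul_iff₀ (hμ μ Z hZ hZ0).ne', h1]
        rw [hδ _ _ hZ, hδ _ _ h2, Real.log_inv, map_smul, neg_smul, neg_neg]
    have h3 := LinearMap.congr_fun h (D.θ Y)
    change D.θ (δ (D.θ Y)) = -δ (D.θ (D.θ Y)) at h3
    rw [D.θ_θ, ← hXδ, ← hXδ, LieEquiv.map_lie, D.θ_θ] at h3
    rw [add_lie, h3, neg_add_cancel]
  · intro Y
    have h := hext p (G.AdEnd (G.exp X)) fun μ Z hZ => by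
      rcases eq_or_ne Z 0 with rfl | hZ0
      · simp
      have h1 : ⁅X, Z⁆ = Real.log μ • Z := by rw [hXδ, hδ _ _ hZ]
      rw [AdEnd_apply, G.Ad_exp_eigen h1, Real.exp_log (hμ μ Z hZ hZ0), hZ]
    exact LinearMap.congr_fun h Y

/-- The element `X ∈ 𝔭` with `Ad(g)* Ad(g) = Ad (exp X)`. -/
def logSquare (g : G.Pts) : G.lieAlgebra := (D.exists_square_eq g).choose

theorem θ_logSquare (g : G.Pts) : D.θ (D.logSquare g) = -D.logSquare g :=
  (D.exists_square_eq g).choose_spec.1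

theorem square_eq (g : G.Pts) (Y : G.lieAlgebra) :
    D.square g Y = G.Ad (G.exp (D.logSquare g)) Y :=
  (D.exists_square_eq g).choose_spec.2 Y

/-- On eigenvectors this is `c² ≤ 2 (exp c + exp (-c))`; the `θ Y` term stands for `Ad (exp (-X))`.
The estimate makes the exponential proper on `𝔭`. -/
theorem form_lie_le {X : G.lieAlgebra} (hX : D.θ X = -X) (Y : G.lieAlgebra) :
    D.form ⁅X, Y⁆ ⁅X, Y⁆ ≤
      2 * (D.form (G.Ad (G.exp X) Y) Y + D.form (G.Ad (G.exp X) (D.θ Y)) (D.θ Y)) := by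
  let ad := LieAlgebra.ad ℝ G.lieAlgebra X
  have h := nonneg_of_eigen D.form D.form_symm D.form_pos ad
    (fun Y Z => D.form_lie_of_neg hX Y Z)
    ((2 : ℝ) • (G.AdEnd (G.exp X) + G.AdEnd (G.exp (-X))) - ad ∘ₗ ad)
    (fun c => 2 * (Real.exp c + Real.exp (-c)) - c * c) (fun c => by
      have h1 := Real.quadratic_le_exp_of_nonneg (abs_nonneg c)
      have h2 : Real.exp |c| + Real.exp (-|c|) = Real.exp c + Real.exp (-c) := by
        rcases abs_cases c with ⟨h, -⟩ | ⟨h, -⟩ <;> rw [h]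
        rw [neg_neg, add_comm]
      have h3 := Real.exp_pos (-|c|)
      have h4 : |c| ^ 2 = c * c := by rw [sq_abs, sq]
      have h5 := abs_nonneg c
      nlinarith)
    (fun c Z hZ => by
      have hZ' : ⁅X, Z⁆ = c • Z := hZ
      have hZ'' : ⁅-X, Z⁆ = (-c) • Z := by rw [neg_lie, hZ', neg_smul]
      change (2 : ℝ) • (G.Ad (G.exp X) Z + G.Ad (G.exp (-X)) Z) - ⁅X, ⁅X, Z⁆⁆ = _
      rw [G.Ad_exp_eigen hZ', G.Ad_exp_eigen hZ'', hZ', lie_smul, hZ', smul_smul, sub_smul,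
        ← add_smul, smul_smul]) Y
  change 0 ≤ D.form ((2 : ℝ) • (G.Ad (G.exp X) Y + G.Ad (G.exp (-X)) Y) - ⁅X, ⁅X, Y⁆⁆) Y at h
  rw [map_sub, map_smul, map_add, LinearMap.sub_apply, LinearMap.smul_apply, smul_eq_mul,
    LinearMap.add_apply, D.form_lie_of_neg hX] at h
  have h2 : D.form (G.Ad (G.exp X) (D.θ Y)) (D.θ Y) = D.form (G.Ad (G.exp (-X)) Y) Y := by
    have h3 := D.θ_Ad_exp hX (D.θ Y)
    rw [D.θ_θ] at h3
    rw [← h3, form_apply, form_apply, ← D.killingForm_θ (G.Ad (G.exp X) (D.θ Y)), D.θ_θ]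
  rw [h2]
  linarith

end CartanData

end ConnectedRealAlgebraicGroup

/-! ### The maximal compact subgroup -/

namespace ConnectedRealAlgebraicGroup

namespace CartanData

variable {n : ℕ} {G : ConnectedRealAlgebraicGroup n} (D : G.CartanData)

theorem continuous_θ : Continuous D.θ :=
  LinearMap.continuous_of_finiteDimensional (D.θ : G.lieAlgebra →ₗ[ℝ] G.lieAlgebra)

theorem continuous_form {T : Type*} [TopologicalSpace T] {f g : T → G.lieAlgebra}
    (hf : Continuous f) (hg : Continuous g) : Continuous fun t => D.form (f t) (g t) := by
  let b := Module.finBasis ℝ G.lieAlgebra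
  have h : ∀ x y, D.form x y = ∑ i, b.repr x i * D.form (b i) y := fun x y => by
    have h1 : D.form.flip y x = D.form.flip y (∑ i, b.repr x i • b i) := by rw [b.sum_repr x]
    rw [map_sum] at h1
    refine h1.trans (Finset.sum_congr rfl fun i _ => ?_)
    rw [map_smul, smul_eq_mul, LinearMap.flip_apply]
  have h' : (fun t => D.form (f t) (g t)) = fun t => ∑ i, b.repr (f t) i * D.form (b i) (g t) :=
    funext fun t => h _ _
  rw [h']
  refine continuous_finsetSum _ fun i _ => ?_
  exact ((LinearMap.continuous_of_finiteDimensional (b.coord i)).comp hf).mul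
    ((LinearMap.continuous_of_finiteDimensional (D.form (b i))).comp hg)

theorem continuous_square (Y : G.lieAlgebra) : Continuous fun g => D.square g Y :=
  D.continuous_θ.comp (G.continuous_Ad_of continuous_inv
    (D.continuous_θ.comp (G.continuous_Ad_apply Y)))

/-- A subset of `𝔭` on which the matrix coefficients of `Ad (exp X)` are bounded is bounded. -/
theorem exists_isCompact_of_bound (D : G.CartanData) :
    ∃ F : Set G.lieAlgebra, F.Finite ∧ ∀ C : G.lieAlgebra → ℝ,
      ∃ S : Set G.lieAlgebra, IsCompact S ∧ ∀ X, D.θ X = -X →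
        (∀ Y ∈ F, D.form (G.Ad (G.exp X) Y) Y ≤ C Y) → X ∈ S := by
  let b := Module.finBasis ℝ G.lieAlgebra
  let L : G.lieAlgebra →ₗ[ℝ] (Fin (Module.finrank ℝ G.lieAlgebra) → G.lieAlgebra) :=
    LinearMap.pi fun i =>
      (LieAlgebra.ad ℝ G.lieAlgebra : G.lieAlgebra →ₗ[ℝ] Module.End ℝ G.lieAlgebra).flip (b i)
  have hL : LinearMap.ker L = ⊥ := by
    rw [LinearMap.ker_eq_bot']
    intro X hX
    refine D.eq_zero_of_lie fun Y => ?_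
    have h : LieAlgebra.ad ℝ G.lieAlgebra X = 0 := b.ext fun i => congrFun hX i
    exact LinearMap.congr_fun h Y
  refine ⟨Set.range b ∪ Set.range fun i => D.θ (b i),
    (Set.finite_range _).union (Set.finite_range _), fun C => ?_⟩
  let S := L ⁻¹' Set.univ.pi fun i => {Z | D.form Z Z ≤ 2 * (C (b i) + C (D.θ (b i)))}
  refine ⟨S, (LinearMap.isClosedEmbedding_of_injective hL).isCompact_preimage
    (isCompact_univ_pi fun i => isCompact_setOf_form_le D.form D.form_pos _), fun X hX h => ?_⟩
  intro i _
  refine (D.form_lie_le hX (b i)).trans ?_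
  have h1 := h (b i) (Or.inl ⟨i, rfl⟩)
  have h2 := h (D.θ (b i)) (Or.inr ⟨i, rfl⟩)
  linarith

/-- Near `g` the values stay in a compact set, and any cluster point is an `X ∈ 𝔭` with `Ad (exp X)
= Ad(g)* Ad(g)`, which is unique. -/
theorem continuous_logSquare : Continuous D.logSquare := by
  rw [continuous_iff_continuousAt]
  intro g
  obtain ⟨F, hF, hbd⟩ := D.exists_isCompact_of_bound
  obtain ⟨S, hS, hmem⟩ := hbd fun Y => D.form (D.square g Y) Y + 1
  have hev : ∀ᶠ g' in 𝓝 g, ∀ Y ∈ F, D.form (D.square g' Y) Y < D.form (D.square g Y) Y + 1 := by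
    rw [hF.eventually_all]
    intro Y _
    exact ((D.continuous_form (D.continuous_square Y) continuous_const).tendsto g).eventually_lt_const
      (lt_add_one _)
  refine hS.tendsto_nhds_of_unique_mapClusterPt (hev.mono fun g' hg' =>
    hmem _ (D.θ_logSquare g') fun Y hY => ?_) fun X _ hX => ?_
  · rw [← D.square_eq]; exact (hg' Y hY).le
  · obtain ⟨U, hU, hlim⟩ := mapClusterPt_iff_ultrafilter.1 hX
    refine D.eq_of_Ad_exp_eq ?_ (D.θ_logSquare g) fun Y => ?_
    · refine tendsto_nhds_unique ((D.continuous_θ.tendsto X).comp hlim) ?_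
      refine hlim.neg.congr fun g' => ?_
      exact (D.θ_logSquare g').symm
    · have hc : Continuous fun Z : G.lieAlgebra => G.Ad (G.exp Z) Y :=
        G.continuous_Ad_of G.continuous_exp continuous_const
      refine tendsto_nhds_unique ((hc.tendsto X).comp hlim) ?_
      rw [← D.square_eq]
      refine (((D.continuous_square Y).tendsto g).mono_left hU).congr fun g' => ?_
      exact D.square_eq g' Y

/-- The elements of `G` whose adjoint action commutes with `θ`. -/
def fixedSubgroup : Subgroup G.Pts where
  carrier := {g | ∀ X, G.Ad g (D.θ X) = D.θ (G.Ad g X)}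
  one_mem' X := by simp
  mul_mem' {g h} hg hh X := by rw [G.Ad_mul, G.Ad_mul, hh, hg]
  inv_mem' {g} hg X := by
    have h := hg (G.Ad g⁻¹ X)
    rw [G.Ad_Ad_inv] at h
    rw [← h, G.Ad_inv_Ad]

theorem mem_fixedSubgroup {g : G.Pts} :
    g ∈ D.fixedSubgroup ↔ ∀ X, G.Ad g (D.θ X) = D.θ (G.Ad g X) := Iff.rfl

theorem isClosed_fixedSubgroup : IsClosed (D.fixedSubgroup : Set G.Pts) := by
  have : (D.fixedSubgroup : Set G.Pts) = ⋂ X, {g | G.Ad g (D.θ X) = D.θ (G.Ad g X)} := by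
    ext g; simp [mem_fixedSubgroup]
  rw [this]
  exact isClosed_iInter fun X => isClosed_eq (G.continuous_Ad_apply _)
    (D.continuous_θ.comp (G.continuous_Ad_apply X))

/-- The compact part of the polar decomposition of `g`. -/
def polarPart (g : G.Pts) : G.Pts := g * G.exp (-((2⁻¹ : ℝ) • D.logSquare g))

theorem continuous_polarPart : Continuous D.polarPart :=
  continuous_id.mul (G.continuous_exp.comp (f := fun g => -((2⁻¹ : ℝ) • D.logSquare g)) ((D.continuous_logSquare.const_smul (2⁻¹ : ℝ)).neg))

/-- Half of `logSquare g` exponentiates to the square root of `Ad(g)* Ad(g)`, so this is the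
orthogonal factor of `Ad g`; for automorphisms, orthogonality is the same as commuting with `θ`. -/
theorem polarPart_mem (g : G.Pts) : D.polarPart g ∈ D.fixedSubgroup := by
  set Z := (2⁻¹ : ℝ) • D.logSquare g with hZ
  have hθZ : D.θ Z = -Z := by rw [hZ, map_smul, D.θ_logSquare, smul_neg]
  have hZZ : Z + Z = D.logSquare g := by rw [hZ, ← two_smul ℝ, smul_smul]; norm_num
  have hexp : G.exp Z * G.exp Z = G.exp (D.logSquare g) := by
    rw [← G.exp_add (lie_self Z), hZZ]
  intro X
  have hsq := D.square_eq g
  have key : ∀ Y, D.θ (G.Ad g Y) = G.Ad g (D.θ (G.Ad (G.exp (D.logSquare g)) Y)) := fun Y => by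
    rw [← hsq, square, D.θ_θ, G.Ad_Ad_inv]
  rw [polarPart, ← hZ, G.Ad_mul, G.Ad_mul, key, ← hexp, G.Ad_mul, G.exp_neg, G.Ad_Ad_inv,
    D.θ_Ad_exp hθZ, G.exp_neg]

theorem polarPart_of_mem {g : G.Pts} (hg : g ∈ D.fixedSubgroup) : D.polarPart g = g := by
  have h : D.logSquare g = 0 := D.eq_of_Ad_exp_eq (D.θ_logSquare g) (by simp) fun X => by
    rw [← D.square_eq, square, ← hg, G.Ad_inv_Ad, D.θ_θ, G.exp_zero, G.Ad_one]
  rw [polarPart, h, smul_zero, neg_zero, G.exp_zero, mul_one]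

/-- `Ad k` preserves the Lie algebra of `K`, which is the fixed space of `θ`, hence also its Killing
complement `𝔭`. -/
theorem K_le_fixedSubgroup : D.K ≤ D.fixedSubgroup := by
  have hk : ∀ k ∈ D.K, ∀ X, D.θ X = X → D.θ (G.Ad k X) = G.Ad k X := by
    intro k hk X hX
    refine (D.K_lie _).1 fun t => ?_
    rw [← G.Ad_smul, G.exp_Ad]
    exact D.K.mul_mem (D.K.mul_mem hk ((D.K_lie X).2 hX t)) (D.K.inv_mem hk)
  have hp : ∀ k ∈ D.K, ∀ X, D.θ X = -X → D.θ (G.Ad k X) = -G.Ad k X := by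
    intro k hkK X hX
    set Y := G.Ad k X
    have h0 : ∀ Z, D.θ Z = Z → killingForm ℝ G.lieAlgebra Y Z = 0 := by
      intro Z hZ
      have h1 : killingForm ℝ G.lieAlgebra Y Z =
          killingForm ℝ G.lieAlgebra X (G.Ad k⁻¹ Z) := by
        rw [← G.killingForm_Ad k X, G.Ad_Ad_inv]
      have h2 := hk k⁻¹ (D.K.inv_mem hkK) Z hZ
      have h3 := D.killingForm_θ X (G.Ad k⁻¹ Z)
      rw [hX, h2, map_neg, LinearMap.neg_apply] at h3
      rw [h1]; linarith
    have hW : D.θ (Y + D.θ Y) = Y + D.θ Y := by rw [map_add, D.θ_θ, add_comm]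
    have h4 : D.form (Y + D.θ Y) (Y + D.θ Y) = 0 := by
      have h5 := h0 _ hW
      have h6 := D.killingForm_θ Y (Y + D.θ Y)
      rw [hW] at h6
      rw [form_apply, hW, map_add (killingForm ℝ G.lieAlgebra), LinearMap.add_apply, h6, h5]
      simp
    exact (neg_eq_of_add_eq_zero_right (D.eq_zero_of_form h4)).symm
  intro k hkK X
  have h1 := hk k hkK (X + D.θ X) (by rw [map_add, D.θ_θ, add_comm])
  have h2 := hp k hkK (X - D.θ X) (by rw [map_sub, D.θ_θ, neg_sub])
  rw [map_add, map_add] at h1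
  rw [map_sub, map_sub] at h2
  have h3 : (2 : ℝ) • G.Ad k (D.θ X) = (2 : ℝ) • D.θ (G.Ad k X) := by
    have h4 : G.Ad k (D.θ X) = D.θ (G.Ad k X) + D.θ (G.Ad k (D.θ X)) - G.Ad k X := by
      rw [h1]; abel
    have h5 : G.Ad k (D.θ X) = D.θ (G.Ad k X) - D.θ (G.Ad k (D.θ X)) + G.Ad k X := by
      rw [h2]; abel
    rw [two_smul, two_smul]
    refine (congrArg₂ (· + ·) h4 h5).trans ?_
    abel
  exact smul_right_injective _ (two_ne_zero' ℝ) h3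

/-- Differentiating a one-parameter group that commutes with `θ` shows that its generator is fixed
by `θ`. So near 1 the closed group of such elements consists of exponentials lying in `K`. -/
theorem eventually_mem_K : ∀ᶠ g in 𝓝 (1 : G.Pts), g ∈ D.fixedSubgroup → g ∈ D.K := by
  set H := D.fixedSubgroup.map G.toSubgroup.subtype with hH
  have hclosed : IsClosed (H : Set (GL (Fin n) ℝ)) := by
    rw [hH, Subgroup.coe_map]
    exact G.isClosed.isClosedEmbedding_subtypeVal.isClosedMap _ D.isClosed_fixedSubgroup
  filter_upwards [(continuous_subtype_val.tendsto (1 : G.Pts)).eventually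
    (eventually_exists_expGL hclosed)] with g hg hgH
  obtain ⟨Y, hY, h⟩ := hg ⟨g, hgH, rfl⟩
  have hmem : ∀ t : ℝ, ∃ k ∈ D.fixedSubgroup, (k : GL (Fin n) ℝ) = expGL (t • Y) := hY
  let Y' : G.lieAlgebra := ⟨Y, fun t => by
    obtain ⟨k, -, hk⟩ := hmem t
    rw [← hk]; exact k.2⟩
  have hexp : ∀ t : ℝ, G.exp (t • Y') ∈ D.fixedSubgroup := fun t => by
    obtain ⟨k, hk, hkt⟩ := hmem t
    have : k = G.exp (t • Y') := Subtype.ext hkt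
    exact this ▸ hk
  have hθ : D.θ Y' = Y' := by
    rw [← sub_eq_zero]
    refine D.eq_zero_of_lie fun X => ?_
    rw [sub_lie, sub_eq_zero]
    by_contra hne
    obtain ⟨ℓ, hℓ⟩ := Module.Projective.exists_dual_ne_zero ℝ (sub_ne_zero.2 hne)
    have h1 := G.hasDerivAt_Ad_exp ℓ Y' X
    have h2 := G.hasDerivAt_Ad_exp (ℓ ∘ₗ (D.θ : G.lieAlgebra →ₗ[ℝ] G.lieAlgebra)) Y' (D.θ X)
    have h3 : (fun t : ℝ => (ℓ ∘ₗ (D.θ : G.lieAlgebra →ₗ[ℝ] G.lieAlgebra))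
        (G.Ad (G.exp (t • Y')) (D.θ X))) = fun t : ℝ => ℓ (G.Ad (G.exp (t • Y')) X) := by
      funext t
      change ℓ (D.θ (G.Ad (G.exp (t • Y')) (D.θ X))) = _
      rw [hexp t X, D.θ_θ]
    rw [h3] at h2
    have h4 := h2.unique h1
    change ℓ (D.θ ⁅Y', D.θ X⁆) = _ at h4
    rw [LieEquiv.map_lie, D.θ_θ] at h4
    exact hℓ (by rw [map_sub, h4, sub_self])
  have h1 := (D.K_lie Y').2 hθ 1
  rw [one_smul] at h1
  have h2 : G.exp Y' = g := Subtype.ext h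
  exact h2 ▸ h1

/-- `polarPart` retracts the connected group `G` continuously onto the subgroup commuting with `θ`.
In it `K` is open and closed, so the preimage of `K` is all of `G`. -/
theorem fixedSubgroup_eq_K : D.fixedSubgroup = D.K := by
  refine le_antisymm (fun k hk => ?_) D.K_le_fixedSubgroup
  have hclosed : IsClosed (D.polarPart ⁻¹' (D.K : Set G.Pts)) :=
    D.K_maximal.prop.isClosed.preimage D.continuous_polarPart
  have hopen : IsOpen (D.polarPart ⁻¹' (D.K : Set G.Pts)) := by
    rw [isOpen_iff_mem_nhds]
    intro g hg
    have hc : Continuous fun g' => (D.polarPart g)⁻¹ * D.polarPart g' :=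
      continuous_const.mul D.continuous_polarPart
    have h1 := hc.tendsto g
    rw [inv_mul_cancel] at h1
    filter_upwards [h1.eventually D.eventually_mem_K] with g' hg'
    have h2 := hg' (D.fixedSubgroup.mul_mem (D.fixedSubgroup.inv_mem (D.polarPart_mem g))
      (D.polarPart_mem g'))
    exact (D.K.mul_mem_cancel_left (D.K.inv_mem hg)).1 h2
  have huniv := IsClopen.eq_univ ⟨hclosed, hopen⟩
    ⟨1, by rw [Set.mem_preimage, D.polarPart_of_mem (D.fixedSubgroup.one_mem)]; exact D.K.one_mem⟩
  have h : k ∈ D.polarPart ⁻¹' (D.K : Set G.Pts) := huniv ▸ Set.mem_univ k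
  rw [Set.mem_preimage, D.polarPart_of_mem hk] at h
  exact h

theorem mem_K_iff {g : G.Pts} : g ∈ D.K ↔ ∀ X, G.Ad g (D.θ X) = D.θ (G.Ad g X) := by
  rw [← D.fixedSubgroup_eq_K, mem_fixedSubgroup]

theorem form_Ad_of_mem_K {k : G.Pts} (hk : k ∈ D.K) (X Y : G.lieAlgebra) :
    D.form (G.Ad k X) (G.Ad k Y) = D.form X Y := by
  rw [form_apply, form_apply, ← D.mem_K_iff.1 hk, G.killingForm_Ad]

end CartanData

end ConnectedRealAlgebraicGroup

/-! ### The centralizer of `A`, the big cell and the Iwasawa projection -/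

namespace ConnectedRealAlgebraicGroup

namespace CartanData

variable {n : ℕ} {G : ConnectedRealAlgebraicGroup n} (D : G.CartanData)

theorem Ad_eq_self_of_commute {u : G.lieAlgebra} (hu : D.θ u = -u) {g : G.Pts}
    (h : Commute g (G.exp u)) : G.Ad g u = u := by
  have h1 : LieAlgebra.ad ℝ G.lieAlgebra u = LieAlgebra.ad ℝ G.lieAlgebra (G.Ad g⁻¹ u) := by
    refine D.eq_of_eigen hu fun c X hX => ?_
    change ⁅u, X⁆ = ⁅G.Ad g⁻¹ u, X⁆
    have h2 : ⁅u, G.Ad g X⁆ = c • G.Ad g X := D.lie_eq_smul_of_Ad_exp hu (by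
      rw [← G.Ad_mul, ← h.eq, G.Ad_mul, G.Ad_exp_eigen hX, G.Ad_smul])
    have h3 := congrArg (G.Ad g⁻¹) h2
    rw [G.Ad_lie, G.Ad_inv_Ad, G.Ad_smul, G.Ad_inv_Ad] at h3
    rw [h3, hX]
  have h2 : u = G.Ad g⁻¹ u := by
    rw [← sub_eq_zero]
    refine D.eq_zero_of_lie fun Y => ?_
    rw [sub_lie, sub_eq_zero]
    exact LinearMap.congr_fun h1 Y
  have h3 := congrArg (G.Ad g) h2
  rwa [G.Ad_Ad_inv] at h3

theorem commute_of_mem_M {m : G.Pts} (hm : m ∈ D.M) (v : D.𝔞) : Commute m (D.a v) :=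
  (Subgroup.mem_centralizer_iff.1 hm.2 (D.a v) ⟨v, rfl⟩).symm

section Interior

variable {u : D.𝔞} (hu : u ∈ interior D.chamber)

include hu

/-- `Ad l` fixes `𝔞` pointwise, so `logSquare l` commutes with `𝔞` and lies in it; the polar
decomposition of `l` is the factorization. -/
theorem exists_mem_M_mul_a {l : G.Pts} (hl : PreservesParts (u : G.lieAlgebra) l) :
    ∃ m ∈ D.M, ∃ v, l = m * D.a v := by
  have hfix : ∀ H ∈ D.𝔞, G.Ad l H = H := fun H hH => D.Ad_eq_self_of_preservesParts hu hl hH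
  set Z := (2⁻¹ : ℝ) • D.logSquare l with hZdef
  have hX : ∀ H ∈ D.𝔞, ⁅D.logSquare l, H⁆ = 0 := by
    intro H hH
    have hθ : D.θ H = -H := D.θ_coe ⟨H, hH⟩
    have h1 : G.Ad (G.exp (D.logSquare l)) H = Real.exp 0 • H := by
      have h2 : G.Ad l⁻¹ H = H := by
        nth_rewrite 1 [← hfix H hH]
        rw [G.Ad_inv_Ad]
      rw [← D.square_eq, square, hfix H hH, hθ, map_neg, h2, map_neg, hθ, neg_neg, Real.exp_zero,
        one_smul]
    have h3 := D.lie_eq_smul_of_Ad_exp (D.θ_logSquare l) h1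
    rwa [zero_smul] at h3
  have hZ : Z ∈ D.𝔞 := D.𝔞.smul_mem _ (D.mem_𝔞_of_commute (D.θ_logSquare l) fun H hH => by
    rw [← lie_skew, hX H hH, neg_zero])
  refine ⟨D.polarPart l, ⟨?_, ?_⟩, ⟨Z, hZ⟩, ?_⟩
  · rw [← D.fixedSubgroup_eq_K]; exact D.polarPart_mem l
  · refine Subgroup.mem_centralizer_iff.2 ?_
    rintro _ ⟨v, rfl⟩
    have h1 : G.Ad (D.polarPart l) v = v := by
      rw [polarPart, G.Ad_mul, G.Ad_exp_eq_self, hfix _ v.2]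
      rw [neg_lie, smul_lie, hX _ v.2, smul_zero, neg_zero]
    have h2 := G.exp_Ad (D.polarPart l) v
    rw [h1, eq_mul_inv_iff_mul_eq] at h2
    exact h2
  · rw [polarPart, a_eq_exp, ← hZdef, G.exp_neg, inv_mul_cancel_right]

theorem exists_mem_M_mul_a_of_commute {l : G.Pts} (hl : Commute l (D.a u)) :
    ∃ m ∈ D.M, ∃ v, l = m * D.a v :=
  D.exists_mem_M_mul_a hu (preservesParts_of_Ad_eq (D.Ad_eq_self_of_commute (D.θ_coe u) hl))

omit hu in
theorem spec_inf_le : spec (u : G.lieAlgebra) (Set.Ici 0) ⊓ spec (u : G.lieAlgebra) (Set.Iic 0) ≤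
    spec (u : G.lieAlgebra) {0} := by
  rintro X ⟨h1, h2⟩
  obtain ⟨A, hA, B, hB, C, hC, rfl⟩ := D.exists_parts (u := u) X
  have hθ := D.θ_coe u
  have h0 : ∀ s : Set ℝ, (0 : ℝ) ∈ s → spec (u : G.lieAlgebra) {0} ≤ spec (u : G.lieAlgebra) s :=
    fun s hs => spec_mono _ (Set.singleton_subset_iff.2 hs)
  have hA0 : A = 0 := by
    refine Submodule.disjoint_def.1 (D.disjoint_spec hθ (s := Set.Iio 0) (t := Set.Ici 0) ?_) A hA ?_
    · exact Set.disjoint_left.2 fun x hx hx' => (Set.mem_Iio.1 hx).not_ge hx'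
    · have h3 := Submodule.sub_mem _ (Submodule.sub_mem _ h1
        (spec_mono _ Set.Ioi_subset_Ici_self hC)) (h0 _ Set.self_mem_Ici hB)
      convert h3 using 1; abel
  have hC0 : C = 0 := by
    refine Submodule.disjoint_def.1 (D.disjoint_spec hθ (s := Set.Ioi 0) (t := Set.Iic 0) ?_) C hC ?_
    · exact Set.disjoint_left.2 fun x hx hx' => (Set.mem_Ioi.1 hx).not_ge hx'
    · have h3 := Submodule.sub_mem _ (Submodule.sub_mem _ h2
        (spec_mono _ Set.Iio_subset_Iic_self hA)) (h0 _ Set.self_mem_Iic hB)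
      convert h3 using 1; abel
  rw [hA0, hC0, zero_add, add_zero]
  exact hB

omit hu in
theorem Ad_mem_spec_pos {v : G.lieAlgebra} (hv : D.θ v = -v) {q : G.Pts}
    (hq : ∀ X ∈ spec v (Set.Ici 0), G.Ad q X ∈ spec v (Set.Ici 0)) {X : G.lieAlgebra}
    (hX : X ∈ spec v (Set.Ioi 0)) : G.Ad q X ∈ spec v (Set.Ioi 0) := by
  rw [D.mem_spec_pos_iff hv] at hX ⊢
  intro Y hY
  have h := hX _ (Ad_inv_mem hq hY)
  rwa [← G.killingForm_Ad q, G.Ad_Ad_inv] at h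

/-- The big cell: an element that moves the parabolic subalgebra of `u` to one transverse to the
opposite nilradical lies in `N⁻ M A N`. -/
theorem exists_bigCell {q : G.Pts} (hq : ∀ X ∈ spec (u : G.lieAlgebra) (Set.Ici 0),
    G.Ad q X ∈ spec (u : G.lieAlgebra) (Set.Iio 0) → X = 0) :
    ∃ W ∈ spec (u : G.lieAlgebra) (Set.Iio 0), ∃ m ∈ D.M, ∃ v,
      ∃ W' ∈ spec (u : G.lieAlgebra) (Set.Ioi 0), q = G.exp W * (m * D.a v) * G.exp W' := by
  have hθ := D.θ_coe u
  have hθ' : D.θ (-(u : G.lieAlgebra)) = - -(u : G.lieAlgebra) := by rw [map_neg, hθ]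
  have e1 : spec (-(u : G.lieAlgebra)) (Set.Ici 0) = spec (u : G.lieAlgebra) (Set.Iic 0) := by
    rw [spec_neg]; simp
  have e2 : spec (-(u : G.lieAlgebra)) (Set.Iio 0) = spec (u : G.lieAlgebra) (Set.Ioi 0) := by
    rw [spec_neg]; simp
  have e3 : spec (-(u : G.lieAlgebra)) (Set.Ioi 0) = spec (u : G.lieAlgebra) (Set.Iio 0) := by
    rw [spec_neg]; simp
  -- A factor of `N⁻` makes the nonnegative part stable. The same lemma for `-u` and the inverse
  -- gives a factor of `N` that makes the nonpositive part stable too; what remains preserves all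
  -- three parts.
  obtain ⟨W₀, hW₀, hst⟩ := D.exists_exp_mul_stabilizes hθ hq
  set q' := G.exp W₀ * q with hq'
  have hpos : ∀ X ∈ spec (u : G.lieAlgebra) (Set.Ioi 0), G.Ad q' X ∈ spec (u : G.lieAlgebra) (Set.Ioi 0) :=
    fun X hX => D.Ad_mem_spec_pos hθ hst hX
  obtain ⟨W₁, hW₁, hst'⟩ := D.exists_exp_mul_stabilizes hθ' (q := q'⁻¹) (by
    intro X hX h
    rw [e1] at hX
    rw [e2] at h
    have h2 := hpos _ h
    rw [G.Ad_Ad_inv] at h2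
    exact Submodule.disjoint_def.1 (D.disjoint_spec hθ (s := Set.Ioi 0) (t := Set.Iic 0)
      (Set.disjoint_left.2 fun x hx hx' => (Set.mem_Ioi.1 hx).not_ge hx')) X h2 hX)
  rw [e2] at hW₁
  set l := (G.exp W₁ * q'⁻¹)⁻¹ with hl
  have hlq : l = q' * G.exp (-W₁) := by rw [hl, mul_inv_rev, inv_inv, G.exp_neg]
  have hneg : ∀ X ∈ spec (-(u : G.lieAlgebra)) (Set.Ici 0),
      G.Ad l X ∈ spec (-(u : G.lieAlgebra)) (Set.Ici 0) := fun X hX => Ad_inv_mem hst' hX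
  have hnonneg : ∀ X ∈ spec (u : G.lieAlgebra) (Set.Ici 0),
      G.Ad l X ∈ spec (u : G.lieAlgebra) (Set.Ici 0) := by
    intro X hX
    rw [hlq, G.Ad_mul]
    refine hst _ (Ad_exp_mem_spec (Submodule.neg_mem _ hW₁) (fun a ha b hb => ?_) hX)
    exact (add_pos_of_pos_of_nonneg (Set.mem_Ioi.1 ha) (Set.mem_Ici.1 hb)).le
  have hparts : PreservesParts (u : G.lieAlgebra) l := by
    refine ⟨fun X hX => D.spec_inf_le ⟨hnonneg X (spec_mono _ (by simp) hX), ?_⟩,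
      fun X hX => D.Ad_mem_spec_pos hθ hnonneg hX, fun X hX => ?_⟩
    · have := hneg X (by rw [e1]; exact spec_mono _ (by simp) hX)
      rwa [e1] at this
    · have := D.Ad_mem_spec_pos hθ' hneg (X := X) (by rwa [e3])
      rwa [e3] at this
  obtain ⟨m, hm, v, hmv⟩ := D.exists_mem_M_mul_a hu hparts
  refine ⟨-W₀, Submodule.neg_mem _ hW₀, m, hm, v, W₁, hW₁, ?_⟩
  rw [← hmv, hlq, hq', G.exp_neg, G.exp_neg]
  group

end Interior

theorem form_Ad_exp {w : G.lieAlgebra} (hw : D.θ w = -w) (X Y : G.lieAlgebra) :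
    D.form (G.Ad (G.exp w) X) Y = D.form X (G.Ad (G.exp w) Y) := by
  rw [form_apply, form_apply, D.θ_Ad_exp hw, ← G.killingForm_Ad (G.exp w) X, G.exp_neg,
    G.Ad_Ad_inv]

/-- Conjugating `x` by powers of `a_u` leaves the coefficient at an eigenvector unchanged, since the
two scalars cancel, while the conjugates tend to 1. -/
theorem form_Ad_of_mem_N {u : D.𝔞} (hu : u ∈ interior D.chamber) {x : G.Pts} (hx : x ∈ D.N)
    {X : G.lieAlgebra} {c : ℝ} (hX : ⁅(u : G.lieAlgebra), X⁆ = c • X) :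
    D.form (G.Ad x X) X = D.form X X := by
  have h1 := hx u hu
  have hc : Continuous fun g : G.Pts => D.form (G.Ad g X) X :=
    D.continuous_form (G.continuous_Ad_apply X) continuous_const
  have h2 := (hc.tendsto 1).comp h1
  rw [G.Ad_one] at h2
  refine tendsto_nhds_unique (tendsto_const_nhds.congr fun k => ?_) h2
  have h3 : G.Ad (D.a u ^ k) X = Real.exp (k * c) • X := by
    rw [D.a_pow]
    exact G.Ad_exp_eigen (by rw [Submodule.coe_smul, smul_lie, hX, smul_smul])
  have h4 : G.Ad (D.a u ^ k)⁻¹ X = Real.exp (-(k * c)) • X := by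
    rw [D.a_pow, ← D.a_neg]
    exact G.Ad_exp_eigen (by
      rw [Submodule.coe_neg, Submodule.coe_smul, neg_lie, smul_lie, hX, smul_smul, neg_smul])
  have h5 : ∀ Y Z, D.form (G.Ad (D.a u ^ k)⁻¹ Y) Z = D.form Y (G.Ad (D.a u ^ k)⁻¹ Z) := by
    intro Y Z
    rw [D.a_pow, ← D.a_neg]
    exact D.form_Ad_exp (D.θ_coe _) Y Z
  rw [Function.comp_apply, G.Ad_mul, G.Ad_mul, h5, h4, h3, G.Ad_smul, map_smul, map_smul,
    LinearMap.smul_apply, smul_eq_mul, smul_eq_mul, ← mul_assoc, ← Real.exp_add, neg_add_cancel,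
    Real.exp_zero, one_mul]

/-- `θ` exchanges the weights `χ` and `-χ`, so all weights vanish at `v`, which is then central. -/
theorem eq_zero_of_eigenvalues_nonpos {v : D.𝔞}
    (h : ∀ (χ : D.𝔞 → ℝ) (X : G.lieAlgebra), X ≠ 0 →
      (∀ H : D.𝔞, ⁅(H : G.lieAlgebra), X⁆ = χ H • X) → χ v ≤ 0) : v = 0 := by
  have hχ : ∀ (χ : D.𝔞 → ℝ) (X : G.lieAlgebra), X ≠ 0 →
      (∀ H : D.𝔞, ⁅(H : G.lieAlgebra), X⁆ = χ H • X) → χ v = 0 := by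
    intro χ X h0 hX
    refine le_antisymm (h χ X h0 hX) ?_
    have h1 := h (fun H => -χ H) (D.θ X) (by simpa using h0) (fun H => by
      have h2 := congrArg D.θ (hX H)
      rw [LieEquiv.map_lie, D.θ_coe, map_smul, neg_lie] at h2
      rw [neg_smul, ← h2, neg_neg])
    linarith
  have h0 : (v : G.lieAlgebra) = 0 := by
    refine D.eq_zero_of_lie fun Y => ?_
    have hle : ⨆ χ, D.jointEigenspace χ ≤ LinearMap.ker (LieAlgebra.ad ℝ G.lieAlgebra (v : G.lieAlgebra)) := by
      refine iSup_le fun χ X hX => ?_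
      rcases eq_or_ne X 0 with rfl | hX0
      · exact Submodule.zero_mem _
      have hX' := D.mem_jointEigenspace.1 hX
      rw [LinearMap.mem_ker, LieAlgebra.ad_apply, hX' v, hχ χ X hX0 hX', zero_smul]
    rw [D.iSup_jointEigenspace] at hle
    exact hle (Submodule.mem_top (x := Y))
  exact Subtype.ext h0

/-- `Ad (a_v x)` is an isometry whose coefficient at a weight vector `X` is `exp (χ v) ‖X‖²`;
Cauchy–Schwarz forces `χ v ≤ 0`. -/
theorem eq_zero_of_a_mul_mem_K {u : D.𝔞} (hu : u ∈ interior D.chamber) {v : D.𝔞} {x : G.Pts}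
    (hx : x ∈ D.N) (h : D.a v * x ∈ D.K) : v = 0 := by
  refine D.eq_zero_of_eigenvalues_nonpos fun χ X hX0 hX => ?_
  have h1 := D.form_Ad_of_mem_K h X X
  have h2 : D.form (G.Ad (D.a v * x) X) X = Real.exp (χ v) * D.form X X := by
    rw [G.Ad_mul, a_eq_exp, D.form_Ad_exp (D.θ_coe v), G.Ad_exp_eigen (hX v), map_smul, smul_eq_mul,
      D.form_Ad_of_mem_N hu hx (hX u)]
  have h3 := D.form_nonneg (G.Ad (D.a v * x) X - X)
  rw [map_sub, map_sub, LinearMap.sub_apply, LinearMap.sub_apply, h1,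
    D.form_symm X (G.Ad (D.a v * x) X), h2] at h3
  have h4 := D.form_pos X hX0
  have h5 : Real.exp (χ v) ≤ 1 := by
    by_contra hlt
    push Not at hlt
    nlinarith
  exact Real.exp_le_one_iff.1 h5

theorem a_mul_mul_inv_mem_N {x : G.Pts} (hx : x ∈ D.N) {m : G.Pts} (hm : m ∈ D.M) (v : D.𝔞) :
    (m * D.a v)⁻¹ * x * (m * D.a v) ∈ D.N :=
  D.conj_mem_N (mul_mem hm.2 (D.A_le_centralizer ⟨v, rfl⟩)) hx

/-- Uniqueness of the `𝔞`-component of the Iwasawa decomposition. -/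
theorem iwasawa_unique {u : D.𝔞} (hu : u ∈ interior D.chamber) {k k' x x' : G.Pts} {v v' : D.𝔞}
    (hk : k ∈ D.K) (hk' : k' ∈ D.K) (hx : x ∈ D.N) (hx' : x' ∈ D.N)
    (h : k * D.a v * x = k' * D.a v' * x') : v = v' := by
  have hN := D.a_mul_mul_inv_mem_N (D.N.mul_mem hx (D.N.inv_mem hx')) D.M.one_mem (-v')
  rw [one_mul, D.a_neg, inv_inv] at hN
  rw [← sub_eq_zero]
  refine D.eq_zero_of_a_mul_mem_K hu hN ?_
  have e : D.a (v - v') * (D.a v' * (x * x'⁻¹) * (D.a v')⁻¹) = k⁻¹ * k' := by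
    rw [sub_eq_add_neg, D.a_add, D.a_neg]
    have h' : x = (D.a v)⁻¹ * k⁻¹ * (k' * D.a v' * x') := by rw [← h]; group
    rw [h']; group
  rw [e]
  exact D.K.mul_mem (D.K.inv_mem hk) hk'

/-- The cocycle is defined through a representative in `K`. Passing to any `g` over the same
boundary point adds the Iwasawa component `w` of `g`, because `MA` normalizes `N` and `M` commutes
with `A`. -/
theorem exists_iwasawa_of_cocycle {f g : G.Pts} {v : D.𝔞}
    (h : D.IwasawaCocycleEq f (g : D.Boundary) v) :
    ∃ w, (∃ k ∈ D.K, ∃ x ∈ D.N, g = k * D.a w * x) ∧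
      ∃ k ∈ D.K, ∃ x ∈ D.N, f * g = k * D.a (v + w) * x := by
  obtain ⟨k, hk, hkg, k', hk', x, hx, hfk⟩ := h
  obtain ⟨m, hm, _, ⟨w, rfl⟩, y, hy, hp⟩ := QuotientGroup.eq.1 hkg
  have hg : g = k * (m * D.a w * y) := by rw [← hp]; group
  refine ⟨w, ⟨k * m, D.K.mul_mem hk hm.1, y, hy, by rw [hg]; group⟩, k' * m,
    D.K.mul_mem hk' hm.1, _, D.N.mul_mem (D.a_mul_mul_inv_mem_N hx hm w) hy, ?_⟩
  have hc : m * D.a v = D.a v * m := (D.commute_of_mem_M hm v).eq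
  calc f * g = f * k * (m * D.a w * y) := by rw [hg]; group
    _ = k' * (D.a v * m) * D.a w * ((m * D.a w)⁻¹ * x * (m * D.a w)) * y := by
      rw [hfk]; group
    _ = _ := by rw [← hc, D.a_add]; group

end CartanData

end ConnectedRealAlgebraicGroup

/-! ### Powers of unipotent elements -/

theorem one_add_pow_eq_sum {R : Type*} [Ring R] {N : R} {d : ℕ} (hN : N ^ d = 0) (k : ℕ) :
    (1 + N) ^ k = ∑ i ∈ Finset.range d, (k.choose i : R) * N ^ i := by
  have h1 : (1 + N) ^ k = ∑ i ∈ Finset.range (k + 1 + d), (k.choose i : R) * N ^ i := by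
    rw [add_comm, (Commute.one_right N).add_pow]
    simp only [one_pow, mul_one]
    rw [Finset.sum_subset (Finset.range_subset_range.2 (Nat.le_add_right (k + 1) d))]
    · exact Finset.sum_congr rfl fun i _ => (Nat.cast_commute _ _).eq.symm
    · intro i _ hi
      rw [Nat.choose_eq_zero_of_lt (by simpa using hi), Nat.cast_zero, mul_zero]
  rw [h1]
  symm
  refine Finset.sum_subset (Finset.range_subset_range.2 (Nat.le_add_left d (k + 1))) fun i _ hi => ?_
  rw [pow_eq_zero_of_le (by simpa using hi) hN, mul_zero]

/-- The binomial expansion is finite, so powers of a unipotent element grow only polynomially. -/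
theorem tendsto_smul_unipotent_pow {E : Type*} [NormedRing E] [NormedAlgebra ℝ E] {U : E}
    (hU : IsNilpotent (U - 1)) {r : ℝ} (h0 : 0 ≤ r) (h1 : r < 1) :
    Tendsto (fun k : ℕ => r ^ k • U ^ k) atTop (𝓝 0) := by
  obtain ⟨d, hd⟩ := hU
  have h2 : ∀ k : ℕ, r ^ k • U ^ k =
      ∑ i ∈ Finset.range d, (r ^ k * (k.choose i : ℝ)) • (U - 1) ^ i := by
    intro k
    have := one_add_pow_eq_sum hd k
    rw [add_sub_cancel] at this
    rw [this, Finset.smul_sum]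
    refine Finset.sum_congr rfl fun i _ => ?_
    rw [mul_smul, Nat.cast_smul_eq_nsmul ℝ, nsmul_eq_mul]
  simp only [h2]
  rw [show (0 : E) = ∑ i ∈ Finset.range d, (0 : ℝ) • (U - 1) ^ i by simp]
  refine tendsto_finsetSum _ fun i _ => Tendsto.smul_const ?_ _
  refine squeeze_zero (fun k => by positivity) (fun k => ?_)
    (tendsto_pow_const_mul_const_pow_of_lt_one i h0 h1)
  rw [mul_comm]
  exact mul_le_mul_of_nonneg_right (by exact_mod_cast Nat.choose_le_pow k i) (by positivity)

theorem IsNilpotent.inv_sub_one {R : Type*} [Ring R] {g : Rˣ} (h : IsNilpotent ((g : R) - 1)) :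
    IsNilpotent (((g⁻¹ : Rˣ) : R) - 1) := by
  have e : ((g⁻¹ : Rˣ) : R) - 1 = -(((g⁻¹ : Rˣ) : R) * ((g : R) - 1)) := by
    rw [mul_sub, Units.inv_mul, mul_one, neg_sub]
  rw [e]
  refine IsNilpotent.neg (Commute.isNilpotent_mul_left ?_ h)
  exact Commute.sub_right (by simp [Commute, SemiconjBy]) (Commute.one_right _)

namespace ConnectedRealAlgebraicGroup

section

attribute [local instance] Matrix.linftyOpNormedRing Matrix.linftyOpNormedAlgebra

theorem tendsto_matrix_unipotent {n : ℕ} {U : Matrix (Fin n) (Fin n) ℝ} (hU : IsNilpotent (U - 1)) {r : ℝ}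
    (h0 : 0 ≤ r) (h1 : r < 1) : Tendsto (fun k : ℕ => r ^ k • U ^ k) atTop (𝓝 0) :=
  tendsto_smul_unipotent_pow hU h0 h1

end

section

variable {n : ℕ} {G : ConnectedRealAlgebraicGroup n}

theorem tendsto_Ad_unipotent {g : G.Pts}
    (hg : IsNilpotent (((g : GL (Fin n) ℝ) : Matrix (Fin n) (Fin n) ℝ) - 1)) (X : G.lieAlgebra)
    {r : ℝ} (h0 : 0 ≤ r) (h1 : r < 1) :
    Tendsto (fun k : ℕ => (r ^ k * r ^ k) • G.Ad (g ^ k) X) atTop (𝓝 0) := by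
  rw [tendsto_subtype_rng]
  have hA := tendsto_matrix_unipotent hg h0 h1
  have hB := tendsto_matrix_unipotent hg.inv_sub_one h0 h1
  have h := (hA.mul_const (X : Matrix (Fin n) (Fin n) ℝ)).mul hB
  rw [zero_mul, mul_zero] at h
  refine h.congr fun k => ?_
  change _ = (r ^ k * r ^ k) • ((((g ^ k : G.Pts) : GL (Fin n) ℝ) : Matrix (Fin n) (Fin n) ℝ) * X *
      ((((g ^ k : G.Pts) : GL (Fin n) ℝ)⁻¹ : GL (Fin n) ℝ) : Matrix (Fin n) (Fin n) ℝ))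
  rw [Subgroup.coe_pow, ← inv_pow, Units.val_pow_eq_pow_val, Units.val_pow_eq_pow_val]
  rw [smul_mul_assoc, smul_mul_smul_comm]

end

/-! ### Elements whose Jordan projection lies in the open chamber -/

namespace CartanData

variable {n : ℕ} {G : ConnectedRealAlgebraicGroup n} (D : G.CartanData)

/-- An element of `MA` that is a commuting product of an elliptic and a unipotent element, up to
conjugation, lies in `M`. -/
theorem eq_zero_of_elliptic_mul_unipotent {φ ge gu m : G.Pts} {v : D.𝔞} (hc : Commute ge gu)
    {L : Subgroup G.Pts} (hL : IsCompact (L : Set G.Pts)) (hge : ge ∈ L)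
    (hgu : IsNilpotent (((gu : GL (Fin n) ℝ) : Matrix (Fin n) (Fin n) ℝ) - 1)) (hm : m ∈ D.M)
    (h : φ⁻¹ * (ge * gu) * φ = m * D.a v) : v = 0 := by
  refine D.eq_zero_of_eigenvalues_nonpos fun χ X hX0 hX => ?_
  by_contra hlt
  push Not at hlt
  have hpow : ∀ k : ℕ, φ⁻¹ * (ge ^ k * gu ^ k) * φ = m ^ k * D.a ((k : ℝ) • v) := by
    intro k
    rw [← D.a_pow, ← (D.commute_of_mem_M hm v).mul_pow, ← h, ← hc.mul_pow]
    have := conj_pow (a := φ⁻¹) (b := ge * gu) (i := k)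
    rw [inv_inv] at this
    exact this.symm
  have hnorm : ∀ k : ℕ, D.form (G.Ad (φ⁻¹ * (ge ^ k * gu ^ k) * φ) X)
      (G.Ad (φ⁻¹ * (ge ^ k * gu ^ k) * φ) X) =
        Real.exp (k * χ v) * (Real.exp (k * χ v) * D.form X X) := by
    intro k
    have h1 : G.Ad (D.a ((k : ℝ) • v)) X = Real.exp (k * χ v) • X :=
      G.Ad_exp_eigen (by rw [Submodule.coe_smul, smul_lie, hX, smul_smul])
    rw [hpow, G.Ad_mul, h1, D.form_Ad_of_mem_K (D.K.pow_mem hm.1 k), map_smul, map_smul,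
      LinearMap.smul_apply, smul_eq_mul, smul_eq_mul]
  -- Chosen so that `r ^ (2 k)` cancels the growth `exp (k χ(v))`. The rescaled orbit of `X` has
  -- constant norm, yet it tends to 0: the elliptic powers stay in a compact group and the unipotent
  -- ones grow subexponentially.
  set r := Real.exp (-(χ v / 2)) with hr
  have hr1 : r < 1 := Real.exp_lt_one_iff.2 (by linarith)
  have hrk : ∀ k : ℕ, (r ^ k * r ^ k) * Real.exp (k * χ v) = 1 := by
    intro k
    rw [hr, ← Real.exp_nat_mul, ← Real.exp_add, ← Real.exp_add, Real.exp_eq_one_iff]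
    ring
  have hlim := (tendsto_Ad_unipotent hgu (G.Ad φ X) (Real.exp_nonneg _) hr1).mono_left
    (Nat.hyperfilter_le_atTop)
  obtain ⟨l, -, hl⟩ := hL.ultrafilter_le_nhds' ((hyperfilter ℕ).map fun k => ge ^ k)
    (Ultrafilter.mem_map.2 (Filter.univ_mem' fun k => L.pow_mem hge k))
  have hl' : Tendsto (fun k : ℕ => ge ^ k) (hyperfilter ℕ) (𝓝 l) := hl
  have hcont : Continuous fun p : G.Pts × G.lieAlgebra => G.Ad φ⁻¹ (G.Ad p.1 p.2) :=
    G.continuous_Ad_of continuous_const (G.continuous_Ad_of continuous_fst continuous_snd)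
  have hlim2 := (hcont.tendsto (l, 0)).comp (hl'.prodMk_nhds hlim)
  have hform := ((D.continuous_form continuous_id continuous_id).tendsto _).comp hlim2
  have hzero : D.form (G.Ad φ⁻¹ (G.Ad l 0)) (G.Ad φ⁻¹ (G.Ad l 0)) = 0 := by simp
  have hconst : ∀ k : ℕ, D.form X X = D.form
      (G.Ad φ⁻¹ (G.Ad (ge ^ k) ((r ^ k * r ^ k) • G.Ad (gu ^ k) (G.Ad φ X))))
      (G.Ad φ⁻¹ (G.Ad (ge ^ k) ((r ^ k * r ^ k) • G.Ad (gu ^ k) (G.Ad φ X)))) := by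
    intro k
    have e : G.Ad φ⁻¹ (G.Ad (ge ^ k) ((r ^ k * r ^ k) • G.Ad (gu ^ k) (G.Ad φ X))) =
        (r ^ k * r ^ k) • G.Ad (φ⁻¹ * (ge ^ k * gu ^ k) * φ) X := by
      rw [G.Ad_smul, G.Ad_smul, G.Ad_mul, G.Ad_mul, G.Ad_mul]
    rw [e, map_smul, map_smul, LinearMap.smul_apply, smul_eq_mul, smul_eq_mul, hnorm]
    linear_combination (-(1 + (r ^ k * r ^ k) * Real.exp (k * χ v)) * D.form X X) * hrk k
  have h2 := tendsto_nhds_unique (tendsto_const_nhds.congr hconst) hform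
  exact hX0 (D.eq_zero_of_form (h2.trans hzero))

/-- An element with Jordan projection `u` in the open chamber is conjugate into `a_u M`. -/
theorem exists_conj_of_jordanProjection {u : D.𝔞} (hu : u ∈ interior D.chamber) {γ : G.Pts}
    (h : D.JordanProjectionEq γ u) : ∃ φ, ∃ m ∈ D.M, γ = φ * (D.a u * m) * φ⁻¹ := by
  obtain ⟨-, gh, ge, gu, φ, hγ, hhe, hhu, heu, hgh, ⟨L, hL, hge⟩, hnil⟩ := h
  have hcomm : Commute (φ⁻¹ * (ge * gu) * φ) (D.a u) := by
    have h1 : (ge * gu) * gh = gh * (ge * gu) := (hhe.mul_right hhu).eq.symm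
    rw [hgh] at h1
    change φ⁻¹ * (ge * gu) * φ * D.a u = D.a u * (φ⁻¹ * (ge * gu) * φ)
    calc φ⁻¹ * (ge * gu) * φ * D.a u = φ⁻¹ * ((ge * gu) * (φ * D.a u * φ⁻¹)) * φ := by group
      _ = _ := by rw [h1]; group
  obtain ⟨m, hm, v, hmv⟩ := D.exists_mem_M_mul_a_of_commute hu hcomm
  have hv := D.eq_zero_of_elliptic_mul_unipotent heu hL hge hnil hm hmv
  rw [hv, D.a_zero, mul_one] at hmv
  refine ⟨φ, m, hm, ?_⟩
  rw [hγ, hgh, ← hmv]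
  group

end CartanData

/-! ### Zariski density -/

section Zariski

variable {n : ℕ} {G : ConnectedRealAlgebraicGroup n}

/-- The adjugate replaces the inverse, which is not polynomial in the entries; the price is a factor
of the determinant. -/
theorem exists_mvPolynomial_eval_eq (ℓ : Matrix (Fin n) (Fin n) ℝ →ₗ[ℝ] ℝ)
    (A B C : Matrix (Fin n) (Fin n) ℝ) : ∃ p : MvPolynomial (Fin n × Fin n) ℝ,
      ∀ g : Matrix (Fin n) (Fin n) ℝ, MvPolynomial.eval (fun ij => g ij.1 ij.2) p =
        ℓ (A * g * B * g.adjugate * C) := by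
  let M := Matrix.mvPolynomialX (Fin n) (Fin n) ℝ
  let c : ℝ →+* MvPolynomial (Fin n × Fin n) ℝ := MvPolynomial.C
  let P := c.mapMatrix A * M * c.mapMatrix B * M.adjugate * c.mapMatrix C
  refine ⟨∑ i, ∑ j, c (ℓ (Matrix.single i j 1)) * P i j, fun g => ?_⟩
  set ev := MvPolynomial.eval (fun ij : Fin n × Fin n => g ij.1 ij.2) with hev
  have hc : ∀ A : Matrix (Fin n) (Fin n) ℝ, ev.mapMatrix (c.mapMatrix A) = A := fun A => by
    ext i j; simp [ev, c]
  have hM : ev.mapMatrix M = g := Matrix.mvPolynomialX_mapMatrix_eval g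
  have hP : ev.mapMatrix P = A * g * B * g.adjugate * C := by
    simp only [P, map_mul, hc, hM, RingHom.map_adjugate]
  have hP' : ∀ i j, ev (P i j) = (A * g * B * g.adjugate * C) i j := fun i j => by
    rw [← hP]; rfl
  rw [Matrix.matrix_eq_sum_single (A * g * B * g.adjugate * C)]
  simp only [map_sum, map_mul, hP']
  refine Finset.sum_congr rfl fun i _ => Finset.sum_congr rfl fun j _ => ?_
  have e : Matrix.single i j ((A * g * B * g.adjugate * C) i j) =
      (A * g * B * g.adjugate * C) i j • Matrix.single i j (1 : ℝ) := by
    rw [Matrix.smul_single, smul_eq_mul, mul_one]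
  rw [e, map_smul, smul_eq_mul, mul_comm]
  simp [ev, c]

theorem exists_mvPolynomial_eval_eq_Ad (ℓ : G.lieAlgebra →ₗ[ℝ] ℝ) (φ y : G.Pts)
    (X : G.lieAlgebra) : ∃ p : MvPolynomial (Fin n × Fin n) ℝ, ∀ g : G.Pts,
      MvPolynomial.eval (fun ij => ((g : GL (Fin n) ℝ) : Matrix (Fin n) (Fin n) ℝ) ij.1 ij.2) p =
        ((g : GL (Fin n) ℝ) : Matrix (Fin n) (Fin n) ℝ).det * ℓ (G.Ad (φ * g * y) X) := by
  obtain ⟨L, hL⟩ := LinearMap.exists_extend (p := G.lieAlgebra.toSubmodule) ℓ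
  have hL' : ∀ Z : G.lieAlgebra, ℓ Z = L (Z : Matrix (Fin n) (Fin n) ℝ) :=
    fun Z => (LinearMap.congr_fun hL Z).symm
  obtain ⟨p, hp⟩ := exists_mvPolynomial_eval_eq L ((φ : GL (Fin n) ℝ) : Matrix (Fin n) (Fin n) ℝ)
    (G.Ad y X : Matrix (Fin n) (Fin n) ℝ)
    (((φ : GL (Fin n) ℝ)⁻¹ : GL (Fin n) ℝ) : Matrix (Fin n) (Fin n) ℝ)
  refine ⟨p, fun g => ?_⟩
  set g' := ((g : GL (Fin n) ℝ) : Matrix (Fin n) (Fin n) ℝ) with hg'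
  have hadj : g'.adjugate = g'.det • (((g : GL (Fin n) ℝ)⁻¹ : GL (Fin n) ℝ) : Matrix (Fin n) (Fin n) ℝ) := by
    have h1 : g'.adjugate * (g' * (((g : GL (Fin n) ℝ)⁻¹ : GL (Fin n) ℝ) : Matrix (Fin n) (Fin n) ℝ)) =
        g'.adjugate := by rw [hg', Units.mul_inv, mul_one]
    rw [← h1, ← mul_assoc, Matrix.adjugate_mul, smul_mul_assoc, one_mul]
  rw [hp, hL', mul_assoc φ g y, G.Ad_mul, G.Ad_mul, hadj, ← smul_eq_mul (g'.det), ← map_smul L]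
  congr 1
  rw [G.coe_Ad φ, G.coe_Ad g, mul_smul_comm, smul_mul_assoc]
  simp only [mul_assoc]
  rfl

/-- A Zariski dense subgroup contains elements that move one of two complementary subspaces to a
complement of the other. -/
theorem exists_transversal {Γ : Subgroup G.Pts} (hΓ : G.IsZariskiDense Γ)
    {S T : Submodule ℝ G.lieAlgebra} (hST : IsCompl S T) (φ y : G.Pts) :
    ∃ γ ∈ Γ, ∀ X ∈ S, G.Ad (φ * γ * y) X ∈ T → X = 0 := by
  let b := Module.finBasis ℝ S
  let π := S.projectionOnto T hST
  -- `F g` is invertible exactly when transversality holds at `g`. Its determinant times a power of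
  -- `det g` is polynomial, and does not vanish at `φ⁻¹ y⁻¹`, where `F` is the identity.
  let F : G.Pts → Module.End ℝ S := fun g => π ∘ₗ G.AdEnd (φ * g * y) ∘ₗ S.subtype
  choose p hp using fun i j => exists_mvPolynomial_eval_eq_Ad (b.coord i ∘ₗ π) φ y (b j)
  have hdet : ∀ g : G.Pts, MvPolynomial.eval
      (fun ij => ((g : GL (Fin n) ℝ) : Matrix (Fin n) (Fin n) ℝ) ij.1 ij.2) (Matrix.of p).det =
      ((g : GL (Fin n) ℝ) : Matrix (Fin n) (Fin n) ℝ).det ^ (Module.finrank ℝ S) *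
        LinearMap.det (F g) := by
    intro g
    rw [RingHom.map_det, ← LinearMap.det_toMatrix b]
    have e : (MvPolynomial.eval
        (fun ij => ((g : GL (Fin n) ℝ) : Matrix (Fin n) (Fin n) ℝ) ij.1 ij.2)).mapMatrix
          (Matrix.of p) = ((g : GL (Fin n) ℝ) : Matrix (Fin n) (Fin n) ℝ).det •
            LinearMap.toMatrix b b (F g) := by
      ext i j
      rw [Matrix.smul_apply, LinearMap.toMatrix_apply, smul_eq_mul]
      exact hp i j g
    rw [e, Matrix.det_smul, Fintype.card_fin]
  by_contra hcon
  push Not at hcon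
  have hzero := hΓ (Matrix.of p).det (fun γ hγ => by
    obtain ⟨X, hX, hT, hX0⟩ := hcon γ hγ
    rw [hdet]
    by_contra hne
    have h1 : LinearMap.det (F γ) ≠ 0 := right_ne_zero_of_mul hne
    have h2 : LinearMap.ker (F γ) = ⊥ := by
      by_contra hk
      exact h1 (LinearMap.det_eq_zero_iff_ker_ne_bot.2 hk)
    have h3 := LinearMap.ker_eq_bot'.1 h2 ⟨X, hX⟩ ((Submodule.projectionOnto_apply_eq_zero_iff hST).2 hT)
    exact hX0 (congrArg Subtype.val h3)) (φ⁻¹ * y⁻¹)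
  rw [hdet] at hzero
  have hF : F (φ⁻¹ * y⁻¹) = LinearMap.id := by
    ext1 X
    change π (G.Ad (φ * (φ⁻¹ * y⁻¹) * y) X) = X
    rw [mul_inv_cancel_left, inv_mul_cancel, G.Ad_one]
    exact Submodule.projectionOnto_apply_left hST X
  rw [hF, LinearMap.det_id, mul_one] at hzero
  have hunit := (Matrix.isUnit_iff_isUnit_det _).1
    (Units.isUnit (((φ⁻¹ * y⁻¹ : G.Pts) : GL (Fin n) ℝ)))
  exact hunit.ne_zero (eq_zero_of_pow_eq_zero hzero)

end Zariski

end ConnectedRealAlgebraicGroup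

/-! ### Limits of horospherical orbits -/

namespace ConnectedRealAlgebraicGroup

variable {n : ℕ} {G : ConnectedRealAlgebraicGroup n}

/-- A basis of the negative part reduces the moving vectors to finitely many fixed ones with
convergent coefficients. -/
theorem tendsto_Ad_exp_smul {ι : Type*} {F : Filter ι} {u : G.lieAlgebra} {t : ι → ℝ}
    (ht : Tendsto t F atTop) {Y : ι → G.lieAlgebra} {Y₀ : G.lieAlgebra}
    (hY : ∀ᶠ j in F, Y j ∈ spec u (Set.Iio 0)) (hlim : Tendsto Y F (𝓝 Y₀)) :
    Tendsto (fun j => G.Ad (G.exp (t j • u)) (Y j)) F (𝓝 0) := by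
  set S := spec u (Set.Iio 0)
  obtain ⟨π, hπ⟩ := S.subtype.exists_leftInverse_of_injective S.ker_subtype
  let b := Module.finBasis ℝ S
  have hsum : Tendsto (fun j => ∑ i, b.coord i (π (Y j)) • G.Ad (G.exp (t j • u)) (b i)) F
      (𝓝 (∑ i, b.coord i (π Y₀) • (0 : G.lieAlgebra))) := by
    refine tendsto_finsetSum _ fun i _ => Tendsto.smul ?_ ?_
    · exact ((LinearMap.continuous_of_finiteDimensional (b.coord i ∘ₗ π)).tendsto Y₀).comp hlim
    · exact (CartanData.Ad_exp_smul_tendsto_zero (b i).2).comp ht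
  simp only [smul_zero, Finset.sum_const_zero] at hsum
  refine hsum.congr' ?_
  filter_upwards [hY] with j hj
  have h1 : ((π (Y j) : S) : G.lieAlgebra) = Y j :=
    congrArg Subtype.val (LinearMap.congr_fun hπ ⟨Y j, hj⟩)
  have h2 := congrArg (fun Z : S => G.AdEnd (G.exp (t j • u)) (S.subtype Z)) (b.sum_repr (π (Y j)))
  simp only [map_sum, map_smul] at h2
  refine h2.trans ?_
  rw [Submodule.subtype_apply, h1, AdEnd_apply]

theorem exists_nhds_isCompact_preimage (G : ConnectedRealAlgebraicGroup n) :
    ∃ U ∈ 𝓝 (0 : Matrix (Fin n) (Fin n) ℝ), IsCompact ((fun X : G.lieAlgebra =>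
      (X : Matrix (Fin n) (Fin n) ℝ)) ⁻¹' U) := by
  have : LocallyCompactSpace (Matrix (Fin n) (Fin n) ℝ) :=
    inferInstanceAs (LocallyCompactSpace (Fin n → Fin n → ℝ))
  obtain ⟨U, hU, h0⟩ := exists_compact_mem_nhds (0 : Matrix (Fin n) (Fin n) ℝ)
  refine ⟨U, h0, ?_⟩
  have hcl : IsClosed (G.lieAlgebra.toSubmodule : Set (Matrix (Fin n) (Fin n) ℝ)) :=
    G.lieAlgebra.toSubmodule.closed_of_finiteDimensional
  exact hcl.isClosedEmbedding_subtypeVal.isCompact_preimage hU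

theorem continuous_toQuotient (Γ : Subgroup G.Pts) : Continuous (G.toQuotient Γ) :=
  continuous_quotient_mk'

theorem translate_toQuotient (Γ : Subgroup G.Pts) (g h : G.Pts) :
    G.translate (G.toQuotient Γ g) h = G.toQuotient Γ (g * h) := rfl

theorem toQuotient_mul_left {Γ : Subgroup G.Pts} {γ : G.Pts} (hγ : γ ∈ Γ) (g : G.Pts) :
    G.toQuotient Γ (γ * g) = G.toQuotient Γ g :=
  Quotient.sound (QuotientGroup.rightRel_apply.2 (by
    rw [mul_inv_rev, mul_inv_cancel_left]; exact Γ.inv_mem hγ))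

namespace CartanData

variable (D : G.CartanData)

theorem continuous_norm : Continuous D.norm :=
  Real.continuous_sqrt.comp (D.continuous_form continuous_subtype_val continuous_subtype_val)

theorem isCompact_norm_le (R : ℝ) : IsCompact {v : D.𝔞 | D.form v v ≤ R} := by
  have : IsTopologicalAddGroup D.𝔞 := inferInstanceAs (IsTopologicalAddGroup D.𝔞.toAddSubgroup)
  exact isCompact_setOf_form_le (D.form.compl₁₂ D.𝔞.subtype D.𝔞.subtype)
    (fun v hv => D.form_pos v (by simpa using hv)) R

/-- The coordinates stay in a compact set, so they converge along the ultrafilter, not necessarily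
to 0. The positive one needs no limit: its factor is later absorbed into `N`. -/
theorem exists_exp_coordinates {ι : Type*} (F : Ultrafilter ι) (u : D.𝔞) {s : ι → G.Pts}
    (hs : Tendsto s F (𝓝 1)) : ∃ Y Z V : ι → G.lieAlgebra, ∃ Y₀ Z₀ : G.lieAlgebra,
      Tendsto Y F (𝓝 Y₀) ∧ Tendsto Z F (𝓝 Z₀) ∧
      ∀ᶠ j in (F : Filter ι), Y j ∈ spec (u : G.lieAlgebra) (Set.Iio 0) ∧
        Z j ∈ spec (u : G.lieAlgebra) {0} ∧ V j ∈ spec (u : G.lieAlgebra) (Set.Ioi 0) ∧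
        G.exp (Y j) * G.exp (Z j) * G.exp (V j) = s j := by
  obtain ⟨U, hU, hUc⟩ := G.exists_nhds_isCompact_preimage
  have hsup : spec (u : G.lieAlgebra) (Set.Iio 0) ⊔ spec (u : G.lieAlgebra) {0} ⊔
      spec (u : G.lieAlgebra) (Set.Ioi 0) = ⊤ := by
    rw [eq_top_iff]
    intro X _
    obtain ⟨A, hA, B, hB, C, hC, rfl⟩ := D.exists_parts (u := u) X
    exact Submodule.add_mem_sup (Submodule.add_mem_sup hA hB) hC
  have hev := hs.eventually (G.eventually_exists_exp_mul _ _ _ hsup hU)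
  have hev' : ∀ᶠ j in (F : Filter ι), ∃ p : G.lieAlgebra × G.lieAlgebra × G.lieAlgebra,
      p.1 ∈ spec (u : G.lieAlgebra) (Set.Iio 0) ∧ p.2.1 ∈ spec (u : G.lieAlgebra) {0} ∧
      p.2.2 ∈ spec (u : G.lieAlgebra) (Set.Ioi 0) ∧
      (p.1 : Matrix (Fin n) (Fin n) ℝ) ∈ U ∧ (p.2.1 : Matrix (Fin n) (Fin n) ℝ) ∈ U ∧
      G.exp p.1 * G.exp p.2.1 * G.exp p.2.2 = s j := by
    filter_upwards [hev] with j ⟨Y, hY, Z, hZ, V, hV, h1, h2, _, h⟩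
    exact ⟨(Y, Z, V), hY, hZ, hV, h1, h2, h⟩
  obtain ⟨p, hp⟩ := hev'.choice
  obtain ⟨Y₀, -, hY₀⟩ := hUc.ultrafilter_le_nhds' (F.map fun j => (p j).1)
    (Ultrafilter.mem_map.2 (hp.mono fun j hj => hj.2.2.2.1))
  obtain ⟨Z₀, -, hZ₀⟩ := hUc.ultrafilter_le_nhds' (F.map fun j => (p j).2.1)
    (Ultrafilter.mem_map.2 (hp.mono fun j hj => hj.2.2.2.2.1))
  exact ⟨fun j => (p j).1, fun j => (p j).2.1, fun j => (p j).2.2, Y₀, Z₀, hY₀, hZ₀,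
    hp.mono fun j hj => ⟨hj.1, hj.2.1, hj.2.2.1, hj.2.2.2.2.2⟩⟩

variable {u : D.𝔞} (hu : u ∈ interior D.chamber)

include hu

/-- The constant `c` is the Iwasawa component of `h⁻¹ g`, independent of `j` by uniqueness. -/
theorem exists_iwasawa_of_busemann {g h : G.Pts} {f : ℕ → G.Pts} {v : ℕ → D.𝔞}
    (hv : ∀ j, D.BusemannEq (g : D.Boundary) h (f j) (v j)) :
    ∃ c, ∀ j, ∃ k ∈ D.K, ∃ x ∈ D.N, (f j)⁻¹ * g = k * D.a (c - v j) * x := by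
  obtain ⟨v₁, v₂, h₁, h₂, hv₀⟩ := hv 0
  obtain ⟨w, ⟨k, hk, x, hx, hg⟩, k', hk', x', hx', hhg⟩ := D.exists_iwasawa_of_cocycle h₁
  refine ⟨v₁ + w, fun j => ?_⟩
  obtain ⟨v₁', v₂', h₁', h₂', hvj⟩ := hv j
  obtain ⟨w₁, ⟨k₁, hk₁, x₁, hx₁, hg₁⟩, k₁', hk₁', x₁', hx₁', hhg₁⟩ :=
    D.exists_iwasawa_of_cocycle h₁'
  obtain ⟨w₂, ⟨k₂, hk₂, x₂, hx₂, hg₂⟩, k₂', hk₂', x₂', hx₂', hhg₂⟩ :=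
    D.exists_iwasawa_of_cocycle h₂'
  have e₁ := D.iwasawa_unique hu hk₁' hk' hx₁' hx' (hhg₁.symm.trans hhg)
  have e₂ := D.iwasawa_unique hu hk₁ hk₂ hx₁ hx₂ (hg₁.symm.trans hg₂)
  refine ⟨k₂', hk₂', x₂', hx₂', ?_⟩
  rw [hhg₂, hvj, ← e₁, e₂]
  congr 3
  abel

/-- For a `u`-horospherical point, translates of the orbit `g N` by `Γ` followed by the flow
`a_{tu}`, `t → ∞`, converge. -/
theorem exists_tendsto_of_isHorospherical {Γ : Subgroup G.Pts} {g : G.Pts}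
    (hg : D.IsHorospherical Γ u (g : D.Boundary)) :
    ∃ (γ x : ℕ → G.Pts) (t : ℕ → ℝ) (y : G.Pts), (∀ j, γ j ∈ Γ) ∧ (∀ j, x j ∈ D.N) ∧
      (∀ j, 0 ≤ t j) ∧ Tendsto t (hyperfilter ℕ) atTop ∧
      Tendsto (fun j => γ j * g * x j * D.a (t j • u)) (hyperfilter ℕ) (𝓝 y) := by
  obtain ⟨h, R, γ, v, hR, hγ, hb, hlim, ht⟩ := hg
  choose t ht0 htR using ht
  obtain ⟨c, hc⟩ := D.exists_iwasawa_of_busemann hu hb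
  choose k hk x hx hkx using hc
  obtain ⟨κ, -, hκ⟩ := D.K_maximal.prop.ultrafilter_le_nhds' ((hyperfilter ℕ).map k)
    (Ultrafilter.mem_map.2 (univ_mem' hk))
  have hκ' : Tendsto k (hyperfilter ℕ) (𝓝 κ) := hκ
  obtain ⟨e, -, he⟩ := (D.isCompact_norm_le (R ^ 2)).ultrafilter_le_nhds'
    ((hyperfilter ℕ).map fun j => v j - t j • u) (Ultrafilter.mem_map.2 (univ_mem' fun j => by
      have h1 := (Real.sqrt_lt' hR).1 (htR j)
      exact h1.le))
  have he' : Tendsto (fun j => v j - t j • u) (hyperfilter ℕ) (𝓝 e) := he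
  have hca : Continuous D.a := G.continuous_exp.comp continuous_subtype_val
  refine ⟨fun j => (γ j)⁻¹, fun j => (x j)⁻¹, t, h * κ * D.a (c - e), fun j => Γ.inv_mem (hγ j),
    fun j => D.N.inv_mem (hx j), ht0, ?_, ?_⟩
  -- Were `t` bounded along the ultrafilter, `v` would converge along it, against the divergence of
  -- its norm.
  · rw [tendsto_atTop]
    intro C
    by_contra hC
    rw [Ultrafilter.eventually_not.symm] at hC
    have hmem : ∀ᶠ j in (hyperfilter ℕ : Filter ℕ), t j ∈ Set.Icc 0 C :=
      hC.mono fun j hj => ⟨ht0 j, (not_le.1 hj).le⟩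
    obtain ⟨t₀, -, ht₀⟩ := isCompact_Icc.ultrafilter_le_nhds' ((hyperfilter ℕ).map t)
      (Ultrafilter.mem_map.2 hmem)
    have ht₀' : Tendsto t (hyperfilter ℕ) (𝓝 t₀) := ht₀
    have h1 : Tendsto v (hyperfilter ℕ) (𝓝 (e + t₀ • u)) := by
      refine (he'.add (ht₀'.smul_const u)).congr fun j => ?_
      rw [sub_add_cancel]
    exact not_tendsto_nhds_of_tendsto_atTop (hlim.mono_left Nat.hyperfilter_le_atTop) _
      ((D.continuous_norm.tendsto _).comp h1)
  -- The translated and flowed points equal `h k_j a_{c - (v_j - t_j u)}`, where `k_j ∈ K` and `v_j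
  -- - t_j u` is bounded.
  · have h1 : Tendsto (fun j => h * k j * D.a (c - (v j - t j • u))) (hyperfilter ℕ)
        (𝓝 (h * κ * D.a (c - e))) :=
      (hκ'.const_mul h).mul ((hca.tendsto _).comp (tendsto_const_nhds.sub he'))
    refine h1.congr fun j => ?_
    have h2 := hkx j
    have h3 : (γ j)⁻¹ * g * (x j)⁻¹ = h * k j * D.a (c - v j) := by
      have h4 : (γ j)⁻¹ * g = h * ((γ j * h)⁻¹ * g) := by group
      rw [h4, h2]; group
    rw [h3, mul_assoc (h * k j), ← D.a_add, sub_add]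

end CartanData

end ConnectedRealAlgebraicGroup

/-! ### Periodic points in closures of horospherical orbits -/

namespace ConnectedRealAlgebraicGroup

namespace CartanData

variable {n : ℕ} {G : ConnectedRealAlgebraicGroup n} (D : G.CartanData)
variable {u : D.𝔞}

theorem commute_exp_a_smul {Z : G.lieAlgebra} (hZ : Z ∈ spec (u : G.lieAlgebra) {0}) (t : ℝ) :
    Commute (G.exp Z) (D.a (t • u)) := by
  have h1 : ⁅((t • u : D.𝔞) : G.lieAlgebra), Z⁆ = 0 := by
    rw [Submodule.coe_smul, smul_lie, mem_spec_zero.1 hZ, smul_zero]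
  have h2 := G.exp_Ad (D.a (t • u)) Z
  rw [a_eq_exp, G.Ad_exp_eq_self h1, eq_mul_inv_iff_mul_eq] at h2
  exact h2

/-- Moving `a_u` to the left of `c` and absorbing `φ a_u m φ⁻¹` into `Γ` leaves `m⁻¹ c`; since `c ∈
MA`, this is `c` times an element of `M`. -/
theorem isPeriodic_of_commute (hu : u ∈ interior D.chamber) {Γ : Subgroup G.Pts}
    {φ m c : G.Pts} (hm : m ∈ D.M) (hγ : φ * (D.a u * m) * φ⁻¹ ∈ Γ) (hc : Commute c (D.a u)) :
    D.IsPeriodic u (G.toQuotient Γ (φ * c)) := by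
  obtain ⟨m₁, hm₁, v, hcv⟩ := D.exists_mem_M_mul_a_of_commute hu hc
  refine ⟨m₁⁻¹ * m⁻¹ * m₁, D.M.mul_mem (D.M.mul_mem (D.M.inv_mem hm₁) (D.M.inv_mem hm)) hm₁, ?_⟩
  rw [translate_toQuotient, translate_toQuotient, mul_assoc φ c, hc.eq]
  have h1 : φ * (D.a u * c) = φ * (D.a u * m) * φ⁻¹ * (φ * (m⁻¹ * c)) := by group
  rw [h1, toQuotient_mul_left hγ]
  have h2 : m⁻¹ * c = c * (m₁⁻¹ * m⁻¹ * m₁) := by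
    have h3 := (D.commute_of_mem_M (D.M.mul_mem (D.M.mul_mem (D.M.inv_mem hm₁) (D.M.inv_mem hm))
      hm₁) v).eq
    rw [hcv, mul_assoc m₁, ← h3]
    group
  rw [h2, mul_assoc φ c]

/-- If translates by `Γ` of a horospherical orbit followed by the flow converge to `y`, and `y` is
in general position with respect to a `u`-periodic point, then that point can be moved along its
centralizer into the closure of the orbit. -/
theorem exists_periodic_mem_closure (hu : u ∈ interior D.chamber) {Γ : Subgroup G.Pts}
    {g φ m y γ₁ : G.Pts} {γ x : ℕ → G.Pts} {t : ℕ → ℝ} (hm : m ∈ D.M)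
    (hγ₀ : φ * (D.a u * m) * φ⁻¹ ∈ Γ) (hγ : ∀ j, γ j ∈ Γ) (hx : ∀ j, x j ∈ D.N)
    (ht0 : ∀ j, 0 ≤ t j) (ht : Tendsto t (hyperfilter ℕ) atTop)
    (hy : Tendsto (fun j => γ j * g * x j * D.a (t j • u)) (hyperfilter ℕ) (𝓝 y))
    (hγ₁ : γ₁ ∈ Γ) (hq : ∀ X ∈ spec (u : G.lieAlgebra) (Set.Ici 0),
      G.Ad (φ⁻¹ * γ₁ * y) X ∈ spec (u : G.lieAlgebra) (Set.Iio 0) → X = 0) :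
    ∃ x₀ ∈ closure (D.orbitN (G.toQuotient Γ g)), D.IsPeriodic u x₀ := by
  obtain ⟨W, hW, m₁, hm₁, v, W', hW', hq⟩ := D.exists_bigCell hu hq
  set l := m₁ * D.a v with hl
  have hla : ∀ s : ℝ, Commute l (D.a (s • u)) := fun s =>
    (D.commute_of_mem_M hm₁ _).mul_left (by
      change _ * _ = _ * _
      rw [← D.a_add, ← D.a_add, add_comm])
  set F := hyperfilter ℕ
  let z : ℕ → G.Pts := fun j => γ j * g * x j * D.a (t j • u)
  let s : ℕ → G.Pts := fun j => (G.exp W)⁻¹ * (φ⁻¹ * γ₁ * z j) * (G.exp W')⁻¹ * l⁻¹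
  have hs : Tendsto s F (𝓝 1) := by
    have h1 := (((hy.const_mul (φ⁻¹ * γ₁)).const_mul (G.exp W)⁻¹).mul_const (G.exp W')⁻¹).mul_const l⁻¹
    have h2 : (G.exp W)⁻¹ * (φ⁻¹ * γ₁ * y) * (G.exp W')⁻¹ * l⁻¹ = 1 := by rw [hq]; group
    rwa [h2] at h1
  obtain ⟨Y, Z, V, Y₀, Z₀, hY₀, hZ₀, hYZV⟩ := D.exists_exp_coordinates F u hs
  -- The number of returns of the periodic orbit within time `t j`; the leftover time `r j` is
  -- bounded.
  let k : ℕ → ℕ := fun j => ⌊t j⌋₊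
  let r : ℕ → ℝ := fun j => t j - k j
  have hr : ∀ j, r j ∈ Set.Icc (0 : ℝ) 1 := fun j =>
    ⟨sub_nonneg.2 (Nat.floor_le (ht0 j)), by
      have := (Nat.lt_floor_add_one (t j)).le
      change t j - (⌊t j⌋₊ : ℝ) ≤ 1
      linarith⟩
  obtain ⟨r₀, -, hr₀⟩ := isCompact_Icc.ultrafilter_le_nhds' (F.map r)
    (Ultrafilter.mem_map.2 (univ_mem' hr))
  obtain ⟨m₀, -, hm₀⟩ := D.K_maximal.prop.ultrafilter_le_nhds' (F.map fun j => m ^ k j)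
    (Ultrafilter.mem_map.2 (univ_mem' fun j => D.K.pow_mem hm.1 _))
  have hr₀' : Tendsto r F (𝓝 r₀) := hr₀
  have hm₀' : Tendsto (fun j => m ^ k j) F (𝓝 m₀) := hm₀
  have hca : Continuous fun s : ℝ => D.a (-(s • u)) :=
    G.continuous_exp.comp (continuous_subtype_val.comp (continuous_id.smul continuous_const).neg)
  have hA : Tendsto (fun j => m ^ k j * D.a (-(r j • u))) F (𝓝 (m₀ * D.a (-(r₀ • u)))) :=
    hm₀'.mul ((hca.tendsto r₀).comp hr₀')
  have hB : Tendsto (fun j => G.exp (Z j) * l) F (𝓝 (G.exp Z₀ * l)) :=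
    ((G.continuous_exp.tendsto Z₀).comp hZ₀).mul_const l
  have hdecay : ∀ Y : ℕ → G.lieAlgebra, (Tendsto (fun j => G.Ad (G.exp (t j • (u : G.lieAlgebra))) (Y j)) F (𝓝 0)) →
      Tendsto (fun j => G.exp (G.Ad (D.a (t j • u)) (Y j))) F (𝓝 1) := by
    intro Y h
    have := (G.continuous_exp.tendsto 0).comp h
    rwa [G.exp_zero] at this
  have hW0 := hdecay (fun _ => W) (tendsto_Ad_exp_smul ht (Eventually.of_forall fun _ => hW)
    tendsto_const_nhds)
  have hY0 := hdecay Y (tendsto_Ad_exp_smul ht (hYZV.mono fun j hj => hj.1) hY₀)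
  let c := m₀ * D.a (-(r₀ • u)) * (G.exp Z₀ * l)
  have hlim : Tendsto (fun j => φ * (m ^ k j * D.a (-(r j • u)) *
      (G.exp (G.Ad (D.a (t j • u)) W) * G.exp (G.Ad (D.a (t j • u)) (Y j))) * (G.exp (Z j) * l))) F
      (𝓝 (φ * c)) := by
    have := ((hA.mul (hW0.mul hY0)).mul hB).const_mul φ
    rwa [mul_one, mul_one] at this
  have hc : Commute c (D.a u) := by
    have h1 : Tendsto (fun j => m ^ k j * D.a (-(r j • u)) * (G.exp (Z j) * l)) F (𝓝 c) := hA.mul hB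
    refine tendsto_nhds_unique (h1.mul_const (D.a u)) ((h1.const_mul (D.a u)).congr' ?_)
    filter_upwards [hYZV] with j hj
    have e1 := (D.commute_of_mem_M hm u).pow_left (k j)
    have e2 : Commute (D.a (-(r j • u))) (D.a u) := by
      change _ * _ = _ * _
      rw [← D.a_add, ← D.a_add, add_comm]
    have e3 := D.commute_exp_a_smul hj.2.1 1
    have e4 := hla 1
    rw [one_smul] at e3 e4
    exact ((e1.mul_left e2).mul_left (e3.mul_left e4)).eq.symm
  refine ⟨G.toQuotient Γ (φ * c), ?_, D.isPeriodic_of_commute hu hm hγ₀ hc⟩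
  refine mem_closure_of_tendsto (((continuous_toQuotient Γ).tendsto _).comp hlim) ?_
  filter_upwards [hYZV] with j ⟨hYj, hZj, hVj, hj⟩
  set a := D.a (t j • u) with ha
  -- `p` collects everything to the right of `l` in `φ⁻¹ γ₁ z_j = exp W exp Y exp Z l p`. It lies in
  -- `N`, as does its conjugate by `a`, so it can be removed by moving along the orbit.
  set p := l⁻¹ * G.exp (V j) * l * G.exp W' with hp
  have hpN : p ∈ D.N := D.N.mul_mem (D.a_mul_mul_inv_mem_N (D.exp_mem_N hu hVj) hm₁ v)
    (D.exp_mem_N hu hW')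
  have hpa : a * p⁻¹ * a⁻¹ ∈ D.N := by
    have := D.a_mul_mul_inv_mem_N (D.N.inv_mem hpN) D.M.one_mem (-(t j • u))
    rwa [one_mul, D.a_neg, inv_inv] at this
  refine ⟨x j * (a * p⁻¹ * a⁻¹), D.N.mul_mem (hx j) hpa, ?_⟩
  have hpow : (φ * (D.a u * m) * φ⁻¹) ^ k j = φ * (D.a ((k j : ℝ) • u) * m ^ k j) * φ⁻¹ := by
    rw [conj_pow, ← D.a_pow, ((D.commute_of_mem_M hm u).symm).mul_pow]
  have hz : γ₁ * (γ j * g * x j * a) = φ * G.exp W * (G.exp (Y j) * G.exp (Z j)) * l * p := by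
    have h1 : G.exp (Y j) * G.exp (Z j) = s j * (G.exp (V j))⁻¹ := by rw [← hj]; group
    rw [h1, hp]
    change _ = φ * G.exp W * ((G.exp W)⁻¹ * (φ⁻¹ * γ₁ * (γ j * g * x j * a)) * (G.exp W')⁻¹ * l⁻¹ *
      (G.exp (V j))⁻¹) * l * (l⁻¹ * G.exp (V j) * l * G.exp W')
    group
  have hexpW : G.exp (G.Ad a W) = a * G.exp W * a⁻¹ := G.exp_Ad a W
  have hexpY : G.exp (G.Ad a (Y j)) = a * G.exp (Y j) * a⁻¹ := G.exp_Ad a (Y j)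
  have hcomm : a⁻¹ * (G.exp (Z j) * l) = G.exp (Z j) * l * a⁻¹ :=
    (((D.commute_exp_a_smul hZj (t j)).mul_left (hla (t j))).inv_right).eq.symm
  -- The final `a⁻¹` commutes past `exp Z` and `l`. Together with `a_{k_j u} = a_{-r_j u} a` from
  -- the power of the periodic element, it conjugates `exp W exp Y` by `a`, which contracts them.
  have hleft : φ * (m ^ k j * D.a (-(r j • u)) * (G.exp (G.Ad a W) * G.exp (G.Ad a (Y j))) *
      (G.exp (Z j) * l)) =
      (φ * (D.a u * m) * φ⁻¹) ^ k j * (γ₁ * (γ j * (g * (x j * (a * p⁻¹ * a⁻¹))))) := by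
    have e1 : γ₁ * (γ j * (g * (x j * (a * p⁻¹ * a⁻¹)))) =
        γ₁ * (γ j * g * x j * a) * p⁻¹ * a⁻¹ := by group
    have e2 : D.a ((k j : ℝ) • u) * m ^ k j = m ^ k j * D.a ((k j : ℝ) • u) :=
      ((D.commute_of_mem_M hm _).pow_left (k j)).eq.symm
    have e3 : D.a (-(r j • u)) * a = D.a ((k j : ℝ) • u) := by
      rw [ha, ← D.a_add]
      congr 1
      rw [← neg_smul, ← add_smul]
      congr 1
      change -(t j - (k j : ℝ)) + t j = k j
      ring
    calc _ = φ * (m ^ k j * (D.a (-(r j • u)) * a) * G.exp W * G.exp (Y j) *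
          (a⁻¹ * (G.exp (Z j) * l))) := by rw [hexpW, hexpY]; group
      _ = φ * (m ^ k j * D.a ((k j : ℝ) • u)) * φ⁻¹ *
          (φ * G.exp W * (G.exp (Y j) * G.exp (Z j)) * l * p * p⁻¹ * a⁻¹) := by
            rw [e3, hcomm]; group
      _ = _ := by rw [e1, hz, hpow, e2]
  change G.toQuotient Γ (φ * (m ^ k j * D.a (-(r j • u)) *
    (G.exp (G.Ad a W) * G.exp (G.Ad a (Y j))) * (G.exp (Z j) * l))) = _
  rw [hleft, toQuotient_mul_left (Γ.pow_mem hγ₀ _), toQuotient_mul_left hγ₁,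
    toQuotient_mul_left (hγ j), translate_toQuotient]

end CartanData

end ConnectedRealAlgebraicGroup
end

/-! ### Assembly of the theorem -/

theorem mainTheorem6 {n : ℕ} (G : ConnectedRealAlgebraicGroup n)
    (hG : LieAlgebra.IsSemisimple ℝ G.lieAlgebra) (D : G.CartanData)
    (Γ : Subgroup G.Pts) (hΓ : DiscreteTopology Γ) (hΓZ : G.IsZariskiDense Γ)
    (u : D.𝔞) (hu : ∃ γ ∈ Γ, D.JordanProjectionEq γ u) (hu_int : u ∈ interior D.chamber)
    (x : G.LeftQuotient Γ) (hx : D.IsHorosphericalPlus u x) :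
    ∃ x₀ ∈ closure (D.orbitN x), D.IsPeriodic u x₀ := by
  obtain ⟨γ₀, hγ₀, hJ⟩ := hu
  obtain ⟨g, rfl, hg⟩ := hx
  obtain ⟨φ, m, hm, rfl⟩ := D.exists_conj_of_jordanProjection hu_int hJ
  obtain ⟨γ, y, t, z, hγ, hy, ht0, ht, hlim⟩ := D.exists_tendsto_of_isHorospherical hu_int hg
  have hθ := D.θ_coe u
  have hcompl : IsCompl (ConnectedRealAlgebraicGroup.spec (u : G.lieAlgebra) (Set.Ici 0))
      (ConnectedRealAlgebraicGroup.spec (u : G.lieAlgebra) (Set.Iio 0)) :=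
    ⟨D.disjoint_spec hθ (Set.disjoint_left.2 fun _ h h' => (Set.mem_Iio.1 h').not_ge h),
      codisjoint_iff.2 (D.spec_sup_eq_top hθ (Set.union_comm _ _ ▸ Set.Iio_union_Ici))⟩
  -- This places `φ⁻¹ γ₁ z` in the big cell; it is the only use of Zariski density.
  obtain ⟨γ₁, hγ₁, hq⟩ := ConnectedRealAlgebraicGroup.exists_transversal hΓZ hcompl φ⁻¹ z
  exact D.exists_periodic_mem_closure hu_int hm hγ₀ hγ hy ht0 ht hlim hγ₁ hq
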